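/- Let $m\ge 1$ be an integer, let $C$ be a compact connected Riemann surface of genus $g$ (so that $\deg TC=2-2g$), let $p\in C$ be a point, and let $d>m+2-2g$ be an integer. Then there exist a connected complex surface $S$ (Hausdorff, second countable) and a holomorphic embedding $C\hookrightarrow S$ with self-intersection number $C\cdot C=d$ (that is, the normal bundle $NC=TS|_C/TC$ has degree $d$) such that, for every integer $n$ with $0\le n\le m-1$ and every open neighborhood $U$ of $C$ in $S$ (in particular $U=S$), there is no regular holomorphic foliation $\mathcal F$ on $U$ which is transverse to $C$ at every point of $C\setminus\{p\}$ and whose order of tangency with $C$ at $p$ equals $n$. Here a regular foliation on $U$ is a field of tangent lines locally spanned by nowhere vanishing holomorphic vector fields, and its order of tangency with $C$ at $p$ is the order of vanishing at $p$ of the section of $NC$ induced by a local generating vector field ($n=0$ means that $\mathcal F$ is transverse to $C$ at $p$). If moreover $m=1$ (so that $d>3-2g$), then no regular holomorphic foliation defined on a neighborhood of $C$ in $S$ is transverse to $C$ at all points of $C$, and no neighborhood of $C$ in $S$ is biholomorphic to a neighborhood of the zero section in the total space of $NC$ by a map that takes $C$ onto the zero section. -/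

import Mathlib

open scoped Manifold ContDiff Topology Bundle
open Set Bundle

universe u v

noncomputable section

set_option linter.unusedSectionVars false

/-! ### Holomorphic line bundles over a Riemann surface -/

section LineBundles

variable {C : Type u} [TopologicalSpace C] [ChartedSpace ℂ C]
  (E : C → Type v) [TopologicalSpace (TotalSpace ℂ E)] [∀ x, TopologicalSpace (E x)]
  [FiberBundle ℂ E]

/-- The expression of a (set-theoretic) section `s` of a line bundle over a Riemann surface, in the
preferred chart and the preferred trivialization at `x`. -/
def localExpr (s : ∀ x, E x) (x : C) : ℂ → ℂ := fun z =>
  (trivializationAt ℂ E x ⟨(chartAt ℂ x).symm z, s ((chartAt ℂ x).symm z)⟩).2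

/-- The section `s` is meromorphic on all of `C`. -/
def IsMeromorphicSection (s : ∀ x, E x) : Prop :=
  ∀ x : C, MeromorphicAt (localExpr E s x) (chartAt ℂ x x)

/-- The order of vanishing at `x` of a meromorphic section (negative at poles, and `⊤` if
the section vanishes identically near `x`). -/
def sectionOrder (s : ∀ x, E x) (x : C) : WithTop ℤ :=
  meromorphicOrderAt (localExpr E s x) (chartAt ℂ x x)

/-- The line bundle `E` over the compact Riemann surface `C` has degree (Chern number) `d`: the
divisor of a nonzero meromorphic section of `E` has degree `d`. -/
def HasDegree (d : ℤ) : Prop :=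
  ∃ s : ∀ x, E x, IsMeromorphicSection E s ∧ (∀ x, sectionOrder E s x ≠ ⊤) ∧
    {x | sectionOrder E s x ≠ 0}.Finite ∧ ∑ᶠ x, (sectionOrder E s x).untop₀ = d

end LineBundles

/-- The compact Riemann surface `C` has genus `g`: its Euler characteristic, that is the
degree of its tangent bundle, is `2 - 2 * g` (in other words canonical divisors have
degree `2 * g - 2`). -/
def HasGenus (C : Type u) [TopologicalSpace C] [ChartedSpace ℂ C] [IsManifold 𝓘(ℂ) ω C]
    (g : ℕ) : Prop :=
  HasDegree (fun x : C => TangentSpace 𝓘(ℂ) x) (2 - 2 * (g : ℤ))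

/-! ### Embedded curves and their normal bundles -/

/-- A holomorphic embedding of the Riemann surface `C` into the complex surface `S`. -/
structure HolomorphicEmbedding (C : Type u) [TopologicalSpace C] [ChartedSpace ℂ C]
    (S : Type v) [TopologicalSpace S] [ChartedSpace (ℂ × ℂ) S] where
  toFun : C → S
  isEmbedding : Topology.IsEmbedding toFun
  contMDiff : ContMDiff 𝓘(ℂ) 𝓘(ℂ, ℂ × ℂ) ω toFun
  mfderiv_injective : ∀ x, Function.Injective (mfderiv 𝓘(ℂ) 𝓘(ℂ, ℂ × ℂ) toFun x)

section NormalBundle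

variable {C : Type u} [TopologicalSpace C] [ChartedSpace ℂ C]
  {S : Type v} [TopologicalSpace S] [ChartedSpace (ℂ × ℂ) S]

instance : CoeFun (HolomorphicEmbedding C S) (fun _ => C → S) := ⟨HolomorphicEmbedding.toFun⟩

/-- The line tangent to the embedded curve, in the tangent plane of the surface at `i x`. -/
def tangentLine (i : HolomorphicEmbedding C S) (x : C) :
    Submodule ℂ (TangentSpace 𝓘(ℂ, ℂ × ℂ) (i x)) :=
  (mfderiv 𝓘(ℂ) 𝓘(ℂ, ℂ × ℂ) i x).range

/-- The fibre `T_{i x} S / T_x C` of the normal bundle. -/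
abbrev CurveNormalSpace (i : HolomorphicEmbedding C S) (x : C) : Type :=
  TangentSpace 𝓘(ℂ, ℂ × ℂ) (i x) ⧸ tangentLine i x

/-- The class of a tangent vector of the surface in the normal space. -/
def normalClass (i : HolomorphicEmbedding C S) (x : C) (w : TangentSpace 𝓘(ℂ, ℂ × ℂ) (i x)) :
    CurveNormalSpace i x :=
  (tangentLine i x).mkQ w

/-- The determinant of two vectors of `ℂ²`. -/
def detTwo (a b : ℂ × ℂ) : ℂ := a.1 * b.2 - a.2 * b.1

theorem detTwo_map (G : (ℂ × ℂ) →L[ℂ] (ℂ × ℂ)) (a b : ℂ × ℂ) :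
    detTwo (G a) (G b) = detTwo (G (1, 0)) (G (0, 1)) * detTwo a b := by
  have h : ∀ c : ℂ × ℂ, G c = c.1 • G (1, 0) + c.2 • G (0, 1) := by
    intro c
    rw [← map_smul, ← map_smul, ← map_add]
    simp
  rw [h a, h b]
  simp only [detTwo, Prod.fst_add, Prod.snd_add, Prod.smul_fst, Prod.smul_snd, smul_eq_mul]
  ring

theorem detTwo_ker {a b : ℂ × ℂ} (ha : a ≠ 0) (h : detTwo a b = 0) : ∃ c : ℂ, b = c • a := by
  unfold detTwo at h
  by_cases h1 : a.1 = 0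
  · have h2 : a.2 ≠ 0 := fun h2 => ha (Prod.ext h1 h2)
    refine ⟨b.2 / a.2, Prod.ext ?_ ?_⟩
    · have : a.2 * b.1 = 0 := by
        rw [h1] at h
        simpa using h
      simp [h1, (mul_eq_zero.1 this).resolve_left h2]
    · simp [h2]
  · refine ⟨b.1 / a.1, Prod.ext ?_ ?_⟩
    · simp [h1]
    · simp only [Prod.smul_snd, smul_eq_mul]
      field_simp
      linear_combination h

variable [IsManifold 𝓘(ℂ) ω C] [IsManifold 𝓘(ℂ, ℂ × ℂ) ω S]

/-- Local trivialization of the tangent bundle of the curve at `x₀`, backwards. -/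
abbrev curveFrame (x₀ x : C) : TangentSpace 𝓘(ℂ) x :=
  (trivializationAt ℂ (TangentSpace 𝓘(ℂ) : C → Type) x₀).symmL ℂ x (1 : ℂ)

/-- Local trivialization of the tangent bundle of the surface at `y₀`. -/
abbrev surfCoord (y₀ y : S) : TangentSpace 𝓘(ℂ, ℂ × ℂ) y →L[ℂ] (ℂ × ℂ) :=
  (trivializationAt (ℂ × ℂ) (TangentSpace 𝓘(ℂ, ℂ × ℂ) : S → Type) y₀).continuousLinearMapAt ℂ y

/-- The linear form `w ↦ det (∂i/∂z, w)` on `T_{i x} S`, computed in the charts at `x₀`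
and `i x₀`. -/
def normalForm (i : HolomorphicEmbedding C S) (x₀ x : C) :
    TangentSpace 𝓘(ℂ, ℂ × ℂ) (i x) →ₗ[ℂ] ℂ where
  toFun w := detTwo
    (surfCoord (i x₀) (i x) (mfderiv 𝓘(ℂ) 𝓘(ℂ, ℂ × ℂ) i x (curveFrame x₀ x)))
    (surfCoord (i x₀) (i x) w)
  map_add' a b := by
    rw [map_add]
    simp only [detTwo, Prod.fst_add, Prod.snd_add]
    ring
  map_smul' c a := by
    rw [map_smul]
    simp only [detTwo, Prod.smul_fst, Prod.smul_snd, smul_eq_mul, RingHom.id_apply]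
    ring

/-- The domain on which the charts at `x₀` and at `i x₀` trivialize the normal bundle. -/
def normalDomain (i : HolomorphicEmbedding C S) (x₀ : C) : Set C :=
  (chartAt ℂ x₀).source ∩ i ⁻¹' (chartAt (ℂ × ℂ) (i x₀)).source

theorem isOpen_normalDomain (i : HolomorphicEmbedding C S) (x₀ : C) :
    IsOpen (normalDomain i x₀) :=
  (chartAt ℂ x₀).open_source.inter
    ((chartAt (ℂ × ℂ) (i x₀)).open_source.preimage i.contMDiff.continuous)


theorem mfderiv_curveFrame_ne_zero (i : HolomorphicEmbedding C S) {x₀ x : C}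
    (hx : x ∈ normalDomain i x₀) :
    surfCoord (i x₀) (i x) (mfderiv 𝓘(ℂ) 𝓘(ℂ, ℂ × ℂ) i x (curveFrame x₀ x)) ≠ 0 := by
  intro h
  have hS : i x ∈ (trivializationAt (ℂ × ℂ)
      (TangentSpace 𝓘(ℂ, ℂ × ℂ) : S → Type) (i x₀)).baseSet := hx.2
  have hC : x ∈ (trivializationAt ℂ (TangentSpace 𝓘(ℂ) : C → Type) x₀).baseSet := hx.1
  have h1 := congrArg ((trivializationAt (ℂ × ℂ)
      (TangentSpace 𝓘(ℂ, ℂ × ℂ) : S → Type) (i x₀)).symmL ℂ (i x)) h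
  rw [Trivialization.symmL_continuousLinearMapAt _ hS, map_zero] at h1
  have h2 : curveFrame x₀ x = 0 := i.mfderiv_injective x (h1.trans (map_zero _).symm)
  have h3 := congrArg ((trivializationAt ℂ
      (TangentSpace 𝓘(ℂ) : C → Type) x₀).continuousLinearMapAt ℂ x) h2
  rw [Trivialization.continuousLinearMapAt_symmL _ hC, map_zero] at h3
  exact one_ne_zero h3

theorem tangentLine_eq_span (i : HolomorphicEmbedding C S) {x₀ x : C}
    (hx : x ∈ normalDomain i x₀) (w : TangentSpace 𝓘(ℂ, ℂ × ℂ) (i x)) :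
    w ∈ tangentLine i x ↔
      ∃ c : ℂ, w = c • mfderiv 𝓘(ℂ) 𝓘(ℂ, ℂ × ℂ) i x (curveFrame x₀ x) := by
  have hC : x ∈ (trivializationAt ℂ (TangentSpace 𝓘(ℂ) : C → Type) x₀).baseSet := hx.1
  constructor
  · rintro ⟨t, rfl⟩
    refine ⟨(trivializationAt ℂ (TangentSpace 𝓘(ℂ) : C → Type) x₀).continuousLinearMapAt ℂ x t, ?_⟩
    rw [← map_smul, ← map_smul, smul_eq_mul, mul_one,
      Trivialization.symmL_continuousLinearMapAt _ hC]
    rfl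
  · rintro ⟨c, rfl⟩
    exact Submodule.smul_mem _ _ ⟨_, rfl⟩

theorem normalForm_eq_zero_iff (i : HolomorphicEmbedding C S) {x₀ x : C}
    (hx : x ∈ normalDomain i x₀) (w : TangentSpace 𝓘(ℂ, ℂ × ℂ) (i x)) :
    normalForm i x₀ x w = 0 ↔ w ∈ tangentLine i x := by
  rw [tangentLine_eq_span i hx]
  constructor
  · intro h
    obtain ⟨c, hc⟩ := detTwo_ker (mfderiv_curveFrame_ne_zero i hx) h
    refine ⟨c, ?_⟩
    have hS : i x ∈ (trivializationAt (ℂ × ℂ)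
      (TangentSpace 𝓘(ℂ, ℂ × ℂ) : S → Type) (i x₀)).baseSet := hx.2
    rw [← map_smul] at hc
    have h1 := congrArg ((trivializationAt (ℂ × ℂ)
      (TangentSpace 𝓘(ℂ, ℂ × ℂ) : S → Type) (i x₀)).symmL ℂ (i x)) hc
    rwa [Trivialization.symmL_continuousLinearMapAt _ hS,
      Trivialization.symmL_continuousLinearMapAt _ hS] at h1
  · rintro ⟨c, rfl⟩
    rw [map_smul]
    have : normalForm i x₀ x (mfderiv 𝓘(ℂ) 𝓘(ℂ, ℂ × ℂ) i x (curveFrame x₀ x)) = 0 := by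
      simp only [normalForm, LinearMap.coe_mk, AddHom.coe_mk, detTwo]
      ring
    rw [this, smul_zero]

theorem normalForm_surjective (i : HolomorphicEmbedding C S) {x₀ x : C}
    (hx : x ∈ normalDomain i x₀) : Function.Surjective (normalForm i x₀ x) := by
  have hS : i x ∈ (trivializationAt (ℂ × ℂ)
      (TangentSpace 𝓘(ℂ, ℂ × ℂ) : S → Type) (i x₀)).baseSet := hx.2
  apply LinearMap.surjective
  intro h0
  apply mfderiv_curveFrame_ne_zero i hx
  have key : ∀ b : ℂ × ℂ, detTwo
      (surfCoord (i x₀) (i x) (mfderiv 𝓘(ℂ) 𝓘(ℂ, ℂ × ℂ) i x (curveFrame x₀ x))) b = 0 := by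
    intro b
    have := LinearMap.congr_fun h0 ((trivializationAt (ℂ × ℂ)
      (TangentSpace 𝓘(ℂ, ℂ × ℂ) : S → Type) (i x₀)).symmL ℂ (i x) b)
    simp only [normalForm, LinearMap.coe_mk, AddHom.coe_mk, LinearMap.zero_apply] at this
    rwa [Trivialization.continuousLinearMapAt_symmL _ hS] at this
  have k1 := key (1, 0)
  have k2 := key (0, 1)
  simp only [detTwo, mul_zero, mul_one, zero_sub, neg_eq_zero, sub_zero] at k1 k2
  exact Prod.ext k2 k1

/-- The linear coordinate on the normal space at `x` given by the charts at `x₀` and `i x₀`. -/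
def normalCoord (i : HolomorphicEmbedding C S) (x₀ x : C) : CurveNormalSpace i x →ₗ[ℂ] ℂ :=
  open Classical in
  if h : x ∈ normalDomain i x₀ then
    (tangentLine i x).liftQ (normalForm i x₀ x)
      (fun w hw => (normalForm_eq_zero_iff i h w).2 hw)
  else 0

theorem normalCoord_class (i : HolomorphicEmbedding C S) {x₀ x : C}
    (hx : x ∈ normalDomain i x₀) (w : TangentSpace 𝓘(ℂ, ℂ × ℂ) (i x)) :
    normalCoord i x₀ x (normalClass i x w) = normalForm i x₀ x w := by
  simp only [normalCoord, dif_pos hx, normalClass]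
  exact Submodule.liftQ_apply _ _ _

theorem normalCoord_bijective (i : HolomorphicEmbedding C S) {x₀ x : C}
    (hx : x ∈ normalDomain i x₀) : Function.Bijective (normalCoord i x₀ x) := by
  constructor
  · rw [injective_iff_map_eq_zero]
    intro a ha
    obtain ⟨w, rfl⟩ := (tangentLine i x).mkQ_surjective a
    have h : normalForm i x₀ x w = 0 := (normalCoord_class i hx w).symm.trans ha
    simpa using (normalForm_eq_zero_iff i hx w).1 h
  · intro c
    obtain ⟨w, rfl⟩ := normalForm_surjective i hx c
    exact ⟨_, normalCoord_class i hx w⟩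

/-- The local trivialization of the normal bundle given by the charts at `x₀` and `i x₀`. -/
def normalTriv (i : HolomorphicEmbedding C S) (x₀ : C) :
    Pretrivialization ℂ (π ℂ (CurveNormalSpace i)) where
  toFun z := (z.1, normalCoord i x₀ z.1 z.2)
  invFun q := ⟨q.1, Function.invFun (normalCoord i x₀ q.1) q.2⟩
  source := π ℂ (CurveNormalSpace i) ⁻¹' normalDomain i x₀
  target := normalDomain i x₀ ×ˢ univ
  map_source' z hz := ⟨hz, mem_univ _⟩
  map_target' q hq := hq.1
  left_inv' z hz := by
    have := Function.leftInverse_invFun (normalCoord_bijective i (x₀ := x₀) (x := z.1) hz).1 z.2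
    exact congrArg (TotalSpace.mk z.1) this
  right_inv' q hq := Prod.ext rfl
    (Function.rightInverse_invFun (normalCoord_bijective i hq.1).2 q.2)
  open_target := (isOpen_normalDomain i x₀).prod isOpen_univ
  baseSet := normalDomain i x₀
  open_baseSet := isOpen_normalDomain i x₀
  source_eq := rfl
  target_eq := rfl
  proj_toFun _ _ := rfl

theorem normalTriv_symm (i : HolomorphicEmbedding C S) {x₀ x : C}
    (hx : x ∈ normalDomain i x₀) (w : TangentSpace 𝓘(ℂ, ℂ × ℂ) (i x)) :
    (normalTriv i x₀).symm x (normalForm i x₀ x w) = normalClass i x w := by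
  apply (normalCoord_bijective i hx).1
  have h := (normalTriv i x₀).apply_mk_symm (b := x) hx (normalForm i x₀ x w)
  rw [normalCoord_class i hx]
  exact congrArg Prod.snd h

/-- The coordinate change of the normal bundle: the Jacobian determinant of the change of charts of
the surface times the derivative of the change of charts of the curve. -/
def normalChange (i : HolomorphicEmbedding C S) (x₀ x₁ x : C) : ℂ :=
  detTwo
    (((trivializationAt (ℂ × ℂ) (TangentSpace 𝓘(ℂ, ℂ × ℂ) : S → Type) (i x₀)).coordChangeL ℂ
      (trivializationAt (ℂ × ℂ) (TangentSpace 𝓘(ℂ, ℂ × ℂ) : S → Type) (i x₁)) (i x)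
        : (ℂ × ℂ) →L[ℂ] (ℂ × ℂ)) (1, 0))
    (((trivializationAt (ℂ × ℂ) (TangentSpace 𝓘(ℂ, ℂ × ℂ) : S → Type) (i x₀)).coordChangeL ℂ
      (trivializationAt (ℂ × ℂ) (TangentSpace 𝓘(ℂ, ℂ × ℂ) : S → Type) (i x₁)) (i x)
        : (ℂ × ℂ) →L[ℂ] (ℂ × ℂ)) (0, 1)) *
  ((trivializationAt ℂ (TangentSpace 𝓘(ℂ) : C → Type) x₁).coordChangeL ℂ
      (trivializationAt ℂ (TangentSpace 𝓘(ℂ) : C → Type) x₀) x : ℂ →L[ℂ] ℂ) 1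

theorem surfCoord_change {y₀ y₁ y : S}
    (h₀ : y ∈ (chartAt (ℂ × ℂ) y₀).source) (h₁ : y ∈ (chartAt (ℂ × ℂ) y₁).source)
    (w : TangentSpace 𝓘(ℂ, ℂ × ℂ) y) :
    ((trivializationAt (ℂ × ℂ) (TangentSpace 𝓘(ℂ, ℂ × ℂ) : S → Type) y₀).coordChangeL ℂ
      (trivializationAt (ℂ × ℂ) (TangentSpace 𝓘(ℂ, ℂ × ℂ) : S → Type) y₁) y
        : (ℂ × ℂ) →L[ℂ] (ℂ × ℂ)) (surfCoord y₀ y w) = surfCoord y₁ y w := by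
  have h₀' : y ∈ (trivializationAt (ℂ × ℂ)
      (TangentSpace 𝓘(ℂ, ℂ × ℂ) : S → Type) y₀).baseSet := h₀
  have h₁' : y ∈ (trivializationAt (ℂ × ℂ)
      (TangentSpace 𝓘(ℂ, ℂ × ℂ) : S → Type) y₁).baseSet := h₁
  have e := Trivialization.coordChangeL_apply (R := ℂ)
    (trivializationAt (ℂ × ℂ) (TangentSpace 𝓘(ℂ, ℂ × ℂ) : S → Type) y₀)
    (trivializationAt (ℂ × ℂ) (TangentSpace 𝓘(ℂ, ℂ × ℂ) : S → Type) y₁)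
    ⟨h₀', h₁'⟩ (surfCoord y₀ y w)
  refine e.trans ?_
  have h3 := Trivialization.symmL_continuousLinearMapAt (R := ℂ) _ h₀' w
  rw [Trivialization.symmL_apply _ h₀'] at h3
  rw [h3, Trivialization.continuousLinearMapAt_apply_of_mem (R := ℂ) _ h₁']

theorem curveFrame_change {x₀ x₁ x : C}
    (h₀ : x ∈ (chartAt ℂ x₀).source) (h₁ : x ∈ (chartAt ℂ x₁).source) :
    (curveFrame x₁ x : TangentSpace 𝓘(ℂ) x) =
      (((trivializationAt ℂ (TangentSpace 𝓘(ℂ) : C → Type) x₁).coordChangeL ℂ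
      (trivializationAt ℂ (TangentSpace 𝓘(ℂ) : C → Type) x₀) x : ℂ →L[ℂ] ℂ) 1) •
      (curveFrame x₀ x : TangentSpace 𝓘(ℂ) x) := by
  have h₀' : x ∈ (trivializationAt ℂ (TangentSpace 𝓘(ℂ) : C → Type) x₀).baseSet := h₀
  have h₁' : x ∈ (trivializationAt ℂ (TangentSpace 𝓘(ℂ) : C → Type) x₁).baseSet := h₁
  have e := Trivialization.coordChangeL_apply (R := ℂ)
    (trivializationAt ℂ (TangentSpace 𝓘(ℂ) : C → Type) x₁)
    (trivializationAt ℂ (TangentSpace 𝓘(ℂ) : C → Type) x₀) ⟨h₁', h₀'⟩ (1 : ℂ)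
  rw [← map_smul, smul_eq_mul, mul_one]
  rw [ContinuousLinearEquiv.coe_coe, e, ← Trivialization.symmL_apply (R := ℂ) _ h₁',
    ← Trivialization.continuousLinearMapAt_apply_of_mem (R := ℂ) _ h₀',
    Trivialization.symmL_continuousLinearMapAt _ h₀']

theorem normalForm_change (i : HolomorphicEmbedding C S) {x₀ x₁ x : C}
    (h₀ : x ∈ normalDomain i x₀) (h₁ : x ∈ normalDomain i x₁)
    (w : TangentSpace 𝓘(ℂ, ℂ × ℂ) (i x)) :
    normalForm i x₁ x w = normalChange i x₀ x₁ x * normalForm i x₀ x w := by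
  simp only [normalForm, LinearMap.coe_mk, AddHom.coe_mk, normalChange]
  rw [curveFrame_change h₀.1 h₁.1, map_smul, map_smul, ← surfCoord_change h₀.2 h₁.2 w,
    ← surfCoord_change h₀.2 h₁.2 (mfderiv 𝓘(ℂ) 𝓘(ℂ, ℂ × ℂ) i x (curveFrame x₀ x))]
  have := detTwo_map ((trivializationAt (ℂ × ℂ)
    (TangentSpace 𝓘(ℂ, ℂ × ℂ) : S → Type) (i x₀)).coordChangeL ℂ
      (trivializationAt (ℂ × ℂ) (TangentSpace 𝓘(ℂ, ℂ × ℂ) : S → Type) (i x₁)) (i x)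
        : (ℂ × ℂ) →L[ℂ] (ℂ × ℂ))
    (surfCoord (i x₀) (i x) (mfderiv 𝓘(ℂ) 𝓘(ℂ, ℂ × ℂ) i x (curveFrame x₀ x)))
    (surfCoord (i x₀) (i x) w)
  rw [mul_right_comm, ← this]
  simp only [detTwo, Prod.smul_fst, Prod.smul_snd, smul_eq_mul]
  ring

theorem contMDiffOn_detTwo_mul {A : C → (ℂ × ℂ) →L[ℂ] (ℂ × ℂ)} {B : C → ℂ →L[ℂ] ℂ} {s : Set C}
    (hA : ContMDiffOn 𝓘(ℂ) 𝓘(ℂ, (ℂ × ℂ) →L[ℂ] (ℂ × ℂ)) ω A s)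
    (hB : ContMDiffOn 𝓘(ℂ) 𝓘(ℂ, ℂ →L[ℂ] ℂ) ω B s) :
    ContMDiffOn 𝓘(ℂ) 𝓘(ℂ) ω (fun x => detTwo (A x (1, 0)) (A x (0, 1)) * B x 1) s := by
  have e1 : ContMDiffOn 𝓘(ℂ) 𝓘(ℂ, ℂ × ℂ) ω (fun x => A x (1, 0)) s :=
    hA.clm_apply contMDiffOn_const
  have e2 : ContMDiffOn 𝓘(ℂ) 𝓘(ℂ, ℂ × ℂ) ω (fun x => A x (0, 1)) s :=
    hA.clm_apply contMDiffOn_const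
  have e3 : ContMDiffOn 𝓘(ℂ) 𝓘(ℂ) ω (fun x => B x 1) s := hB.clm_apply contMDiffOn_const
  have p1 : ContMDiff 𝓘(ℂ, ℂ × ℂ) 𝓘(ℂ) ω (Prod.fst : ℂ × ℂ → ℂ) := contDiff_fst.contMDiff
  have p2 : ContMDiff 𝓘(ℂ, ℂ × ℂ) 𝓘(ℂ) ω (Prod.snd : ℂ × ℂ → ℂ) := contDiff_snd.contMDiff
  exact (((p1.comp_contMDiffOn e1).mul (p2.comp_contMDiffOn e2)).sub
    ((p2.comp_contMDiffOn e1).mul (p1.comp_contMDiffOn e2))).mul e3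

theorem contMDiffOn_normalChange (i : HolomorphicEmbedding C S) (x₀ x₁ : C) :
    ContMDiffOn 𝓘(ℂ) 𝓘(ℂ) ω (normalChange i x₀ x₁) (normalDomain i x₀ ∩ normalDomain i x₁) := by
  have hS := contMDiffOn_coordChangeL (n := ω) (IB := 𝓘(ℂ, ℂ × ℂ))
      (trivializationAt (ℂ × ℂ) (TangentSpace 𝓘(ℂ, ℂ × ℂ) : S → Type) (i x₀))
      (trivializationAt (ℂ × ℂ) (TangentSpace 𝓘(ℂ, ℂ × ℂ) : S → Type) (i x₁))
  have hC := contMDiffOn_coordChangeL (n := ω) (IB := 𝓘(ℂ))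
      (trivializationAt ℂ (TangentSpace 𝓘(ℂ) : C → Type) x₁)
      (trivializationAt ℂ (TangentSpace 𝓘(ℂ) : C → Type) x₀)
  have hS' := hS.comp (i.contMDiff.contMDiffOn (s := normalDomain i x₀ ∩ normalDomain i x₁))
    (fun x hx => ⟨hx.1.2, hx.2.2⟩)
  have hC' := hC.mono (show normalDomain i x₀ ∩ normalDomain i x₁ ⊆ _ from
    fun x hx => ⟨hx.2.1, hx.1.1⟩)
  exact contMDiffOn_detTwo_mul hS' hC'

/-- The normal bundle of an embedded curve, as a vector bundle given by its local trivializations. -/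
def normalPrebundle (i : HolomorphicEmbedding C S) :
    VectorPrebundle ℂ ℂ (CurveNormalSpace i) where
  pretrivializationAtlas := range (normalTriv i)
  pretrivialization_linear' := by
    rintro _ ⟨x₀, rfl⟩
    exact ⟨fun b _ => ⟨map_add (normalCoord i x₀ b), map_smul (normalCoord i x₀ b)⟩⟩
  pretrivializationAt := normalTriv i
  mem_base_pretrivializationAt x := ⟨mem_chart_source ℂ x, mem_chart_source (ℂ × ℂ) (i x)⟩
  pretrivialization_mem_atlas x := mem_range_self x
  exists_coordChange := by
    rintro _ ⟨x₀, rfl⟩ _ ⟨x₁, rfl⟩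
    refine ⟨fun x => normalChange i x₀ x₁ x • ContinuousLinearMap.id ℂ ℂ, ?_, ?_⟩
    · exact (contMDiffOn_normalChange i x₀ x₁).continuousOn.smul continuousOn_const
    · rintro x ⟨h₀, h₁⟩ c
      obtain ⟨w, rfl⟩ := normalForm_surjective i h₀ c
      rw [normalTriv_symm i h₀]
      exact (normalForm_change i h₀ h₁ w).symm.trans (normalCoord_class i h₁ w).symm
  totalSpaceMk_isInducing x := by
    have hx : x ∈ normalDomain i x := ⟨mem_chart_source ℂ x, mem_chart_source (ℂ × ℂ) (i x)⟩
    have : FiniteDimensional ℂ (TangentSpace 𝓘(ℂ, ℂ × ℂ) (i x)) :=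
      inferInstanceAs (FiniteDimensional ℂ (ℂ × ℂ))
    have : T2Space (TangentSpace 𝓘(ℂ, ℂ × ℂ) (i x)) := inferInstanceAs (T2Space (ℂ × ℂ))
    have : IsClosed (tangentLine i x : Set (TangentSpace 𝓘(ℂ, ℂ × ℂ) (i x))) :=
      Submodule.closed_of_finiteDimensional (tangentLine i x)
    have : T3Space (CurveNormalSpace i x) := Submodule.t3_quotient_of_isClosed (tangentLine i x)
    have h1 : Topology.IsInducing (normalCoord i x x) :=
      (LinearEquiv.ofBijective (normalCoord i x x)
        (normalCoord_bijective i hx)).toContinuousLinearEquiv.toHomeomorph.isInducing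
    have h2 : Topology.IsInducing (fun c : ℂ => (x, c)) := isInducing_prodMkRight x
    exact h2.comp h1

instance (i : HolomorphicEmbedding C S) : TopologicalSpace (TotalSpace ℂ (CurveNormalSpace i)) :=
  (normalPrebundle i).totalSpaceTopology

instance (i : HolomorphicEmbedding C S) : FiberBundle ℂ (CurveNormalSpace i) :=
  (normalPrebundle i).toFiberBundle

instance (i : HolomorphicEmbedding C S) : VectorBundle ℂ ℂ (CurveNormalSpace i) :=
  (normalPrebundle i).toVectorBundle

instance (i : HolomorphicEmbedding C S) : (normalPrebundle i).IsContMDiff 𝓘(ℂ) ω where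
  exists_contMDiffCoordChange := by
    rintro _ ⟨x₀, rfl⟩ _ ⟨x₁, rfl⟩
    refine ⟨fun x => normalChange i x₀ x₁ x • ContinuousLinearMap.id ℂ ℂ, ?_, ?_⟩
    · exact (contMDiffOn_normalChange i x₀ x₁).smul contMDiffOn_const
    · rintro x ⟨h₀, h₁⟩ c
      obtain ⟨w, rfl⟩ := normalForm_surjective i h₀ c
      rw [normalTriv_symm i h₀]
      exact (normalForm_change i h₀ h₁ w).symm.trans (normalCoord_class i h₁ w).symm

instance (i : HolomorphicEmbedding C S) :
    ContMDiffVectorBundle ω ℂ (CurveNormalSpace i) 𝓘(ℂ) :=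
  (normalPrebundle i).contMDiffVectorBundle 𝓘(ℂ)

/-- The self-intersection number of the embedded compact curve is `d`: the normal bundle has
Chern number `d`. -/
def HasSelfIntersection (i : HolomorphicEmbedding C S) (d : ℤ) : Prop :=
  HasDegree (CurveNormalSpace i) d

/-- Some neighbourhood of the embedded curve in `S` is biholomorphic to a neighbourhood of the zero
section in the total space of the normal bundle, by a map taking the curve to the zero
section. -/
def IsLinearizable (i : HolomorphicEmbedding C S) : Prop :=
  ∃ e : OpenPartialHomeomorph S (TotalSpace ℂ (CurveNormalSpace i)),
    range i ⊆ e.source ∧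
    e '' range i = range (zeroSection ℂ (CurveNormalSpace i)) ∧
    ContMDiffOn 𝓘(ℂ, ℂ × ℂ) (𝓘(ℂ).prod 𝓘(ℂ)) ω e e.source ∧
    ContMDiffOn (𝓘(ℂ).prod 𝓘(ℂ)) 𝓘(ℂ, ℂ × ℂ) ω e.symm e.target

end NormalBundle

/-! ### Regular foliations -/

section Foliations

variable {S : Type v} [TopologicalSpace S] [ChartedSpace (ℂ × ℂ) S]
  [IsManifold 𝓘(ℂ, ℂ × ℂ) ω S]

/-- `v` is a holomorphic vector field on the open set `V` of the surface, and it spans at every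
point of `V` the line `L`. -/
structure IsGenerator (L : ∀ y : S, Submodule ℂ (TangentSpace 𝓘(ℂ, ℂ × ℂ) y))
    (V : Set S) (v : ∀ y : S, TangentSpace 𝓘(ℂ, ℂ × ℂ) y) : Prop where
  isOpen : IsOpen V
  holomorphic : ContMDiffOn 𝓘(ℂ, ℂ × ℂ) 𝓘(ℂ, ℂ × ℂ).tangent ω
    (fun y => (⟨y, v y⟩ : TangentBundle 𝓘(ℂ, ℂ × ℂ) S)) V
  ne_zero : ∀ y ∈ V, v y ≠ 0
  span_eq : ∀ y ∈ V, L y = Submodule.span ℂ {v y}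

/-- A regular (nonsingular) holomorphic foliation by curves on the open subset `U` of the surface
`S`: a holomorphic line subbundle of the tangent bundle of `U`, that is, a field of tangent lines
locally spanned by nowhere vanishing holomorphic vector fields. (The values of `line` outside of `U`
are irrelevant; integrability is automatic for line fields.) -/
structure RegularFoliation (U : Set S) where
  line : ∀ y : S, Submodule ℂ (TangentSpace 𝓘(ℂ, ℂ × ℂ) y)
  exists_generator : ∀ y ∈ U, ∃ V v, y ∈ V ∧ V ⊆ U ∧ IsGenerator line V v

variable {C : Type u} [TopologicalSpace C] [ChartedSpace ℂ C] [IsManifold 𝓘(ℂ) ω C]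
  {U : Set S}

/-- The foliation is transverse to the curve at its point `x`. -/
def RegularFoliation.IsTransverseAt (F : RegularFoliation U) (i : HolomorphicEmbedding C S)
    (x : C) : Prop :=
  F.line (i x) ⊓ tangentLine i x = ⊥

/-- The order of tangency at `x` between the foliation and the curve is `n`: for a generating vector
field `v` of the foliation near `i x`, the section of the normal bundle of the curve defined by `v`
vanishes to order `n` at `x`. -/
def RegularFoliation.HasTangencyOrder (F : RegularFoliation U) (i : HolomorphicEmbedding C S)
    (x : C) (n : ℕ) : Prop :=
  ∃ V v, i x ∈ V ∧ V ⊆ U ∧ IsGenerator F.line V v ∧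
    sectionOrder (CurveNormalSpace i) (fun y => normalClass i y (v (i y))) x = ((n : ℤ) : WithTop ℤ)

end Foliations

end

/-!
Let `l = 2 - 2 g` be the degree of the tangent bundle of `C`, put `q = d - l`, and let `ζ` be a
coordinate of `C` centred at `p`. Away from `p` the surface looks like `C × ℂ` along the curve
`w = 0`, and close to `p` it looks like a disc times `ℂ`, again along the zero section. The two
pieces are glued (`transition`) by the map which in the coordinate `ζ` reads
`(z, w) ↦ (z e ^ u, (z e ^ u) ^ q u)` with `u = z ^ l w` (`twistMap`); it is the identity on the curve. Its derivative
at the point `(ζ, 0)` of the curve is `(v₁, v₂) ↦ (v₁ + ζ ^ (l + 1) v₂, ζ ^ (q + l) v₂)`. The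
second component shows that the section `∂/∂w` of the normal bundle has divisor `(q + l) p = d p`,
so the self-intersection number is `d` (`TwistedSurface.hasSelfIntersection`). To make the glued
space Hausdorff, the outer piece is cut down to `|u| < 1` close to `p`; then `|z| < e < 3`
whenever the image of `(z, w)` lies over the unit disc, so that the gluing takes place well inside
a coordinate disc of radius `3`.

The first component carries the obstruction. Suppose that a foliation is transverse to the curve
away from `p` and has order of tangency `n < m` at `p`. Away from `p`, its lines are spanned along
the curve by the fields `b ∂/∂z + ∂/∂w` for a holomorphic vector field `b ∂/∂z` on `C \ {p}`
(`TwistedSurface.slopeField`). If `(V₁, V₂)` is a generator close to `p`, then `V₂` has order `n`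
at `p`, and the displayed derivative gives `b = ζ ^ (q + l) V₁ / V₂ - ζ ^ (l + 1)`. As
`q + l - n > l + 1`, the field `b ∂/∂z` is meromorphic and vanishes at `p` to the order `l + 1` exactly
(`TwistedSurface.meromorphicOrderAt_slopeField`). It has no poles away from `p`, so its divisor
has degree greater than `l`, whereas the degree of every nonzero meromorphic vector field is `l`
(`TwistedSurface.order_vectorExpr_le`). This last fact rests on the vanishing of the degree of a
principal divisor (`IsMeromorphic.finsum_orderAt_eq_zero`), which is proved by counting preimages:
the number of zeros of `f - c` with multiplicity is the number of points where `f` takes a value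
close to `c` (`IsMeromorphic.eventually_ncard_eq`), hence is locally constant in `c`; it is the
number of zeros of `f` for `c = 0`, and for large `c`, by the same argument for `1 / f`, it is the
number of poles.

A foliation transverse to the curve at every point has order of tangency `0` at `p`
(`TwistedSurface.hasTangencyOrder_zero`). If a neighbourhood of the curve were linearizable, then
the fibres of the normal bundle would give such a foliation
(`IsLinearizable.exists_transverse_foliation`): it is the foliation by level sets of the
projection to `C`, near the zero section.
-/

noncomputable section

set_option linter.unusedSectionVars false

open Filter

/-! ### Local behaviour of meromorphic functions -/

theorem Complex.ncard_setOf_pow_eq {k : ℕ} (hk : k ≠ 0) {c : ℂ} (hc : c ≠ 0) :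
    {t : ℂ | t ^ k = c}.ncard = k := by
  have hp := Complex.isPrimitiveRoot_exp k hk
  have hn := hp.nthRoots_nodup hc
  have h1 : {t : ℂ | t ^ k = c} = ((Polynomial.nthRoots k c).toFinset : Set ℂ) := by
    ext t
    simp [Polynomial.mem_nthRoots (Nat.pos_of_ne_zero hk)]
  rw [h1, Set.ncard_coe_finset, Multiset.toFinset_card_of_nodup hn, hp.card_nthRoots, if_pos]
  exact IsAlgClosed.exists_pow_nat_eq c (Nat.pos_of_ne_zero hk)

/-- A holomorphic function with a zero of order `k` is the `k`-th power of a local coordinate. -/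
theorem exists_openPartialHomeomorph_pow_eq {g : ℂ → ℂ} {z₀ : ℂ} (hg : AnalyticAt ℂ g z₀)
    (hg0 : g z₀ ≠ 0) {k : ℕ} (hk : k ≠ 0) :
    ∃ φ : OpenPartialHomeomorph ℂ ℂ, z₀ ∈ φ.source ∧ φ z₀ = 0 ∧
      ∀ z ∈ φ.source, φ z ^ k = (z - z₀) ^ k * g z := by
  obtain ⟨r, hr⟩ := IsAlgClosed.exists_pow_nat_eq (g z₀) (Nat.pos_of_ne_zero hk)
  set v : ℂ → ℂ := fun z => r * (g z / g z₀) ^ ((k : ℂ)⁻¹) with hv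
  have hvk : ∀ z, v z ^ k = g z := by
    intro z
    rw [hv]
    simp only
    rw [mul_pow, Complex.cpow_nat_inv_pow _ hk, hr, mul_div_cancel₀ _ hg0]
  have hva : AnalyticAt ℂ v z₀ := by
    refine analyticAt_const.mul ((hg.div_const).cpow analyticAt_const ?_)
    rw [div_self hg0]
    exact Complex.one_mem_slitPlane
  have hv0 : v z₀ ≠ 0 := by
    intro h
    apply hg0
    rw [← hvk z₀, h, zero_pow hk]
  have hua : AnalyticAt ℂ (fun z => (z - z₀) * v z) z₀ := by fun_prop
  have hd : HasStrictDerivAt (fun z => (z - z₀) * v z) (v z₀) z₀ := by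
    have := hua.hasStrictDerivAt
    have h2 : deriv (fun z => (z - z₀) * v z) z₀ = v z₀ := by
      have h3 := ((hasDerivAt_id z₀).sub_const z₀).mul hva.differentiableAt.hasDerivAt
      have := h3.deriv
      simp only [Pi.mul_def] at this
      simpa using this
    rwa [h2] at this
  have hd' := hd.hasStrictFDerivAt_equiv hv0
  refine ⟨hd'.toOpenPartialHomeomorph _, hd'.mem_toOpenPartialHomeomorph_source, by simp, ?_⟩
  intro z _
  simp [mul_pow, hvk]

/-- A meromorphic function with a zero of order `k` takes every small nonzero value exactly `k`
times near the zero. -/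
theorem exists_open_ncard_tendsto_eq {f : ℂ → ℂ} {z₀ : ℂ} (hf : MeromorphicAt f z₀) {k : ℕ}
    (hk : k ≠ 0) (hfk : meromorphicOrderAt f z₀ = (k : ℤ)) {W₀ : Set ℂ} (hW₀ : W₀ ∈ 𝓝 z₀) :
    ∃ W ⊆ W₀, IsOpen W ∧ z₀ ∈ W ∧
      ∀ᶠ ε in 𝓝[≠] (0 : ℂ), {z ∈ W | Tendsto f (𝓝[≠] z) (𝓝 ε)}.ncard = k := by
  obtain ⟨g, hg, hg0, hfg⟩ := (meromorphicOrderAt_eq_int_iff hf).1 hfk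
  obtain ⟨φ, hφ, hφ0, hφk⟩ := exists_openPartialHomeomorph_pow_eq hg hg0 hk
  rw [eventually_nhdsWithin_iff] at hfg
  obtain ⟨N, hN, hNo, hzN⟩ := eventually_nhds_iff.1 (hfg.and hW₀)
  have hopen : IsOpen (φ '' (φ.source ∩ N)) :=
    φ.isOpen_image_of_subset_source (φ.open_source.inter hNo) inter_subset_left
  obtain ⟨r, hr, hball⟩ := Metric.isOpen_iff.1 hopen 0 ⟨z₀, ⟨hφ, hzN⟩, hφ0⟩
  have hWo : IsOpen (φ.source ∩ φ ⁻¹' (Metric.ball 0 r)) :=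
    φ.isOpen_inter_preimage Metric.isOpen_ball
  set W := φ.source ∩ φ ⁻¹' (Metric.ball 0 r) ∩ N with hW
  have hWo' : IsOpen W := hWo.inter hNo
  refine ⟨W, fun z hz => (hN z hz.2).2, hWo', ⟨⟨hφ, by simp [hφ0, hr]⟩, hzN⟩, ?_⟩
  have key : ∀ z ∈ W, Tendsto f (𝓝[≠] z) (𝓝 (φ z ^ k)) := by
    intro z hz
    have h1 : Tendsto (fun y => φ y ^ k) (𝓝[≠] z) (𝓝 (φ z ^ k)) :=
      ((φ.continuousAt hz.1.1).pow k).tendsto.mono_left nhdsWithin_le_nhds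
    refine h1.congr' ?_
    have h2 : ∀ᶠ y in 𝓝[≠] z, y ≠ z₀ := by
      rcases eq_or_ne z z₀ with rfl | h
      · exact self_mem_nhdsWithin
      · exact nhdsWithin_le_nhds (isOpen_ne.mem_nhds h)
    filter_upwards [h2, nhdsWithin_le_nhds (hWo'.mem_nhds hz)] with y hy hyW
    rw [hφk y hyW.1.1, (hN y hyW.2).1 hy, zpow_natCast, smul_eq_mul]
  have hε : ∀ᶠ ε in 𝓝[≠] (0 : ℂ), ε ≠ 0 ∧ ‖ε‖ < r ^ k := by
    refine (eventually_nhdsWithin_of_forall fun x hx => hx).and (nhdsWithin_le_nhds ?_)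
    exact continuous_norm.continuousAt.eventually_lt continuousAt_const (by simpa using pow_pos hr k)
  filter_upwards [hε] with ε hε
  have h3 : {z ∈ W | Tendsto f (𝓝[≠] z) (𝓝 ε)} = {z ∈ W | φ z ^ k = ε} := by
    ext z
    refine and_congr_right fun hz => ⟨fun h => tendsto_nhds_unique (key z hz) h, fun h => ?_⟩
    rw [← h]
    exact key z hz
  have h4 : φ '' {z ∈ W | φ z ^ k = ε} = {t | t ^ k = ε} := by
    ext t
    constructor
    · rintro ⟨z, hz, rfl⟩
      exact hz.2
    · intro ht
      have h5 : t ∈ Metric.ball (0 : ℂ) r := by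
        rw [mem_ball_zero_iff]
        refine lt_of_pow_lt_pow_left₀ k hr.le ?_
        rw [← norm_pow, show t ^ k = ε from ht]
        exact hε.2
      obtain ⟨z, hz, rfl⟩ := hball h5
      exact ⟨z, ⟨⟨⟨hz.1, h5⟩, hz.2⟩, ht⟩, rfl⟩
  rw [h3, ← (φ.injOn.mono fun z hz => hz.1.1.1 : InjOn φ {z ∈ W | φ z ^ k = ε}).ncard_image, h4]
  exact Complex.ncard_setOf_pow_eq hk hε.1

/-- Near a point that is not a zero, a meromorphic function does not take small values. -/
theorem eventually_not_tendsto_of_order_nonpos {f : ℂ → ℂ} {z₀ : ℂ} (hf : MeromorphicAt f z₀)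
    (h0 : meromorphicOrderAt f z₀ ≤ 0) :
    ∃ W, IsOpen W ∧ z₀ ∈ W ∧
      ∀ᶠ ε in 𝓝 (0 : ℂ), ∀ z ∈ W, ¬ Tendsto f (𝓝[≠] z) (𝓝 ε) := by
  have hδ : ∃ δ > 0, ∀ᶠ z in 𝓝[≠] z₀, δ ≤ ‖f z‖ := by
    rcases h0.lt_or_eq with h | h
    · refine ⟨1, one_pos, ?_⟩
      have := tendsto_norm_atTop_iff_cobounded.2 (tendsto_cobounded_of_meromorphicOrderAt_neg h)
      exact this.eventually_ge_atTop 1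
    · obtain ⟨c, hc, h⟩ := tendsto_ne_zero_of_meromorphicOrderAt_eq_zero hf h
      have hc' : 0 < ‖c‖ := norm_pos_iff.2 hc
      exact ⟨‖c‖ / 2, by positivity, h.norm.eventually_const_le (by linarith)⟩
  obtain ⟨δ, hδ, hev⟩ := hδ
  rw [eventually_nhdsWithin_iff] at hev
  obtain ⟨W, hW, hWo, hzW⟩ := eventually_nhds_iff.1 hev
  refine ⟨W, hWo, hzW, ?_⟩
  have h1 : ∀ᶠ ε in 𝓝 (0 : ℂ), ‖ε‖ < δ :=
    continuous_norm.continuousAt.eventually_lt continuousAt_const (by simpa using hδ)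
  filter_upwards [h1] with ε hε z hz hT
  have h2 : ∀ᶠ y in 𝓝[≠] z, y ≠ z₀ := by
    rcases eq_or_ne z z₀ with rfl | h
    · exact self_mem_nhdsWithin
    · exact nhdsWithin_le_nhds (isOpen_ne.mem_nhds h)
  have h3 : ∀ᶠ y in 𝓝[≠] z, δ ≤ ‖f y‖ := by
    filter_upwards [h2, nhdsWithin_le_nhds (hWo.mem_nhds hz)] with y hy hyW using hW y hyW hy
  exact absurd (ge_of_tendsto hT.norm h3) (not_le.2 hε)

/-! ### The degree of a principal divisor -/

section PrincipalDivisor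

variable {C : Type u} [TopologicalSpace C] [ChartedSpace ℂ C]

/-- The function `f` is meromorphic on the Riemann surface `C`. Its values at isolated points are
irrelevant, so that poles and removable singularities may carry any value. -/
def IsMeromorphic (f : C → ℂ) : Prop :=
  ∀ x : C, MeromorphicAt (f ∘ (chartAt ℂ x).symm) (chartAt ℂ x x)

/-- The order at `x` of a meromorphic function on a Riemann surface. -/
def orderAt (f : C → ℂ) (x : C) : WithTop ℤ :=
  meromorphicOrderAt (f ∘ (chartAt ℂ x).symm) (chartAt ℂ x x)

theorem OpenPartialHomeomorph.map_nhdsNE {X Y : Type*} [TopologicalSpace X] [TopologicalSpace Y]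
    (e : OpenPartialHomeomorph X Y) {x : X} (hx : x ∈ e.source) :
    map e (𝓝[≠] x) = 𝓝[≠] (e x) := by
  refine OpenPartialHomeomorph.IsImage.map_nhdsWithin_eq (fun y hy => ?_) hx
  simp only [mem_compl_iff, mem_singleton_iff, not_iff_not]
  exact ⟨fun h => e.injOn hy hx h, fun h => h ▸ rfl⟩

theorem OpenPartialHomeomorph.map_symm_nhdsNE {X Y : Type*} [TopologicalSpace X]
    [TopologicalSpace Y] (e : OpenPartialHomeomorph X Y) {x : X} (hx : x ∈ e.source) :
    map e.symm (𝓝[≠] (e x)) = 𝓝[≠] x := by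
  rw [e.symm.map_nhdsNE (e.map_source hx), e.left_inv hx]

theorem OpenPartialHomeomorph.tendsto_comp_symm_iff {X Y Z : Type*} [TopologicalSpace X]
    [TopologicalSpace Y] (e : OpenPartialHomeomorph X Y) {x : X} (hx : x ∈ e.source) {f : X → Z}
    {l : Filter Z} :
    Tendsto (f ∘ e.symm) (𝓝[≠] (e x)) l ↔ Tendsto f (𝓝[≠] x) l := by
  rw [← e.map_symm_nhdsNE hx, tendsto_map'_iff]

theorem OpenPartialHomeomorph.eventually_comp_symm_iff {X Y : Type*} [TopologicalSpace X]
    [TopologicalSpace Y] (e : OpenPartialHomeomorph X Y) {x : X} (hx : x ∈ e.source)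
    {P : X → Prop} :
    (∀ᶠ z in 𝓝[≠] (e x), P (e.symm z)) ↔ ∀ᶠ y in 𝓝[≠] x, P y := by
  rw [← e.map_symm_nhdsNE hx, eventually_map]

theorem orderAt_eq_top_iff {f : C → ℂ} {x : C} :
    orderAt f x = ⊤ ↔ ∀ᶠ y in 𝓝[≠] x, f y = 0 := by
  rw [orderAt, meromorphicOrderAt_eq_top_iff,
    ← (chartAt ℂ x).eventually_comp_symm_iff (mem_chart_source ℂ x)]
  rfl

theorem IsMeromorphic.orderAt_eq_zero_iff {f : C → ℂ} (hf : IsMeromorphic f) {x : C} :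
    orderAt f x = 0 ↔ ∃ c ≠ 0, Tendsto f (𝓝[≠] x) (𝓝 c) := by
  rw [orderAt, ← tendsto_ne_zero_iff_meromorphicOrderAt_eq_zero (hf x)]
  simp_rw [(chartAt ℂ x).tendsto_comp_symm_iff (mem_chart_source ℂ x)]

theorem IsMeromorphic.eventually_orderAt_eq_zero {f : C → ℂ} (hf : IsMeromorphic f) {x : C}
    (hx : orderAt f x ≠ ⊤) : ∀ᶠ y in 𝓝[≠] x, orderAt f y = 0 := by
  set e := chartAt ℂ x with he
  have hxe : x ∈ e.source := mem_chart_source ℂ x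
  have h1 := (hf x).eventually_analyticAt
  have h2 := (meromorphicOrderAt_ne_top_iff_eventually_ne_zero (hf x)).1 hx
  have h3 : ∀ᶠ z in 𝓝[≠] (e x), z ∈ e.target :=
    nhdsWithin_le_nhds (e.open_target.mem_nhds (e.map_source hxe))
  rw [← e.eventually_comp_symm_iff hxe]
  filter_upwards [h1, h2, h3] with z hz1 hz2 hz3
  rw [hf.orderAt_eq_zero_iff]
  refine ⟨_, hz2, ?_⟩
  rw [← e.tendsto_comp_symm_iff (e.map_target hz3), e.right_inv hz3]
  exact hz1.continuousAt.tendsto.mono_left nhdsWithin_le_nhds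

theorem IsMeromorphic.finite_orderAt_ne_zero [CompactSpace C] {f : C → ℂ} (hf : IsMeromorphic f)
    (h : ∀ x, orderAt f x ≠ ⊤) : {x | orderAt f x ≠ 0}.Finite := by
  have h1 : ∀ x : C, ∃ W, IsOpen W ∧ x ∈ W ∧ ∀ y ∈ W, y ≠ x → orderAt f y = 0 := by
    intro x
    have h2 := hf.eventually_orderAt_eq_zero (h x)
    rw [eventually_nhdsWithin_iff] at h2
    obtain ⟨W, hW, hWo, hxW⟩ := eventually_nhds_iff.1 h2
    exact ⟨W, hWo, hxW, fun y hy => hW y hy⟩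
  choose W hWo hxW hW using h1
  obtain ⟨t, ht⟩ := isCompact_univ.elim_finite_subcover W hWo
    (fun x _ => mem_iUnion.2 ⟨x, hxW x⟩)
  refine t.finite_toSet.subset fun y hy => ?_
  obtain ⟨x, hx, hyx⟩ := mem_iUnion₂.1 (ht (mem_univ y))
  by_cases h3 : y = x
  · exact h3 ▸ hx
  · exact absurd (hW x y hyx h3) hy

theorem IsMeromorphic.orderAt_ne_top_of_exists [ConnectedSpace C] [T1Space C] {f : C → ℂ}
    (hf : IsMeromorphic f) {x : C} (hx : orderAt f x ≠ ⊤) (y : C) : orderAt f y ≠ ⊤ := by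
  have hcl : IsClopen {y | orderAt f y = ⊤} := by
    constructor
    · rw [← isOpen_compl_iff, isOpen_iff_mem_nhds]
      intro z hz
      have h1 := hf.eventually_orderAt_eq_zero (x := z) hz
      rw [eventually_nhdsWithin_iff] at h1
      filter_upwards [h1] with w hw
      by_cases h2 : w = z
      · exact h2 ▸ hz
      · simp [hw h2]
    · rw [isOpen_iff_mem_nhds]
      intro z hz
      have h1 := eventually_nhdsNE_eventually_nhds_iff.2 (orderAt_eq_top_iff.1 hz)
      rw [eventually_nhdsWithin_iff] at h1
      filter_upwards [h1] with w hw
      by_cases h3 : w = z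
      · exact h3 ▸ hz
      · exact orderAt_eq_top_iff.2 (nhdsWithin_le_nhds (hw h3))
  rcases isClopen_iff.1 hcl with h | h
  · intro hy
    exact (h ▸ hy : y ∈ (∅ : Set C))
  · exact absurd (h ▸ mem_univ x : x ∈ {y | orderAt f y = ⊤}) hx

/-- A meromorphic function on a compact Riemann surface takes every small nonzero value as often as
it has zeros, counted with multiplicity. -/
theorem IsMeromorphic.eventually_ncard_eq [CompactSpace C] [T2Space C] {f : C → ℂ}
    (hf : IsMeromorphic f) (h : ∀ x, orderAt f x ≠ ⊤) :
    ∀ᶠ ε in 𝓝[≠] (0 : ℂ), {x | Tendsto f (𝓝[≠] x) (𝓝 ε)}.ncard =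
      ∑ᶠ x, (orderAt f x).untop₀.toNat := by
  set Z : Set C := {x | 0 < orderAt f x} with hZ
  have hZf : Z.Finite := (hf.finite_orderAt_ne_zero h).subset fun x hx => ne_of_gt hx
  have hk : ∀ x ∈ Z, (orderAt f x).untop₀.toNat ≠ 0 ∧
      orderAt f x = (((orderAt f x).untop₀.toNat : ℤ) : WithTop ℤ) := by
    intro x hx
    obtain ⟨n, hn⟩ := WithTop.ne_top_iff_exists.1 (h x)
    have h0 : (0 : WithTop ℤ) < orderAt f x := hx
    rw [← hn] at h0 ⊢
    have h0' : 0 < n := by exact_mod_cast h0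
    simp only [WithTop.untop₀_coe, WithTop.coe_inj]
    omega
  -- The zeros have disjoint neighbourhoods `W x` on which the values are counted locally; on the
  -- compact complement `K` of these neighbourhoods, the small values are not taken.
  obtain ⟨V, hV, hVd⟩ := hZf.t2_separation
  have hloc : ∀ x : C, ∃ W ⊆ V x, IsOpen W ∧ x ∈ W ∧ (x ∈ Z → ∀ᶠ ε in 𝓝[≠] (0 : ℂ),
      {y ∈ W | Tendsto f (𝓝[≠] y) (𝓝 ε)}.ncard = (orderAt f x).untop₀.toNat) := by
    intro x
    by_cases hx : x ∈ Z
    swap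
    · exact ⟨V x, subset_rfl, (hV x).2, (hV x).1, fun h => absurd h hx⟩
    set e := chartAt ℂ x with he
    have hxe : x ∈ e.source := mem_chart_source ℂ x
    have hW₀ : e.target ∩ e.symm ⁻¹' V x ∈ 𝓝 (e x) := by
      refine (e.symm.isOpen_inter_preimage (hV x).2).mem_nhds ⟨e.map_source hxe, ?_⟩
      rw [mem_preimage, e.left_inv hxe]
      exact (hV x).1
    obtain ⟨W, hW, hWo, hxW, hev⟩ := exists_open_ncard_tendsto_eq (hf x) (hk x hx).1 (hk x hx).2 hW₀
    refine ⟨e.source ∩ e ⁻¹' W, ?_, e.isOpen_inter_preimage hWo, ⟨hxe, hxW⟩, fun _ => ?_⟩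
    · rintro y ⟨hy, hyW⟩
      have := (hW hyW).2
      rwa [mem_preimage, e.left_inv hy] at this
    · filter_upwards [hev] with ε hε
      rw [← hε]
      refine ncard_congr (fun y _ => e y) ?_ ?_ ?_
      · rintro y ⟨⟨hy, hyW⟩, hyT⟩
        exact ⟨hyW, (e.tendsto_comp_symm_iff hy).2 hyT⟩
      · rintro y y' ⟨⟨hy, -⟩, -⟩ ⟨⟨hy', -⟩, -⟩ hyy
        exact e.injOn hy hy' hyy
      · rintro z ⟨hzW, hzT⟩
        have hzt := (hW hzW).1
        refine ⟨e.symm z, ⟨⟨e.map_target hzt, ?_⟩, ?_⟩, e.right_inv hzt⟩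
        · rwa [mem_preimage, e.right_inv hzt]
        · rwa [← e.tendsto_comp_symm_iff (e.map_target hzt), e.right_inv hzt]
  choose W hWV hWo hxW hWc using hloc
  set K : Set C := (⋃ x ∈ Z, W x)ᶜ with hK
  have hKc : IsCompact K := (isOpen_biUnion fun x _ => hWo x).isClosed_compl.isCompact
  have hoff : ∀ᶠ ε in 𝓝 (0 : ℂ), ∀ y ∈ K, ¬ Tendsto f (𝓝[≠] y) (𝓝 ε) := by
    have h1 : ∀ y ∈ K, ∃ t ∈ 𝓝[K] y, ∀ᶠ ε in 𝓝 (0 : ℂ), ∀ w ∈ t, ¬ Tendsto f (𝓝[≠] w) (𝓝 ε) := by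
      intro y hy
      have hyZ : y ∉ Z := fun hyZ => hy (mem_biUnion hyZ (hxW y))
      obtain ⟨T, hTo, hyT, hT⟩ := eventually_not_tendsto_of_order_nonpos (hf y) (not_lt.1 hyZ)
      set e := chartAt ℂ y
      refine ⟨e.source ∩ e ⁻¹' T, nhdsWithin_le_nhds ((e.isOpen_inter_preimage hTo).mem_nhds
        ⟨mem_chart_source ℂ y, hyT⟩), ?_⟩
      filter_upwards [hT] with ε hε w hw hwT
      exact hε (e w) hw.2 ((e.tendsto_comp_symm_iff hw.1).2 hwT)
    refine hKc.induction_on (p := fun K => ∀ᶠ ε in 𝓝 (0 : ℂ), ∀ y ∈ K, ¬ Tendsto f (𝓝[≠] y) (𝓝 ε))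
      (by simp) ?_ ?_ h1
    · intro s t hst ht
      filter_upwards [ht] with ε hε y hy using hε y (hst hy)
    · intro s t hs ht
      filter_upwards [hs, ht] with ε h1 h2 y hy
      exact hy.elim (h1 y) (h2 y)
  have hon : ∀ᶠ ε in 𝓝[≠] (0 : ℂ), ∀ x ∈ Z,
      {y ∈ W x | Tendsto f (𝓝[≠] y) (𝓝 ε)}.ncard = (orderAt f x).untop₀.toNat :=
    (eventually_all_finite hZf).2 fun x hx => hWc x hx
  filter_upwards [hon, nhdsWithin_le_nhds hoff] with ε h1 h2
  have h3 : {x | Tendsto f (𝓝[≠] x) (𝓝 ε)} =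
      ⋃ x ∈ Z, {y ∈ W x | Tendsto f (𝓝[≠] y) (𝓝 ε)} := by
    ext y
    simp only [mem_ofPred_eq, mem_iUnion, exists_prop]
    refine ⟨fun hy => ?_, fun ⟨x, _, _, h⟩ => h⟩
    by_contra hcon
    refine h2 y (fun hyU => hcon ?_) hy
    obtain ⟨x, hx, hyx⟩ := mem_iUnion₂.1 hyU
    exact ⟨x, hx, hyx, hy⟩
  rw [h3, ← finsum_one, finsum_mem_biUnion ?_ hZf ?_]
  · have h4 : ∀ x ∈ Z, ∑ᶠ y ∈ {y ∈ W x | Tendsto f (𝓝[≠] y) (𝓝 ε)}, 1 =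
        (orderAt f x).untop₀.toNat := by
      intro x hx
      rw [finsum_one, h1 x hx]
    rw [finsum_mem_congr rfl h4]
    refine finsum_congr fun x => ?_
    by_cases hxZ : x ∈ Z
    · simp [hxZ]
    simp only [hxZ, finsum_false]
    by_contra hx'
    replace hx' : (orderAt f x).untop₀.toNat ≠ 0 := Ne.symm hx'
    refine hxZ ?_
    obtain ⟨n, hn⟩ := WithTop.ne_top_iff_exists.1 (h x)
    rw [← hn, WithTop.untop₀_coe] at hx'
    show 0 < orderAt f x
    rw [← hn]
    have : 0 < n := by omega
    exact_mod_cast this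
  · intro x hx y hy hxy
    exact (hVd hx hy hxy).mono ((sep_subset _ _).trans (hWV x)) ((sep_subset _ _).trans (hWV y))
  · intro x hx
    exact finite_of_ncard_ne_zero (by rw [h1 x hx]; exact (hk x hx).1)

theorem orderAt_inv (f : C → ℂ) (x : C) : orderAt f⁻¹ x = - orderAt f x :=
  meromorphicOrderAt_inv

theorem IsMeromorphic.inv {f : C → ℂ} (hf : IsMeromorphic f) : IsMeromorphic f⁻¹ :=
  fun x => (hf x).inv

theorem IsMeromorphic.sub_const {f : C → ℂ} (hf : IsMeromorphic f) (c : ℂ) :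
    IsMeromorphic (fun x => f x - c) :=
  fun x => (hf x).sub (MeromorphicAt.const c _)

/-- A nonzero meromorphic function on a compact connected Riemann surface has as many zeros as
poles, counted with multiplicity. -/
theorem IsMeromorphic.finsum_orderAt_eq_zero [CompactSpace C] [T2Space C] [ConnectedSpace C]
    {f : C → ℂ} (hf : IsMeromorphic f) (h : ∀ x, orderAt f x ≠ ⊤) :
    ∑ᶠ x, (orderAt f x).untop₀ = 0 := by
  by_cases hconst : ∃ c x, orderAt (fun x => f x - c) x = ⊤
  · -- If `f` is a constant, then that constant is not zero and all orders vanish.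
    obtain ⟨c, x, hcx⟩ := hconst
    have hall : ∀ y, orderAt (fun x => f x - c) y = ⊤ := fun y => by
      by_contra hy
      exact (hf.sub_const c).orderAt_ne_top_of_exists hy x hcx
    have h0 : ∀ y, orderAt f y = 0 := by
      intro y
      have h1 : ∀ᶠ z in 𝓝[≠] y, f z = c :=
        (orderAt_eq_top_iff.1 (hall y)).mono fun z hz => sub_eq_zero.1 hz
      refine hf.orderAt_eq_zero_iff.2 ⟨c, ?_, tendsto_const_nhds.congr' (h1.mono fun z hz => hz.symm)⟩
      rintro rfl
      exact h y (orderAt_eq_top_iff.2 h1)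
    simp [h0]
  push Not at hconst
  -- `n c` counts the points where `f` takes the value `c`, and `M c` the zeros of `f - c` with
  -- multiplicity. They agree except for isolated values of `c`, which makes `M` locally constant.
  set n : ℂ → ℕ := fun c => {x | Tendsto f (𝓝[≠] x) (𝓝 c)}.ncard with hn
  set M : ℂ → ℕ := fun c => ∑ᶠ x, (orderAt (fun x => f x - c) x).untop₀.toNat with hM
  have hnM : ∀ c, ∀ᶠ c' in 𝓝[≠] c, n c' = M c := by
    intro c
    have h1 := (hf.sub_const c).eventually_ncard_eq (hconst c)
    have h2 : Tendsto (fun c' => c' - c) (𝓝[≠] c) (𝓝[≠] 0) := by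
      refine tendsto_nhdsWithin_iff.2 ⟨?_, ?_⟩
      · have : ContinuousAt (fun c' : ℂ => c' - c) c := by fun_prop
        simpa [ContinuousAt] using this.tendsto.mono_left nhdsWithin_le_nhds
      · filter_upwards [self_mem_nhdsWithin] with y hy using sub_ne_zero.2 hy
    filter_upwards [h2.eventually h1] with c' hc'
    refine Eq.trans (congrArg ncard (Set.ext fun x => ?_)) hc'
    refine ⟨fun h => h.sub_const c, fun h => ?_⟩
    simpa using Tendsto.add_const c h
  have hMc : IsLocallyConstant M := by
    rw [IsLocallyConstant.iff_eventually_eq]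
    intro c
    have h1 := eventually_nhdsNE_eventually_nhds_iff.2 (hnM c)
    rw [eventually_nhdsWithin_iff] at h1
    filter_upwards [h1] with c' hc'
    by_cases h3 : c' = c
    · rw [h3]
    · obtain ⟨c'', h4, h5⟩ := ((hnM c').and (nhdsWithin_le_nhds (hc' h3))).exists
      rw [← h4, h5]
  -- The points where `f` takes a large value `c` are those where `f⁻¹` takes the small value `c⁻¹`.
  have hinv : ∀ᶠ c in Bornology.cobounded ℂ, n c = ∑ᶠ x, (orderAt f⁻¹ x).untop₀.toNat := by
    have h1 := hf.inv.eventually_ncard_eq (fun x hx => h x (by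
      rw [orderAt_inv] at hx
      exact LinearOrderedAddCommGroupWithTop.neg_eq_top.1 hx))
    filter_upwards [tendsto_inv₀_cobounded'.eventually h1,
      tendsto_inv₀_cobounded'.eventually self_mem_nhdsWithin] with c hc hc0
    have hc0' : c ≠ 0 := by simpa using hc0
    refine Eq.trans (congrArg ncard (Set.ext fun x => ?_)) hc
    refine ⟨fun h => h.inv₀ hc0', fun h => ?_⟩
    simpa using Tendsto.inv₀ h (inv_ne_zero hc0')
  have hkey : ∑ᶠ x, (orderAt f x).untop₀.toNat = ∑ᶠ x, (orderAt f⁻¹ x).untop₀.toNat := by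
    obtain ⟨c, hc⟩ : ∃ c, ∀ᶠ c' in 𝓝 c, n c' = ∑ᶠ x, (orderAt f⁻¹ x).untop₀.toNat := by
      obtain ⟨R, -, hR⟩ := (Metric.hasBasis_cobounded_compl_closedBall (0 : ℂ)).eventually_iff.1 hinv
      obtain ⟨c, hc⟩ := NormedField.exists_lt_norm ℂ R
      exact ⟨c, Filter.mem_of_superset (Metric.isClosed_closedBall.isOpen_compl.mem_nhds
        (by simpa using hc)) hR⟩
    obtain ⟨c', hc'⟩ := ((hnM c).and (nhdsWithin_le_nhds hc)).exists
    have h0 : M 0 = ∑ᶠ x, (orderAt f x).untop₀.toNat := by simp [hM]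
    rw [← h0, hMc.apply_eq_of_isPreconnected isPreconnected_univ (mem_univ 0) (mem_univ c), ← hc'.1,
      hc'.2]
  have hfin := hf.finite_orderAt_ne_zero h
  have hsum : ∀ x, (orderAt f x).untop₀ =
      ((orderAt f x).untop₀.toNat : ℤ) - ((orderAt f⁻¹ x).untop₀.toNat : ℤ) := by
    intro x
    obtain ⟨k, hk⟩ := WithTop.ne_top_iff_exists.1 (h x)
    rw [orderAt_inv, ← hk, ← WithTop.LinearOrderedAddCommGroup.coe_neg]
    simp only [WithTop.untop₀_coe]
    omega
  have hs : ∀ k : WithTop ℤ, k = 0 → ((k.untop₀.toNat : ℕ) : ℤ) = 0 := by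
    rintro _ rfl
    simp
  have hsupp1 : (Function.support fun x => (orderAt f x).untop₀.toNat).Finite := by
    refine hfin.subset fun x hx hx0 => hx ?_
    simp [hx0]
  have hsupp2 : (Function.support fun x => (orderAt f⁻¹ x).untop₀.toNat).Finite := by
    refine hfin.subset fun x hx hx0 => hx ?_
    simp [orderAt_inv, hx0]
  have hc1 := (Nat.castAddMonoidHom ℤ).map_finsum hsupp1
  have hc2 := (Nat.castAddMonoidHom ℤ).map_finsum hsupp2
  simp only [Nat.coe_castAddMonoidHom] at hc1 hc2
  rw [finsum_congr hsum, finsum_sub_distrib, ← hc1, ← hc2, hkey, sub_self]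
  · refine hsupp1.subset fun x hx hx0 => hx ?_
    simpa using hx0
  · refine hsupp2.subset fun x hx hx0 => hx ?_
    simpa using hx0

end PrincipalDivisor

/-! ### Gluing two open sets along a partial homeomorphism -/

section Gluing

variable {X : Type u} {Y : Type v} [TopologicalSpace X] [TopologicalSpace Y]
  (Φ : OpenPartialHomeomorph X Y) (A : Set X) (B : Set Y)

/-- The equivalence relation on `A ⊕ B` that identifies a point of `A` in the source of `Φ` with its
image under `Φ`, if that image is in `B`. -/
def gluingSetoid : Setoid (A ⊕ B) where
  r s t := match s, t with
    | .inl a, .inl a' => a = a'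
    | .inl a, .inr b => a.1 ∈ Φ.source ∧ Φ a = b
    | .inr b, .inl a => a.1 ∈ Φ.source ∧ Φ a = b
    | .inr b, .inr b' => b = b'
  iseqv := by
    refine ⟨?_, ?_, ?_⟩
    · rintro (a | b) <;> rfl
    · rintro (a | b) (a' | b') h
      · exact h.symm
      · exact h
      · exact h
      · exact h.symm
    · rintro (a | b) (a' | b') (a'' | b'') h h'
      · exact h.trans h'
      · exact h ▸ h'
      · exact Subtype.ext (Φ.injOn h.1 h'.1 (h.2.trans h'.2.symm))
      · exact ⟨h.1, h.2.trans (congrArg Subtype.val h')⟩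
      · exact h' ▸ h
      · exact Subtype.ext (h.2.symm.trans h'.2)
      · exact ⟨h'.1, h'.2.trans (congrArg Subtype.val h).symm⟩
      · exact h.trans h'

/-- The topological space obtained from `A` and `B` by gluing along `Φ`. -/
def Glued : Type (max u v) := Quotient (gluingSetoid Φ A B)

instance : TopologicalSpace (Glued Φ A B) := inferInstanceAs (TopologicalSpace (Quotient _))

namespace Glued

/-- The inclusion of the first piece. -/
def inl (a : A) : Glued Φ A B := Quotient.mk (gluingSetoid Φ A B) (.inl a)

/-- The inclusion of the second piece. -/
def inr (b : B) : Glued Φ A B := Quotient.mk (gluingSetoid Φ A B) (.inr b)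

variable {Φ A B}

theorem inl_eq_inr {a : A} {b : B} : inl Φ A B a = inr Φ A B b ↔ a.1 ∈ Φ.source ∧ Φ a = b :=
  Quotient.eq (r := gluingSetoid Φ A B)

theorem inl_injective : Function.Injective (inl Φ A B) := fun _ _ h =>
  (Quotient.eq (r := gluingSetoid Φ A B)).1 h

theorem inr_injective : Function.Injective (inr Φ A B) := fun _ _ h =>
  (Quotient.eq (r := gluingSetoid Φ A B)).1 h

theorem exists_rep (s : Glued Φ A B) : (∃ a, inl Φ A B a = s) ∨ ∃ b, inr Φ A B b = s := by
  induction s using Quotient.inductionOn with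
  | h t =>
    rcases t with a | b
    · exact Or.inl ⟨a, rfl⟩
    · exact Or.inr ⟨b, rfl⟩

theorem isOpen_iff {U : Set (Glued Φ A B)} :
    IsOpen U ↔ IsOpen (inl Φ A B ⁻¹' U) ∧ IsOpen (inr Φ A B ⁻¹' U) :=
  (isOpen_coinduced (f := Quotient.mk (gluingSetoid Φ A B))).trans isOpen_sum_iff

theorem isOpenEmbedding_inl (hA : IsOpen A) : Topology.IsOpenEmbedding (inl Φ A B) := by
  refine .of_continuous_injective_isOpenMap ?_ inl_injective ?_
  · exact ⟨fun U hU => (isOpen_iff.1 hU).1⟩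
  · intro U hU
    refine isOpen_iff.2 ⟨?_, ?_⟩
    · rwa [preimage_image_eq _ inl_injective]
    · have h : inr Φ A B ⁻¹' (inl Φ A B '' U) =
          Subtype.val ⁻¹' (Φ '' (Φ.source ∩ Subtype.val '' U)) := by
        ext b
        constructor
        · rintro ⟨a, ha, hab⟩
          obtain ⟨h1, h2⟩ := inl_eq_inr.1 hab
          exact ⟨a, ⟨h1, a, ha, rfl⟩, h2⟩
        · rintro ⟨_, ⟨h1, a, ha, rfl⟩, h2⟩
          exact ⟨a, ha, inl_eq_inr.2 ⟨h1, h2⟩⟩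
      rw [h]
      exact (Φ.isOpen_image_of_subset_source (Φ.open_source.inter
        (hA.isOpenMap_subtype_val U hU)) inter_subset_left).preimage continuous_subtype_val

theorem isOpenEmbedding_inr (hB : IsOpen B) : Topology.IsOpenEmbedding (inr Φ A B) := by
  refine .of_continuous_injective_isOpenMap ?_ inr_injective ?_
  · exact ⟨fun U hU => (isOpen_iff.1 hU).2⟩
  · intro U hU
    refine isOpen_iff.2 ⟨?_, ?_⟩
    · have h : inl Φ A B ⁻¹' (inr Φ A B '' U) =
          Subtype.val ⁻¹' (Φ.source ∩ Φ ⁻¹' (Subtype.val '' U)) := by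
        ext a
        constructor
        · rintro ⟨b, hb, hab⟩
          obtain ⟨h1, h2⟩ := inl_eq_inr.1 hab.symm
          exact ⟨h1, b, hb, h2.symm⟩
        · rintro ⟨h1, b, hb, h2⟩
          exact ⟨b, hb, (inl_eq_inr.2 ⟨h1, h2.symm⟩).symm⟩
      rw [h]
      exact (Φ.isOpen_inter_preimage (hB.isOpenMap_subtype_val U hU)).preimage
        continuous_subtype_val
    · rwa [preimage_image_eq _ inr_injective]

/-- The glued space is Hausdorff as soon as points of the two pieces that are not identified can be
separated. -/
theorem t2Space [T2Space X] [T2Space Y] (hA : IsOpen A) (hB : IsOpen B)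
    (hsep : ∀ a ∈ A, ∀ b ∈ B, ¬ (a ∈ Φ.source ∧ Φ a = b) →
      ∃ U ∈ 𝓝 a, ∃ V ∈ 𝓝 b, ∀ x ∈ U, x ∈ A → x ∈ Φ.source → Φ x ∉ V) :
    T2Space (Glued Φ A B) := by
  have hl := isOpenEmbedding_inl (Φ := Φ) (B := B) hA
  have hr := isOpenEmbedding_inr (Φ := Φ) (A := A) hB
  have key : ∀ a b, inl Φ A B a ≠ inr Φ A B b →
      ∃ u v : Set (Glued Φ A B), IsOpen u ∧ IsOpen v ∧ inl Φ A B a ∈ u ∧ inr Φ A B b ∈ v ∧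
        Disjoint u v := by
    intro a b hab
    obtain ⟨U, hU, V, hV, hUV⟩ := hsep a a.2 b b.2 fun h => hab (inl_eq_inr.2 h)
    obtain ⟨U', hU', hUo, haU⟩ := mem_nhds_iff.1 hU
    obtain ⟨V', hV', hVo, hbV⟩ := mem_nhds_iff.1 hV
    refine ⟨inl Φ A B '' (Subtype.val ⁻¹' U'), inr Φ A B '' (Subtype.val ⁻¹' V'),
      hl.isOpenMap _ (hUo.preimage continuous_subtype_val),
      hr.isOpenMap _ (hVo.preimage continuous_subtype_val), ⟨a, haU, rfl⟩, ⟨b, hbV, rfl⟩, ?_⟩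
    rw [disjoint_left]
    rintro _ ⟨x, hx, rfl⟩ ⟨y, hy, hxy⟩
    obtain ⟨h1, h2⟩ := inl_eq_inr.1 hxy.symm
    exact hUV x (hU' hx) x.2 h1 (h2 ▸ hV' hy)
  refine ⟨fun s t hst => ?_⟩
  rcases exists_rep s with ⟨a, rfl⟩ | ⟨b, rfl⟩ <;> rcases exists_rep t with ⟨a', rfl⟩ | ⟨b', rfl⟩
  · obtain ⟨U, V, hU, hV, haU, haV, hUV⟩ := t2_separation (fun h => hst (congrArg _ h) : a ≠ a')
    exact ⟨_, _, hl.isOpenMap U hU, hl.isOpenMap V hV, ⟨a, haU, rfl⟩, ⟨a', haV, rfl⟩,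
      (disjoint_image_iff inl_injective).2 hUV⟩
  · exact key a b' hst
  · obtain ⟨u, v, hu, hv, h1, h2, h3⟩ := key a' b hst.symm
    exact ⟨v, u, hv, hu, h2, h1, h3.symm⟩
  · obtain ⟨U, V, hU, hV, haU, haV, hUV⟩ := t2_separation (fun h => hst (congrArg _ h) : b ≠ b')
    exact ⟨_, _, hr.isOpenMap U hU, hr.isOpenMap V hV, ⟨b, haU, rfl⟩, ⟨b', haV, rfl⟩,
      (disjoint_image_iff inr_injective).2 hUV⟩

theorem secondCountableTopology [SecondCountableTopology X] [SecondCountableTopology Y]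
    (hA : IsOpen A) (hB : IsOpen B) : SecondCountableTopology (Glued Φ A B) := by
  have hl := isOpenEmbedding_inl (Φ := Φ) (B := B) hA
  have hr := isOpenEmbedding_inr (Φ := Φ) (A := A) hB
  have h1 : SecondCountableTopology (range (inl Φ A B)) :=
    hl.isEmbedding.toHomeomorph.symm.secondCountableTopology
  have h2 : SecondCountableTopology (range (inr Φ A B)) :=
    hr.isEmbedding.toHomeomorph.symm.secondCountableTopology
  have h3 : ∀ b : Bool, SecondCountableTopology
      (bif b then range (inl Φ A B) else range (inr Φ A B) : Set (Glued Φ A B)) := by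
    rintro (_ | _)
    · exact h2
    · exact h1
  refine TopologicalSpace.secondCountableTopology_of_countable_cover (ι := Bool)
    (U := fun b => bif b then range (inl Φ A B) else range (inr Φ A B)) ?_ ?_
  · rintro (_ | _)
    · exact hr.isOpen_range
    · exact hl.isOpen_range
  · rw [eq_univ_iff_forall]
    intro s
    rcases exists_rep s with ⟨a, rfl⟩ | ⟨b, rfl⟩
    · exact mem_iUnion.2 ⟨true, mem_range_self a⟩
    · exact mem_iUnion.2 ⟨false, mem_range_self b⟩

/-- The first piece, as the domain of a partial homeomorphism to `X`. -/
def homeoLeft (hA : IsOpen A) [Nonempty A] : OpenPartialHomeomorph (Glued Φ A B) X :=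
  ((isOpenEmbedding_inl (Φ := Φ) (B := B) hA).toOpenPartialHomeomorph _).symm ≫ₕ
    (hA.isOpenEmbedding_subtypeVal.toOpenPartialHomeomorph _)

/-- The second piece, as the domain of a partial homeomorphism to `Y`. -/
def homeoRight (hB : IsOpen B) [Nonempty B] : OpenPartialHomeomorph (Glued Φ A B) Y :=
  ((isOpenEmbedding_inr (Φ := Φ) (A := A) hB).toOpenPartialHomeomorph _).symm ≫ₕ
    (hB.isOpenEmbedding_subtypeVal.toOpenPartialHomeomorph _)

section
variable (hA : IsOpen A) [Nonempty A]

@[simp] theorem homeoLeft_source :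
    (homeoLeft (Φ := Φ) (B := B) hA).source = range (inl Φ A B) := by
  simp [homeoLeft]

@[simp] theorem homeoLeft_target : (homeoLeft (Φ := Φ) (B := B) hA).target = A := by
  simp [homeoLeft]

@[simp] theorem homeoLeft_inl (a : A) : homeoLeft (Φ := Φ) (B := B) hA (inl Φ A B a) = a := by
  have := ((isOpenEmbedding_inl (Φ := Φ) (B := B) hA).toOpenPartialHomeomorph _).left_inv
    (x := a) (by simp)
  simp only [Topology.IsOpenEmbedding.toOpenPartialHomeomorph_apply] at this
  simp [homeoLeft, this]

theorem homeoLeft_symm {x : X} (hx : x ∈ A) :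
    (homeoLeft (Φ := Φ) (B := B) hA).symm x = inl Φ A B ⟨x, hx⟩ := by
  have h := (homeoLeft (Φ := Φ) (B := B) hA).left_inv (x := inl Φ A B ⟨x, hx⟩) (by simp)
  rwa [homeoLeft_inl] at h

end

section
variable (hB : IsOpen B) [Nonempty B]

@[simp] theorem homeoRight_source :
    (homeoRight (Φ := Φ) (A := A) hB).source = range (inr Φ A B) := by
  simp [homeoRight]

@[simp] theorem homeoRight_target : (homeoRight (Φ := Φ) (A := A) hB).target = B := by
  simp [homeoRight]

@[simp] theorem homeoRight_inr (b : B) : homeoRight (Φ := Φ) (A := A) hB (inr Φ A B b) = b := by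
  have := ((isOpenEmbedding_inr (Φ := Φ) (A := A) hB).toOpenPartialHomeomorph _).left_inv
    (x := b) (by simp)
  simp only [Topology.IsOpenEmbedding.toOpenPartialHomeomorph_apply] at this
  simp [homeoRight, this]

end

theorem homeoLeft_symm_mem_iff (hA : IsOpen A) (hB : IsOpen B) [Nonempty A] [Nonempty B] {x : X}
    (hx : x ∈ A) : (homeoLeft (Φ := Φ) (B := B) hA).symm x ∈ (homeoRight (Φ := Φ) (A := A) hB).source ↔
      x ∈ Φ.source ∧ Φ x ∈ B := by
  rw [homeoLeft_symm _ hx, homeoRight_source]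
  constructor
  · rintro ⟨b, hb⟩
    obtain ⟨h1, h2⟩ := inl_eq_inr.1 hb.symm
    exact ⟨h1, h2 ▸ b.2⟩
  · rintro ⟨h1, h2⟩
    exact ⟨⟨_, h2⟩, (inl_eq_inr.2 ⟨h1, rfl⟩).symm⟩

theorem homeoRight_homeoLeft_symm (hA : IsOpen A) (hB : IsOpen B) [Nonempty A] [Nonempty B] {x : X}
    (hx : x ∈ A) (h1 : x ∈ Φ.source) (h2 : Φ x ∈ B) :
    homeoRight (Φ := Φ) (A := A) hB ((homeoLeft (Φ := Φ) (B := B) hA).symm x) = Φ x := by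
  rw [homeoLeft_symm _ hx, (inl_eq_inr (b := ⟨_, h2⟩)).2 ⟨h1, rfl⟩, homeoRight_inr]

theorem mem_source_or (hA : IsOpen A) (hB : IsOpen B) [Nonempty A] [Nonempty B] (s : Glued Φ A B) :
    s ∈ (homeoLeft hA).source ∨ s ∈ (homeoRight hB).source := by
  rw [homeoLeft_source, homeoRight_source]
  exact exists_rep s

end Glued

end Gluing

/-! ### The model transition map -/

/-- The map `(z, w) ↦ (z e ^ u, (z e ^ u) ^ q u)` with `u = z ^ l w`. In the coordinates
`(z, z ^ l w)` of the source and `(z, w / z ^ q)` of the target it is the time-one flow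
`(z, u) ↦ (z e ^ u, u)` of the vector field `z u ∂/∂z`. -/
def twistMap (l q : ℤ) (a : ℂ × ℂ) : ℂ × ℂ :=
  (a.1 * Complex.exp (a.1 ^ l * a.2), (a.1 * Complex.exp (a.1 ^ l * a.2)) ^ q * (a.1 ^ l * a.2))

/-- The inverse of `twistMap` where the first coordinate does not vanish. -/
def twistInv (l q : ℤ) (b : ℂ × ℂ) : ℂ × ℂ :=
  (b.1 * Complex.exp (-(b.2 / b.1 ^ q)), (b.1 * Complex.exp (-(b.2 / b.1 ^ q))) ^ (-l) *
    (b.2 / b.1 ^ q))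

theorem analyticAt_twistCoord (l : ℤ) {a : ℂ × ℂ} (ha : a.1 ≠ 0) :
    AnalyticAt ℂ (fun a : ℂ × ℂ => a.1 ^ l * a.2) a :=
  (analyticAt_fst.zpow ha).mul analyticAt_snd

theorem analyticAt_twistMap (l q : ℤ) {a : ℂ × ℂ} (ha : a.1 ≠ 0) :
    AnalyticAt ℂ (twistMap l q) a := by
  have h1 := analyticAt_twistCoord l ha
  have h2 : AnalyticAt ℂ (fun a : ℂ × ℂ => a.1 * Complex.exp (a.1 ^ l * a.2)) a :=
    analyticAt_fst.mul h1.cexp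
  exact h2.prod ((h2.zpow (mul_ne_zero ha (Complex.exp_ne_zero _))).mul h1)

theorem analyticAt_twistInv (l q : ℤ) {b : ℂ × ℂ} (hb : b.1 ≠ 0) :
    AnalyticAt ℂ (twistInv l q) b := by
  have h1 : AnalyticAt ℂ (fun b : ℂ × ℂ => b.2 / b.1 ^ q) b :=
    analyticAt_snd.div (analyticAt_fst.zpow hb) (zpow_ne_zero q hb)
  have h2 : AnalyticAt ℂ (fun b : ℂ × ℂ => b.1 * Complex.exp (-(b.2 / b.1 ^ q))) b :=
    analyticAt_fst.mul h1.neg.cexp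
  exact h2.prod ((h2.zpow (mul_ne_zero hb (Complex.exp_ne_zero _))).mul h1)

theorem twistMap_coord (l q : ℤ) {a : ℂ × ℂ} (ha : a.1 ≠ 0) :
    (twistMap l q a).2 / (twistMap l q a).1 ^ q = a.1 ^ l * a.2 := by
  simp only [twistMap]
  rw [mul_div_cancel_left₀]
  exact zpow_ne_zero q (mul_ne_zero ha (Complex.exp_ne_zero _))

theorem twistInv_coord (l q : ℤ) {b : ℂ × ℂ} (hb : b.1 ≠ 0) :
    (twistInv l q b).1 ^ l * (twistInv l q b).2 = b.2 / b.1 ^ q := by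
  simp only [twistInv]
  rw [← mul_assoc, ← zpow_add₀ (mul_ne_zero hb (Complex.exp_ne_zero _))]
  simp

theorem twistInv_twistMap (l q : ℤ) {a : ℂ × ℂ} (ha : a.1 ≠ 0) :
    twistInv l q (twistMap l q a) = a := by
  have h1 : (twistInv l q (twistMap l q a)).1 = a.1 := by
    simp only [twistInv, twistMap_coord l q ha]
    simp only [twistMap]
    rw [mul_assoc, ← Complex.exp_add, add_neg_cancel, Complex.exp_zero, mul_one]
  refine Prod.ext h1 ?_
  show (twistInv l q (twistMap l q a)).1 ^ (-l) * ((twistMap l q a).2 / (twistMap l q a).1 ^ q) = _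
  rw [h1, twistMap_coord l q ha, ← mul_assoc, ← zpow_add₀ ha]
  simp

theorem twistMap_twistInv (l q : ℤ) {b : ℂ × ℂ} (hb : b.1 ≠ 0) :
    twistMap l q (twistInv l q b) = b := by
  have h1 : (twistMap l q (twistInv l q b)).1 = b.1 := by
    simp only [twistMap, twistInv_coord l q hb]
    simp only [twistInv]
    rw [mul_assoc, ← Complex.exp_add, neg_add_cancel, Complex.exp_zero, mul_one]
  refine Prod.ext h1 ?_
  show (twistMap l q (twistInv l q b)).1 ^ q * ((twistInv l q b).1 ^ l * (twistInv l q b).2) = _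
  rw [h1, twistInv_coord l q hb, mul_div_cancel₀]
  exact zpow_ne_zero q hb

theorem norm_mul_exp_lt_three {z u : ℂ} (hz : ‖z‖ < 1) (hu : ‖u‖ < 1) :
    ‖z * Complex.exp u‖ < 3 := by
  have h1 : ‖Complex.exp u‖ ≤ Real.exp 1 :=
    (Complex.norm_exp_le_exp_norm u).trans (Real.exp_le_exp.2 hu.le)
  have h2 := Real.exp_one_lt_d9
  rw [norm_mul]
  nlinarith [norm_nonneg z, norm_nonneg (Complex.exp u)]

/-- `twistMap` as a biholomorphism between two open subsets of `ℂ²`. The target is the part of the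
punctured unit disc times `ℂ` where `|u| < 1`. The condition `|z| < 3` on the source follows from
the other two, since `e < 3`. -/
def twist (l q : ℤ) : OpenPartialHomeomorph (ℂ × ℂ) (ℂ × ℂ) where
  toFun := twistMap l q
  invFun := twistInv l q
  source := {a | a.1 ≠ 0} ∩ (fun a : ℂ × ℂ => (a.1, a.1 ^ l * a.2, twistMap l q a)) ⁻¹'
    {t | ‖t.1‖ < 3 ∧ ‖t.2.1‖ < 1 ∧ ‖t.2.2.1‖ < 1}
  target := {b | b.1 ≠ 0} ∩ (fun b : ℂ × ℂ => (b.1, b.2 / b.1 ^ q)) ⁻¹'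
    {t | ‖t.1‖ < 1 ∧ ‖t.2‖ < 1}
  map_source' := by
    rintro a ⟨ha, h1, h2, h3⟩
    refine ⟨mul_ne_zero ha (Complex.exp_ne_zero _), h3, ?_⟩
    show ‖(twistMap l q a).2 / (twistMap l q a).1 ^ q‖ < 1
    rwa [twistMap_coord l q ha]
  map_target' := by
    rintro b ⟨hb, h1, h2⟩
    refine ⟨mul_ne_zero hb (Complex.exp_ne_zero _), ?_, ?_, ?_⟩
    · exact norm_mul_exp_lt_three h1 (by rwa [norm_neg])
    · show ‖(twistInv l q b).1 ^ l * (twistInv l q b).2‖ < 1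
      rwa [twistInv_coord l q hb]
    · show ‖(twistMap l q (twistInv l q b)).1‖ < 1
      rwa [twistMap_twistInv l q hb]
  left_inv' a ha := twistInv_twistMap l q ha.1
  right_inv' b hb := twistMap_twistInv l q hb.1
  open_source := by
    refine ContinuousOn.isOpen_inter_preimage (fun a ha => ?_)
      (isOpen_ne_fun continuous_fst continuous_const) ?_
    · exact (continuous_fst.continuousAt.prodMk ((analyticAt_twistCoord l ha).continuousAt.prodMk
        (analyticAt_twistMap l q ha).continuousAt)).continuousWithinAt
    · exact (isOpen_lt continuous_fst.norm continuous_const).inter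
        ((isOpen_lt continuous_snd.fst.norm continuous_const).inter
          (isOpen_lt continuous_snd.snd.fst.norm continuous_const))
  open_target := by
    refine ContinuousOn.isOpen_inter_preimage (fun b hb => ?_)
      (isOpen_ne_fun continuous_fst continuous_const) ?_
    · have h1 : AnalyticAt ℂ (fun b : ℂ × ℂ => b.2 / b.1 ^ q) b :=
        analyticAt_snd.div (analyticAt_fst.zpow hb) (zpow_ne_zero q hb)
      exact (continuous_fst.continuousAt.prodMk h1.continuousAt).continuousWithinAt
    · exact (isOpen_lt continuous_fst.norm continuous_const).inter
        (isOpen_lt continuous_snd.norm continuous_const)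
  continuousOn_toFun a ha := (analyticAt_twistMap l q ha.1).continuousAt.continuousWithinAt
  continuousOn_invFun b hb := (analyticAt_twistInv l q hb.1).continuousAt.continuousWithinAt

theorem mem_twist_source {l q : ℤ} {a : ℂ × ℂ} : a ∈ (twist l q).source ↔
    a.1 ≠ 0 ∧ ‖a.1‖ < 3 ∧ ‖a.1 ^ l * a.2‖ < 1 ∧ ‖(twistMap l q a).1‖ < 1 := Iff.rfl

theorem twistMap_zero (l q : ℤ) (z : ℂ) : twistMap l q (z, 0) = (z, 0) := by
  simp [twistMap]

/-- The derivative of `twistMap` along the curve `w = 0`. -/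
theorem fderiv_twistMap (l q : ℤ) {z : ℂ} (hz : z ≠ 0) (α β : ℂ) :
    fderiv ℂ (twistMap l q) (z, 0) (α, β) = (α + z ^ (l + 1) * β, z ^ (q + l) * β) := by
  have hd : DifferentiableAt ℂ (twistMap l q) (z, 0) :=
    (analyticAt_twistMap l q (a := (z, 0)) hz).differentiableAt
  -- The derivative is evaluated separately on the two coordinate lines.
  have h1 : HasDerivAt (fun t : ℂ => twistMap l q (t, 0)) (fderiv ℂ (twistMap l q) (z, 0) (1, 0)) z := by
    have := HasFDerivAt.comp_hasDerivAt z (f := fun t : ℂ => (t, (0 : ℂ))) (l := twistMap l q)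
      hd.hasFDerivAt ((hasDerivAt_id z).prodMk (hasDerivAt_const z 0))
    exact this
  have h1' : HasDerivAt (fun t : ℂ => twistMap l q (t, 0)) ((1 : ℂ), (0 : ℂ)) z := by
    simp only [twistMap_zero]
    exact (hasDerivAt_id z).prodMk (hasDerivAt_const z 0)
  have h2 : HasDerivAt (fun t : ℂ => twistMap l q (z, t)) (fderiv ℂ (twistMap l q) (z, 0) (0, 1)) 0 := by
    have := HasFDerivAt.comp_hasDerivAt 0 (f := fun t : ℂ => (z, t)) (l := twistMap l q)
      hd.hasFDerivAt ((hasDerivAt_const 0 z).prodMk (hasDerivAt_id 0))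
    exact this
  have h2' : HasDerivAt (fun t : ℂ => twistMap l q (z, t)) (z ^ (l + 1), z ^ (q + l)) 0 := by
    have e1 : HasDerivAt (fun t : ℂ => z ^ l * t) (z ^ l) 0 := by
      simpa using (hasDerivAt_id (0 : ℂ)).const_mul (z ^ l)
    have e2 : HasDerivAt (fun t : ℂ => z * Complex.exp (z ^ l * t)) (z ^ (l + 1)) 0 := by
      have := e1.cexp.const_mul z
      rw [zpow_add_one₀ hz, mul_comm (z ^ l)]
      simpa using this
    have e3 : HasDerivAt (fun t : ℂ => (z * Complex.exp (z ^ l * t)) ^ q * (z ^ l * t))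
        (z ^ (q + l)) 0 := by
      have e4 : DifferentiableAt ℂ (fun t : ℂ => (z * Complex.exp (z ^ l * t)) ^ q) 0 :=
        e2.differentiableAt.zpow (Or.inl (mul_ne_zero hz (Complex.exp_ne_zero _)))
      have := e4.hasDerivAt.fun_mul e1
      rw [zpow_add₀ hz]
      simpa using this
    exact e2.prodMk e3
  have h3 : ((α, β) : ℂ × ℂ) = α • ((1 : ℂ), (0 : ℂ)) + β • ((0 : ℂ), (1 : ℂ)) := by simp
  rw [h3, map_add, map_smul, map_smul, h1.unique h1', h2.unique h2']
  simp [mul_comm]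

/-! ### A coordinate disc around the point -/

section Surface

variable {C : Type u} [TopologicalSpace C] [ChartedSpace ℂ C]

theorem exists_discRadius (p : C) :
    ∃ ρ : ℝ, 0 < ρ ∧ Metric.closedBall (chartAt ℂ p p) (3 * ρ) ⊆ (chartAt ℂ p).target := by
  obtain ⟨ε, hε, h⟩ := Metric.nhds_basis_closedBall.mem_iff.1
    ((chartAt ℂ p).open_target.mem_nhds (mem_chart_target ℂ p))
  exact ⟨ε / 3, by positivity, by rwa [mul_div_cancel₀ _ (by norm_num : (3 : ℝ) ≠ 0)]⟩

/-- A scale such that the disc of three times that radius is in the target of the preferred chart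
at `p`. -/
def discRadius (p : C) : ℝ := (exists_discRadius p).choose

theorem discRadius_pos (p : C) : 0 < discRadius p := (exists_discRadius p).choose_spec.1

theorem discRadius_ne_zero (p : C) : (discRadius p : ℂ) ≠ 0 :=
  Complex.ofReal_ne_zero.2 (discRadius_pos p).ne'

/-- The preferred chart at `p`, centered and rescaled so that its target contains the disc of
radius `3`. -/
def discChart (p : C) : OpenPartialHomeomorph C ℂ :=
  chartAt ℂ p ≫ₕ ((Homeomorph.subRight (chartAt ℂ p p)).trans
    (Homeomorph.mulRight₀ (discRadius p : ℂ)⁻¹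
      (inv_ne_zero (discRadius_ne_zero p)))).toOpenPartialHomeomorph

theorem discChart_apply (p x : C) :
    discChart p x = (chartAt ℂ p x - chartAt ℂ p p) * (discRadius p : ℂ)⁻¹ := rfl

theorem discChart_symm_apply (p : C) (z : ℂ) :
    (discChart p).symm z = (chartAt ℂ p).symm (z * discRadius p + chartAt ℂ p p) := by
  have h : (discChart p).symm z =
      (chartAt ℂ p).symm (z * ((discRadius p : ℂ)⁻¹)⁻¹ + chartAt ℂ p p) := rfl
  rw [h, inv_inv]

@[simp] theorem discChart_source (p : C) : (discChart p).source = (chartAt ℂ p).source := by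
  simp [discChart]

theorem mem_discChart_source (p : C) : p ∈ (discChart p).source := by simp

@[simp] theorem discChart_self (p : C) : discChart p p = 0 := by simp [discChart_apply]

theorem closedBall_subset_discChart_target (p : C) :
    Metric.closedBall 0 3 ⊆ (discChart p).target := by
  intro z hz
  rw [mem_closedBall_zero_iff] at hz
  have h : z ∈ (discChart p).target ↔
      z * ((discRadius p : ℂ)⁻¹)⁻¹ + chartAt ℂ p p ∈ (chartAt ℂ p).target := by
    simp only [discChart, mfld_simps]
    rfl
  rw [h, inv_inv]
  refine (exists_discRadius p).choose_spec.2 ?_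
  rw [mem_closedBall_iff_norm, add_sub_cancel_right, norm_mul, Complex.norm_real,
    Real.norm_of_nonneg (discRadius_pos p).le]
  exact mul_le_mul_of_nonneg_right hz (discRadius_pos p).le

theorem discChart_ne_zero {p x : C} (hx : x ∈ (discChart p).source) (hxp : x ≠ p) :
    discChart p x ≠ 0 := fun h =>
  hxp ((discChart p).injOn hx (mem_discChart_source p) (h.trans (discChart_self p).symm))

end Surface

/-! ### The surface -/

section Surface

variable {C : Type u} [TopologicalSpace C] [ChartedSpace ℂ C]

/-- The piece of the surface over the complement of `p`: all of the trivial bundle, except that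
close to `p`, over the compact coordinate disc of radius `3`, the coordinate `z ^ l w` is required
to be in the unit disc. -/
def outerPiece (p : C) (l : ℤ) : Set (C × ℂ) :=
  {a | a.1 ≠ p ∧ (a.1 ∈ (discChart p).source ∩ discChart p ⁻¹' Metric.closedBall 0 3 →
    ‖discChart p a.1 ^ l * a.2‖ < 1)}

/-- The piece of the surface close to `p`: the unit disc times `ℂ`. -/
def innerPiece : Set (ℂ × ℂ) := {b | ‖b.1‖ < 1}

theorem isOpen_innerPiece : IsOpen innerPiece := isOpen_lt continuous_fst.norm continuous_const

instance : Nonempty innerPiece := ⟨⟨0, by simp [innerPiece]⟩⟩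

theorem isClosed_discChart_preimage [T2Space C] (p : C) :
    IsClosed ((discChart p).source ∩ discChart p ⁻¹' Metric.closedBall 0 3) := by
  have h : (discChart p).source ∩ discChart p ⁻¹' Metric.closedBall 0 3 =
      (discChart p).symm '' Metric.closedBall 0 3 := by
    rw [(discChart p).symm_image_eq_source_inter_preimage (closedBall_subset_discChart_target p)]
  rw [h]
  exact ((isCompact_closedBall (0 : ℂ) 3).image_of_continuousOn
    ((discChart p).continuousOn_symm.mono (closedBall_subset_discChart_target p))).isClosed

theorem isOpen_outerPiece [T2Space C] (p : C) (l : ℤ) : IsOpen (outerPiece p l) := by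
  set K := (discChart p).source ∩ discChart p ⁻¹' Metric.closedBall 0 3 with hK
  set O : Set (C × ℂ) := {a | a.1 ∈ (discChart p).source ∩ {p}ᶜ} with hO
  have hOo : IsOpen O :=
    ((discChart p).open_source.inter isOpen_compl_singleton).preimage continuous_fst
  have hcont : ContinuousOn (fun a : C × ℂ => discChart p a.1 ^ l * a.2) O := by
    intro a ha
    refine (ContinuousAt.mul (ContinuousAt.zpow₀ ?_ l (Or.inl ?_)) continuousAt_snd).continuousWithinAt
    · exact ((discChart p).continuousAt ha.1).comp continuousAt_fst
    · exact discChart_ne_zero ha.1 ha.2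
  have h : outerPiece p l = ({a | a.1 ≠ p} ∩ {a | a.1 ∈ Kᶜ}) ∪
      (O ∩ (fun a : C × ℂ => discChart p a.1 ^ l * a.2) ⁻¹' Metric.ball 0 1) := by
    ext a
    simp only [outerPiece, mem_ofPred_eq, mem_union, mem_inter_iff, mem_compl_iff, hO, mem_preimage,
      mem_ball_zero_iff, mem_singleton_iff]
    constructor
    · rintro ⟨h1, h2⟩
      by_cases h3 : a.1 ∈ K
      · exact Or.inr ⟨⟨h3.1, h1⟩, h2 h3⟩
      · exact Or.inl ⟨h1, h3⟩
    · rintro (⟨h1, h2⟩ | ⟨⟨h1, h2⟩, h3⟩)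
      · exact ⟨h1, fun h => absurd h h2⟩
      · exact ⟨h2, fun _ => h3⟩
  rw [h]
  exact ((isOpen_ne_fun continuous_fst continuous_const).inter
    ((isClosed_discChart_preimage p).isOpen_compl.preimage continuous_fst)).union
    (hcont.isOpen_inter_preimage hOo Metric.isOpen_ball)

theorem mk_zero_mem_outerPiece {p x : C} (l : ℤ) (hx : x ≠ p) : (x, (0 : ℂ)) ∈ outerPiece p l :=
  ⟨hx, fun _ => by simp⟩

instance (p : C) (l : ℤ) : Nonempty (outerPiece p l) := by
  have h1 : (1 : ℂ) ∈ (discChart p).target := closedBall_subset_discChart_target p (by simp)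
  refine ⟨⟨((discChart p).symm 1, 0), mk_zero_mem_outerPiece l fun h => ?_⟩⟩
  have h2 := (discChart p).right_inv h1
  rw [h, discChart_self] at h2
  exact zero_ne_one h2

/-- The gluing map between the two pieces of the surface. -/
def transition (p : C) (l q : ℤ) : OpenPartialHomeomorph (C × ℂ) (ℂ × ℂ) :=
  (discChart p).prod (OpenPartialHomeomorph.refl ℂ) ≫ₕ twist l q

theorem transition_apply (p : C) (l q : ℤ) (a : C × ℂ) :
    transition p l q a = twistMap l q (discChart p a.1, a.2) := rfl

theorem mem_transition_source {p : C} {l q : ℤ} {a : C × ℂ} : a ∈ (transition p l q).source ↔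
    a.1 ∈ (discChart p).source ∧ (discChart p a.1, a.2) ∈ (twist l q).source := by
  simp [transition, -discChart_source]

/-- The surface containing the curve: the line bundle with transition function `z ^ (q + l)` at
`p`, glued along a modification of the usual transition map. -/
def TwistedSurface (p : C) (l q : ℤ) : Type u :=
  Glued (transition p l q) (outerPiece p l) innerPiece

namespace TwistedSurface

variable (p : C) (l q : ℤ)

instance : TopologicalSpace (TwistedSurface p l q) :=
  inferInstanceAs (TopologicalSpace (Glued _ _ _))

variable [T2Space C]

instance : T2Space (TwistedSurface p l q) := by
  refine Glued.t2Space (isOpen_outerPiece p l) isOpen_innerPiece ?_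
  intro a ha b hb hab
  by_cases hK : a.1 ∈ (discChart p).source ∩ discChart p ⁻¹' Metric.closedBall 0 3
  -- Over the disc of radius `3`, the transition map is continuous at `a` even outside its source,
  -- and its value there is not `b`. Elsewhere, a neighbourhood of `a` does not meet the source.
  · have hz := discChart_ne_zero hK.1 ha.1
    have hu := ha.2 hK
    have hcont : ContinuousAt (transition p l q) a := by
      refine ContinuousAt.comp (g := twistMap l q)
        (f := fun a : C × ℂ => (discChart p a.1, a.2)) ?_ ?_
      · exact (analyticAt_twistMap l q (a := (discChart p a.1, a.2)) hz).continuousAt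
      · exact (((discChart p).continuousAt hK.1).comp continuousAt_fst).prodMk continuousAt_snd
    have hne : transition p l q a ≠ b := by
      intro h
      refine hab ⟨mem_transition_source.2 ⟨hK.1, mem_twist_source.2 ⟨hz, ?_, hu, ?_⟩⟩, h⟩
      · have h1 : discChart p a.1 = b.1 * Complex.exp (-(discChart p a.1 ^ l * a.2)) := by
          rw [← h]
          simp only [transition_apply, twistMap]
          rw [mul_assoc, ← Complex.exp_add, add_neg_cancel, Complex.exp_zero, mul_one]
        show ‖discChart p a.1‖ < 3
        rw [h1]
        exact norm_mul_exp_lt_three hb (by rwa [norm_neg])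
      · rw [← transition_apply p l q a, h]
        exact hb
    obtain ⟨U, V, hU, hV, haU, hbV, hUV⟩ := t2_separation hne
    exact ⟨_, hcont.preimage_mem_nhds (hU.mem_nhds haU), V, hV.mem_nhds hbV,
      fun x hx _ _ hxV => disjoint_left.1 hUV hx hxV⟩
  · refine ⟨{x | x.1 ∉ (discChart p).source ∩ discChart p ⁻¹' Metric.closedBall 0 3},
      ((isClosed_discChart_preimage p).isOpen_compl.preimage continuous_fst).mem_nhds hK,
      univ, univ_mem, ?_⟩
    intro x hx _ hxs
    have h1 := mem_transition_source.1 hxs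
    exact absurd ⟨h1.1, by simpa using (mem_twist_source.1 h1.2).2.1.le⟩ hx

instance [CompactSpace C] : SecondCountableTopology (TwistedSurface p l q) := by
  have := ChartedSpace.secondCountable_of_sigmaCompact ℂ C
  exact Glued.secondCountableTopology (isOpen_outerPiece p l) isOpen_innerPiece

/-- The coordinates on the outer piece. -/
def outer : OpenPartialHomeomorph (TwistedSurface p l q) (C × ℂ) :=
  Glued.homeoLeft (isOpen_outerPiece p l)

/-- The coordinates on the inner piece. -/
def inner : OpenPartialHomeomorph (TwistedSurface p l q) (ℂ × ℂ) :=
  Glued.homeoRight isOpen_innerPiece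

@[simp] theorem outer_target : (outer p l q).target = outerPiece p l := Glued.homeoLeft_target _

@[simp] theorem inner_target : (inner p l q).target = innerPiece := Glued.homeoRight_target _

theorem mem_source_or (s : TwistedSurface p l q) :
    s ∈ (outer p l q).source ∨ s ∈ (inner p l q).source :=
  Glued.mem_source_or _ _ s

variable {p l q}

theorem transition_mem_innerPiece {a : C × ℂ} (h : a ∈ (transition p l q).source) :
    transition p l q a ∈ innerPiece :=
  (mem_twist_source.1 (mem_transition_source.1 h).2).2.2.2

theorem outer_symm_mem_iff {a : C × ℂ} (ha : a ∈ outerPiece p l) :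
    (outer p l q).symm a ∈ (inner p l q).source ↔ a ∈ (transition p l q).source :=
  (Glued.homeoLeft_symm_mem_iff (isOpen_outerPiece p l) isOpen_innerPiece ha).trans
    (and_iff_left_of_imp transition_mem_innerPiece)

theorem inner_outer_symm {a : C × ℂ} (ha : a ∈ outerPiece p l)
    (h : a ∈ (transition p l q).source) :
    inner p l q ((outer p l q).symm a) = transition p l q a :=
  Glued.homeoRight_homeoLeft_symm (isOpen_outerPiece p l) isOpen_innerPiece ha h
    (transition_mem_innerPiece h)

theorem outer_inner_symm {b : ℂ × ℂ} (hb : b ∈ innerPiece)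
    (h : (inner p l q).symm b ∈ (outer p l q).source) :
    b ∈ (transition p l q).target ∧
      outer p l q ((inner p l q).symm b) = (transition p l q).symm b := by
  have h1 : outer p l q ((inner p l q).symm b) ∈ outerPiece p l := by
    rw [← outer_target p l q]
    exact (outer p l q).map_source h
  have h2 := (outer p l q).left_inv h
  have hb' : b ∈ (inner p l q).target := by rwa [inner_target]
  have h3 := (outer_symm_mem_iff h1).1 (by rw [h2]; exact (inner p l q).map_target hb')
  have h4 := inner_outer_symm h1 h3
  rw [h2, (inner p l q).right_inv hb'] at h4
  refine ⟨h4 ▸ (transition p l q).map_source h3, ?_⟩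
  conv_rhs => rw [h4]
  rw [(transition p l q).left_inv h3]

variable (p l q)

/-- The chart of the surface defined by a chart of the curve. -/
def outerChart (x : C) : OpenPartialHomeomorph (TwistedSurface p l q) (ℂ × ℂ) :=
  outer p l q ≫ₕ (chartAt ℂ x).prod (OpenPartialHomeomorph.refl ℂ)

theorem outerChart_apply (x : C) (s : TwistedSurface p l q) :
    outerChart p l q x s = (chartAt ℂ x (outer p l q s).1, (outer p l q s).2) := rfl

theorem outerChart_symm_apply (x : C) (c : ℂ × ℂ) :
    (outerChart p l q x).symm c = (outer p l q).symm ((chartAt ℂ x).symm c.1, c.2) := rfl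

open Classical in
instance : ChartedSpace (ℂ × ℂ) (TwistedSurface p l q) where
  atlas := insert (inner p l q) (range (outerChart p l q))
  chartAt s := if s ∈ (outer p l q).source then outerChart p l q (outer p l q s).1 else inner p l q
  mem_chart_source s := by
    by_cases h : s ∈ (outer p l q).source
    · simp [h, outerChart]
    · simpa [h] using (mem_source_or p l q s).resolve_left h
  chart_mem_atlas s := by
    by_cases h : s ∈ (outer p l q).source
    · simp [h]
    · simp [h]

theorem chartAt_of_mem {s : TwistedSurface p l q} (h : s ∈ (outer p l q).source) :
    chartAt (ℂ × ℂ) s = outerChart p l q (outer p l q s).1 := if_pos h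

theorem chartAt_of_notMem {s : TwistedSurface p l q} (h : s ∉ (outer p l q).source) :
    chartAt (ℂ × ℂ) s = inner p l q := if_neg h

end TwistedSurface

variable [IsManifold 𝓘(ℂ) ω C]

theorem contDiffAt_chart_comp_symm (x y : C) {z : ℂ} (hz : z ∈ (chartAt ℂ x).target)
    (hy : (chartAt ℂ x).symm z ∈ (chartAt ℂ y).source) :
    ContDiffAt ℂ ω (chartAt ℂ y ∘ (chartAt ℂ x).symm) z := by
  have h := contMDiffOn_of_mem_contDiffGroupoid
    ((contDiffGroupoid ω 𝓘(ℂ)).compatible (chart_mem_atlas ℂ x) (chart_mem_atlas ℂ y))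
  rw [contMDiffOn_iff_contDiffOn] at h
  exact (h z (by simp [hz, hy])).contDiffAt
    (((chartAt ℂ x).symm ≫ₕ chartAt ℂ y).open_source.mem_nhds (by simp [hz, hy]))

theorem contDiffAt_discChart_comp_symm (x p : C) {z : ℂ} (hz : z ∈ (chartAt ℂ x).target)
    (hy : (chartAt ℂ x).symm z ∈ (discChart p).source) :
    ContDiffAt ℂ ω (discChart p ∘ (chartAt ℂ x).symm) z := by
  rw [discChart_source] at hy
  exact ((contDiffAt_chart_comp_symm x p hz hy).sub contDiffAt_const).mul contDiffAt_const

theorem contDiffAt_chart_comp_discChart_symm (x p : C) {z : ℂ} (hz : z ∈ (discChart p).target)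
    (hy : (discChart p).symm z ∈ (chartAt ℂ x).source) :
    ContDiffAt ℂ ω (chartAt ℂ x ∘ (discChart p).symm) z := by
  have h1 : ContDiffAt ℂ ω (fun z : ℂ => z * discRadius p + chartAt ℂ p p) z := by fun_prop
  have h2 : z * discRadius p + chartAt ℂ p p ∈ (chartAt ℂ p).target := by
    have h3 := (discChart p).right_inv hz
    rw [discChart_apply, mul_inv_eq_iff_eq_mul₀ (discRadius_ne_zero p), sub_eq_iff_eq_add] at h3
    rw [← h3]
    refine (chartAt ℂ p).map_source ?_
    rw [← discChart_source]
    exact (discChart p).map_target hz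
  rw [discChart_symm_apply] at hy
  have h4 : (discChart p).symm = fun z => (chartAt ℂ p).symm (z * discRadius p + chartAt ℂ p p) :=
    funext (discChart_symm_apply p)
  rw [h4]
  exact ContDiffAt.comp (g := chartAt ℂ x ∘ (chartAt ℂ p).symm) z
    (contDiffAt_chart_comp_symm p x h2 hy) h1

namespace TwistedSurface

variable (p : C) (l q : ℤ) [T2Space C]

instance : IsManifold 𝓘(ℂ, ℂ × ℂ) ω (TwistedSurface p l q) := by
  suffices h : ∀ e ∈ atlas (ℂ × ℂ) (TwistedSurface p l q),
      ∀ e' ∈ atlas (ℂ × ℂ) (TwistedSurface p l q), ∀ b ∈ (e.symm ≫ₕ e').source,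
      ContDiffAt ℂ ω (e' ∘ e.symm) b by
    refine isManifold_of_contDiffOn _ _ _ fun e e' he he' b hb => ?_
    simp only [mfld_simps] at hb ⊢
    exact (h e he e' he' b (by simpa only [mfld_simps] using hb)).contDiffWithinAt
  intro e he e' he' b hb
  have hev := (e.symm ≫ₕ e').open_source.mem_nhds hb
  rcases he with rfl | ⟨x, rfl⟩ <;> rcases he' with rfl | ⟨y, rfl⟩
  -- The four cases are `inner`-`inner`, `inner`-`outer`, `outer`-`inner` and `outer`-`outer`.
  · refine contDiffAt_id.congr_of_eventuallyEq ?_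
    filter_upwards [hev] with c hc
    exact (inner p l q).right_inv hc.1
  · have key : ∀ c ∈ ((inner p l q).symm ≫ₕ outerChart p l q y).source,
        (c ∈ (transition p l q).target ∧
          outer p l q ((inner p l q).symm c) = (transition p l q).symm c) ∧
        ((transition p l q).symm c).1 ∈ (chartAt ℂ y).source := by
      rintro c ⟨hc1, hc2⟩
      simp only [outerChart, mfld_simps] at hc1 hc2
      have h1 := outer_inner_symm (by simpa using hc1) hc2.1
      exact ⟨h1, h1.2 ▸ hc2.2⟩
    have hb1 := (key b hb).1.1
    simp only [transition, mfld_simps] at hb1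
    have h0 : b.1 ≠ 0 := hb1.1.1
    have h2 := (analyticAt_twistInv l q h0).contDiffAt (n := ω)
    have h3 : ContDiffAt ℂ ω (fun c => ((chartAt ℂ y ∘ (discChart p).symm) (twistInv l q c).1,
        (twistInv l q c).2)) b := by
      refine ContDiffAt.prodMk
        (ContDiffAt.comp (g := chartAt ℂ y ∘ (discChart p).symm) b ?_ h2.fst) h2.snd
      exact contDiffAt_chart_comp_discChart_symm y p hb1.2 (key b hb).2
    refine h3.congr_of_eventuallyEq ?_
    filter_upwards [hev] with c hc
    rw [Function.comp_apply, outerChart_apply, (key c hc).1.2]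
    rfl
  · have key : ∀ c ∈ ((outerChart p l q x).symm ≫ₕ inner p l q).source,
        c.1 ∈ (chartAt ℂ x).target ∧ ((chartAt ℂ x).symm c.1, c.2) ∈ outerPiece p l ∧
          ((chartAt ℂ x).symm c.1, c.2) ∈ (transition p l q).source := by
      rintro c ⟨hc1, hc2⟩
      simp only [outerChart, mfld_simps] at hc1 hc2
      have h1 : ((chartAt ℂ x).symm c.1, c.2) ∈ outerPiece p l := by simpa using hc1.2
      exact ⟨hc1.1, h1, (outer_symm_mem_iff h1).1 hc2⟩
    obtain ⟨h1, h2, h3⟩ := key b hb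
    rw [mem_transition_source] at h3
    have h4 : ContDiffAt ℂ ω (fun c : ℂ × ℂ =>
        ((discChart p ∘ (chartAt ℂ x).symm) c.1, c.2)) b := by
      refine ContDiffAt.prodMk (ContDiffAt.comp (g := discChart p ∘ (chartAt ℂ x).symm) b ?_
        contDiffAt_fst) contDiffAt_snd
      exact contDiffAt_discChart_comp_symm x p h1 h3.1
    have h5 := ContDiffAt.comp (g := twistMap l q) b
      (analyticAt_twistMap l q (mem_twist_source.1 h3.2).1).contDiffAt h4
    refine h5.congr_of_eventuallyEq ?_
    filter_upwards [hev] with c hc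
    obtain ⟨h1, h2, h3⟩ := key c hc
    rw [Function.comp_apply, outerChart_symm_apply, inner_outer_symm h2 h3, transition_apply]
    rfl
  · have key : ∀ c ∈ ((outerChart p l q x).symm ≫ₕ outerChart p l q y).source,
        c.1 ∈ (chartAt ℂ x).target ∧ ((chartAt ℂ x).symm c.1, c.2) ∈ outerPiece p l ∧
          (chartAt ℂ x).symm c.1 ∈ (chartAt ℂ y).source := by
      rintro c ⟨hc1, hc2⟩
      simp only [outerChart, mfld_simps] at hc1 hc2
      have h1 : ((chartAt ℂ x).symm c.1, c.2) ∈ outerPiece p l := by simpa using hc1.2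
      have h2 := hc2.2
      rw [(outer p l q).right_inv (by simpa using h1)] at h2
      exact ⟨hc1.1, h1, h2⟩
    obtain ⟨h1, h2, h3⟩ := key b hb
    have h4 : ContDiffAt ℂ ω (fun c : ℂ × ℂ =>
        ((chartAt ℂ y ∘ (chartAt ℂ x).symm) c.1, c.2)) b := by
      refine ContDiffAt.prodMk (ContDiffAt.comp (g := chartAt ℂ y ∘ (chartAt ℂ x).symm) b ?_
        contDiffAt_fst) contDiffAt_snd
      exact contDiffAt_chart_comp_symm x y h1 h3
    refine h4.congr_of_eventuallyEq ?_
    filter_upwards [hev] with c hc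
    obtain ⟨h1, h2, h3⟩ := key c hc
    rw [Function.comp_apply, outerChart_symm_apply, outerChart_apply,
      (outer p l q).right_inv (by simpa using h2)]
    rfl

end TwistedSurface

end Surface

/-! ### The normal bundle in coordinates -/

section Coordinates

variable {C : Type u} [TopologicalSpace C] [ChartedSpace ℂ C] [IsManifold 𝓘(ℂ) ω C]
  {S : Type v} [TopologicalSpace S] [ChartedSpace (ℂ × ℂ) S] [IsManifold 𝓘(ℂ, ℂ × ℂ) ω S]

/-- A tangent vector at `y` is identified with a vector of `ℂ²` by the preferred chart at `y`; its
coordinates in the chart at `y₀` are given by the derivative of the change of charts. -/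
theorem surfCoord_eq_fderiv {y₀ y : S} (hy : y ∈ (chartAt (ℂ × ℂ) y₀).source)
    (v : TangentSpace 𝓘(ℂ, ℂ × ℂ) y) :
    surfCoord y₀ y v = fderiv ℂ (chartAt (ℂ × ℂ) y₀ ∘ (chartAt (ℂ × ℂ) y).symm)
      (chartAt (ℂ × ℂ) y y) (v : ℂ × ℂ) := by
  have h1 := DFunLike.congr_fun
    (TangentBundle.continuousLinearMapAt_trivializationAt_eq_core (I := 𝓘(ℂ, ℂ × ℂ)) hy) v
  refine h1.trans ?_
  have h2 : tangentCoordChange 𝓘(ℂ, ℂ × ℂ) y y₀ y =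
      fderivWithin ℂ (chartAt (ℂ × ℂ) y₀ ∘ (chartAt (ℂ × ℂ) y).symm) (range (id : ℂ × ℂ → ℂ × ℂ))
        (chartAt (ℂ × ℂ) y y) := rfl
  rw [range_id, fderivWithin_univ] at h2
  exact DFunLike.congr_fun h2 _

theorem mfderiv_curveFrame_eq_fderiv (i : HolomorphicEmbedding C S) {x₀ x : C}
    (hx : x ∈ normalDomain i x₀) :
    surfCoord (i x₀) (i x) (mfderiv 𝓘(ℂ) 𝓘(ℂ, ℂ × ℂ) i x (curveFrame x₀ x)) =
      fderiv ℂ (chartAt (ℂ × ℂ) (i x₀) ∘ i ∘ (chartAt ℂ x₀).symm) (chartAt ℂ x₀ x) 1 := by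
  have h1 := TangentBundle.continuousLinearMapAt_trivializationAt (I := 𝓘(ℂ, ℂ × ℂ)) hx.2
  have h2 := TangentBundle.symmL_trivializationAt (I := 𝓘(ℂ)) hx.1
  have e1 : (extChartAt 𝓘(ℂ) x₀).symm (extChartAt 𝓘(ℂ) x₀ x) = x :=
    (extChartAt 𝓘(ℂ) x₀).left_inv (by rw [extChartAt_source]; exact hx.1)
  have d1 : MDifferentiableAt 𝓘(ℂ) 𝓘(ℂ) (extChartAt 𝓘(ℂ) x₀).symm (extChartAt 𝓘(ℂ) x₀ x) := by
    have := mdifferentiableWithinAt_extChartAt_symm (I := 𝓘(ℂ)) (x := x₀)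
      (z := extChartAt 𝓘(ℂ) x₀ x)
      ((extChartAt 𝓘(ℂ) x₀).map_source (by rw [extChartAt_source]; exact hx.1))
    rwa [modelWithCornersSelf_coe, range_id, mdifferentiableWithinAt_univ] at this
  have d2 : MDifferentiableAt 𝓘(ℂ) 𝓘(ℂ, ℂ × ℂ) i x :=
    (i.contMDiff x).mdifferentiableAt (by simp)
  have d3 : MDifferentiableAt 𝓘(ℂ, ℂ × ℂ) 𝓘(ℂ, ℂ × ℂ) (extChartAt 𝓘(ℂ, ℂ × ℂ) (i x₀)) (i x) :=
    mdifferentiableAt_extChartAt hx.2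
  have h3 : HasMFDerivAt 𝓘(ℂ) 𝓘(ℂ, ℂ × ℂ)
      (extChartAt 𝓘(ℂ, ℂ × ℂ) (i x₀) ∘ i ∘ (extChartAt 𝓘(ℂ) x₀).symm) (extChartAt 𝓘(ℂ) x₀ x)
      ((mfderiv 𝓘(ℂ, ℂ × ℂ) 𝓘(ℂ, ℂ × ℂ) (extChartAt 𝓘(ℂ, ℂ × ℂ) (i x₀)) (i x)).comp
        ((mfderiv 𝓘(ℂ) 𝓘(ℂ, ℂ × ℂ) i x).comp
        (mfderiv 𝓘(ℂ) 𝓘(ℂ) (extChartAt 𝓘(ℂ) x₀).symm (extChartAt 𝓘(ℂ) x₀ x)))) := by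
    refine HasMFDerivAt.comp (I' := 𝓘(ℂ, ℂ × ℂ)) _ ?_
      (HasMFDerivAt.comp (I' := 𝓘(ℂ)) _ ?_ d1.hasMFDerivAt)
    · have aux : ∀ x', x' = x → HasMFDerivAt 𝓘(ℂ, ℂ × ℂ) 𝓘(ℂ, ℂ × ℂ)
          (extChartAt 𝓘(ℂ, ℂ × ℂ) (i x₀)) (i x')
          (mfderiv 𝓘(ℂ, ℂ × ℂ) 𝓘(ℂ, ℂ × ℂ) (extChartAt 𝓘(ℂ, ℂ × ℂ) (i x₀)) (i x) :
            ℂ × ℂ →L[ℂ] ℂ × ℂ) := by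
        rintro _ rfl
        exact d3.hasMFDerivAt
      exact aux _ e1
    · rw [e1]
      exact d2.hasMFDerivAt
  have h4 : fderiv ℂ (chartAt (ℂ × ℂ) (i x₀) ∘ i ∘ (chartAt ℂ x₀).symm) (chartAt ℂ x₀ x) = _ :=
    mfderiv_eq_fderiv.symm.trans h3.mfderiv
  have h5 := congrArg (fun L : ℂ →L[ℂ] ℂ × ℂ => L 1) h4
  refine Eq.trans ?_ h5.symm
  have h6 : curveFrame x₀ x =
      mfderiv 𝓘(ℂ) 𝓘(ℂ) (extChartAt 𝓘(ℂ) x₀).symm (extChartAt 𝓘(ℂ) x₀ x) (1 : ℂ) := by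
    rw [modelWithCornersSelf_coe, range_id, mfderivWithin_univ] at h2
    exact congrArg (fun L : ℂ →L[ℂ] ℂ => L 1) h2
  rw [h6]
  exact congrArg (fun L : ℂ × ℂ →L[ℂ] ℂ × ℂ => L _) h1

/-- The normal class of a vector field along the curve, in the preferred trivialization. -/
theorem localExpr_normalClass (i : HolomorphicEmbedding C S)
    (w : ∀ y : C, TangentSpace 𝓘(ℂ, ℂ × ℂ) (i y)) {x₀ : C} {z : ℂ}
    (hz : (chartAt ℂ x₀).symm z ∈ normalDomain i x₀) :
    localExpr (CurveNormalSpace i) (fun y => normalClass i y (w y)) x₀ z =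
      normalForm i x₀ ((chartAt ℂ x₀).symm z) (w ((chartAt ℂ x₀).symm z)) := by
  exact normalCoord_class i hz _

/-- A section of the tangent bundle of the curve, in the preferred trivialization at `x₀`, is its
value multiplied by the derivative of the change of charts. -/
theorem localExpr_tangent (s : C → ℂ) {x₀ : C} {z : ℂ} :
    localExpr (fun x : C => TangentSpace 𝓘(ℂ) x) s x₀ z =
      deriv (chartAt ℂ x₀ ∘ (chartAt ℂ ((chartAt ℂ x₀).symm z)).symm)
        (chartAt ℂ ((chartAt ℂ x₀).symm z) ((chartAt ℂ x₀).symm z)) *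
        s ((chartAt ℂ x₀).symm z) := by
  have h : localExpr (fun x : C => TangentSpace 𝓘(ℂ) x) s x₀ z =
      fderivWithin ℂ (chartAt ℂ x₀ ∘ (chartAt ℂ ((chartAt ℂ x₀).symm z)).symm) (range (id : ℂ → ℂ))
        (chartAt ℂ ((chartAt ℂ x₀).symm z) ((chartAt ℂ x₀).symm z))
        (s ((chartAt ℂ x₀).symm z)) := rfl
  rw [h, range_id, fderivWithin_univ, fderiv_eq_smul_deriv, smul_eq_mul, mul_comm]

end Coordinates

namespace TwistedSurface

/-! ### The curve in the surface -/

section Curve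

variable {C : Type u} [TopologicalSpace C] [ChartedSpace ℂ C] [T2Space C] (p : C) (l q : ℤ)

open Classical in
/-- The curve `C` in the surface, given by `w = 0` in both pieces. -/
def curve (x : C) : TwistedSurface p l q :=
  if x = p then (inner p l q).symm (0, 0) else (outer p l q).symm (x, 0)

variable {p}

theorem curve_of_ne {x : C} (hx : x ≠ p) : curve p l q x = (outer p l q).symm (x, 0) := if_neg hx

theorem mk_zero_mem_target {x : C} (hx : x ≠ p) : (x, (0 : ℂ)) ∈ (outer p l q).target := by
  rw [outer_target]
  exact mk_zero_mem_outerPiece l hx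

theorem curve_mem_outer {x : C} (hx : x ≠ p) : curve p l q x ∈ (outer p l q).source := by
  rw [curve_of_ne l q hx]
  exact (outer p l q).map_target (mk_zero_mem_target l q hx)

theorem outer_curve {x : C} (hx : x ≠ p) : outer p l q (curve p l q x) = (x, 0) := by
  rw [curve_of_ne l q hx, (outer p l q).right_inv (mk_zero_mem_target l q hx)]

theorem mk_zero_mem_transition {x : C} (hx : x ≠ p) (hxs : x ∈ (discChart p).source)
    (h1 : ‖discChart p x‖ < 1) : (x, (0 : ℂ)) ∈ (transition p l q).source := by
  refine mem_transition_source.2 ⟨hxs, mem_twist_source.2 ⟨discChart_ne_zero hxs hx, ?_, ?_, ?_⟩⟩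
  · exact h1.trans (by norm_num)
  · simp
  · simpa [twistMap] using h1

theorem curve_eq_inner_symm {x : C} (hxs : x ∈ (discChart p).source) (h1 : ‖discChart p x‖ < 1) :
    curve p l q x = (inner p l q).symm (discChart p x, 0) := by
  by_cases hx : x = p
  · rw [hx, discChart_self]
    exact if_pos rfl
  · have h2 := mk_zero_mem_transition l q hx hxs h1
    have h3 := inner_outer_symm (q := q) (mk_zero_mem_outerPiece l hx) h2
    rw [transition_apply, twistMap_zero] at h3
    rw [← h3, (inner p l q).left_inv, curve_of_ne l q hx]
    exact (outer_symm_mem_iff (mk_zero_mem_outerPiece l hx)).2 h2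

theorem curve_self_notMem_outer : curve p l q p ∉ (outer p l q).source := by
  intro h
  rw [curve_eq_inner_symm l q (mem_discChart_source p) (by simp), discChart_self] at h
  have h1 := (outer_inner_symm (by simp [innerPiece]) h).1
  simp only [transition, mfld_simps] at h1
  exact h1.1.1 rfl

theorem chartAt_curve {x : C} (hx : x ≠ p) :
    chartAt (ℂ × ℂ) (curve p l q x) = outerChart p l q x := by
  rw [chartAt_of_mem p l q (curve_mem_outer l q hx), outer_curve l q hx]

theorem chartAt_curve_self : chartAt (ℂ × ℂ) (curve p l q p) = inner p l q :=
  chartAt_of_notMem p l q (curve_self_notMem_outer l q)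

theorem mem_outerChart_source {x y : C} (hy : y ≠ p) (h : y ∈ (chartAt ℂ x).source) :
    curve p l q y ∈ (outerChart p l q x).source := by
  simp only [outerChart, mfld_simps]
  exact ⟨curve_mem_outer l q hy, by rwa [outer_curve l q hy]⟩

theorem outerChart_curve {x y : C} (hy : y ≠ p) :
    outerChart p l q x (curve p l q y) = (chartAt ℂ x y, 0) := by
  rw [outerChart_apply, outer_curve l q hy]

theorem curve_mem_inner {y : C} (hy : y ∈ (discChart p).source) (h1 : ‖discChart p y‖ < 1) :
    curve p l q y ∈ (inner p l q).source := by
  rw [curve_eq_inner_symm l q hy h1]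
  exact (inner p l q).map_target (by rw [inner_target]; exact h1)

theorem inner_curve {y : C} (hy : y ∈ (discChart p).source) (h1 : ‖discChart p y‖ < 1) :
    inner p l q (curve p l q y) = (discChart p y, 0) := by
  rw [curve_eq_inner_symm l q hy h1, (inner p l q).right_inv (by rw [inner_target]; exact h1)]

variable (p) in
theorem eventually_mem_disc :
    ∀ᶠ y in 𝓝 p, y ∈ (discChart p).source ∧ ‖discChart p y‖ < 1 := by
  refine ((discChart p).open_source.eventually_mem (mem_discChart_source p)).and ?_
  have h1 := ((discChart p).continuousAt (mem_discChart_source p)).norm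
  exact h1.eventually_lt continuousAt_const (by simp)

theorem eventually_ne_and_mem {x : C} (hx : x ≠ p) :
    ∀ᶠ y in 𝓝 x, y ≠ p ∧ y ∈ (chartAt ℂ x).source :=
  (isOpen_ne.eventually_mem hx).and
    ((chartAt ℂ x).open_source.eventually_mem (mem_chart_source ℂ x))

theorem curve_injective : Function.Injective (curve p l q) := by
  intro x y hxy
  by_cases hx : x = p <;> by_cases hy : y = p
  · rw [hx, hy]
  · exact absurd (hxy ▸ curve_mem_outer l q hy) (hx ▸ curve_self_notMem_outer l q)
  · exact absurd (hxy ▸ curve_mem_outer l q hx) (hy ▸ curve_self_notMem_outer l q)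
  · have h := congrArg (outer p l q) hxy
    rw [outer_curve l q hx, outer_curve l q hy] at h
    exact congrArg Prod.fst h

variable [IsManifold 𝓘(ℂ) ω C]

theorem contMDiff_curve : ContMDiff 𝓘(ℂ) 𝓘(ℂ, ℂ × ℂ) ω (curve p l q) := by
  intro x
  have hc : ContMDiffAt 𝓘(ℂ) 𝓘(ℂ) ω (chartAt ℂ x) x :=
    contMDiffOn_chart.contMDiffAt ((chartAt ℂ x).open_source.mem_nhds (mem_chart_source ℂ x))
  have hs := contMDiffOn_chart_symm (I := 𝓘(ℂ, ℂ × ℂ)) (n := ω) (x := curve p l q x)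
  have hs' : ContMDiffAt 𝓘(ℂ, ℂ × ℂ) 𝓘(ℂ, ℂ × ℂ) ω (chartAt (ℂ × ℂ) (curve p l q x)).symm
      (chartAt (ℂ × ℂ) (curve p l q x) (curve p l q x)) :=
    hs.contMDiffAt ((chartAt (ℂ × ℂ) (curve p l q x)).open_target.mem_nhds
      (mem_chart_target _ _))
  by_cases hx : x = p
  · subst hx
    rw [chartAt_curve_self, inner_curve l q (mem_discChart_source x) (by simp)] at hs'
    have h2 : ContMDiffAt 𝓘(ℂ) 𝓘(ℂ, ℂ × ℂ) ω (fun y => (discChart x y, (0 : ℂ))) x := by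
      refine ContMDiffAt.prodMk_space ?_ contMDiffAt_const
      exact (hc.sub contMDiffAt_const).mul contMDiffAt_const
    refine (hs'.comp x h2).congr_of_eventuallyEq ?_
    filter_upwards [eventually_mem_disc x] with y hy
    exact curve_eq_inner_symm l q hy.1 hy.2
  · rw [chartAt_curve l q hx, outerChart_curve l q hx] at hs'
    have h2 : ContMDiffAt 𝓘(ℂ) 𝓘(ℂ, ℂ × ℂ) ω (fun y => (chartAt ℂ x y, (0 : ℂ))) x :=
      hc.prodMk_space contMDiffAt_const
    refine (hs'.comp x h2).congr_of_eventuallyEq ?_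
    filter_upwards [eventually_ne_and_mem hx] with y hy
    rw [Function.comp_apply, ← outerChart_curve l q hy.1,
      (outerChart p l q x).left_inv (mem_outerChart_source l q hy.1 hy.2)]

theorem mfderiv_curve_injective (x : C) :
    Function.Injective (mfderiv 𝓘(ℂ) 𝓘(ℂ, ℂ × ℂ) (curve p l q) x) := by
  have hd : MDifferentiableAt 𝓘(ℂ) 𝓘(ℂ, ℂ × ℂ) (curve p l q) x :=
    (contMDiff_curve l q x).mdifferentiableAt (by simp)
  have hinj : Function.Injective (mfderiv 𝓘(ℂ) 𝓘(ℂ) (chartAt ℂ x) x) :=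
    (mdifferentiable_chart (I := 𝓘(ℂ)) x).mfderiv_injective (mem_chart_source ℂ x)
  -- A chart of the curve factors through the embedding.
  obtain ⟨r, hr, hrc⟩ : ∃ r : TwistedSurface p l q → ℂ,
      MDifferentiableAt 𝓘(ℂ, ℂ × ℂ) 𝓘(ℂ) r (curve p l q x) ∧
        r ∘ curve p l q =ᶠ[𝓝 x] chartAt ℂ x := by
    have hchart : MDifferentiableAt 𝓘(ℂ, ℂ × ℂ) 𝓘(ℂ, ℂ × ℂ)
        (chartAt (ℂ × ℂ) (curve p l q x)) (curve p l q x) :=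
      (mdifferentiable_chart (I := 𝓘(ℂ, ℂ × ℂ)) _).mdifferentiableAt (mem_chart_source _ _)
    by_cases hx : x = p
    · subst hx
      refine ⟨(fun b : ℂ × ℂ => b.1 * discRadius x + chartAt ℂ x x) ∘
        chartAt (ℂ × ℂ) (curve x l q x), MDifferentiableAt.comp _ ?_ hchart, ?_⟩
      · exact DifferentiableAt.mdifferentiableAt (by fun_prop)
      · filter_upwards [eventually_mem_disc x] with y hy
        rw [Function.comp_apply, Function.comp_apply, chartAt_curve_self,
          inner_curve l q hy.1 hy.2, discChart_apply]
        simp only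
        rw [inv_mul_cancel_right₀ (discRadius_ne_zero x), sub_add_cancel]
    · refine ⟨Prod.fst ∘ chartAt (ℂ × ℂ) (curve p l q x), MDifferentiableAt.comp _ ?_ hchart, ?_⟩
      · exact DifferentiableAt.mdifferentiableAt (by fun_prop)
      · filter_upwards [eventually_ne_and_mem hx] with y hy
        rw [Function.comp_apply, Function.comp_apply, chartAt_curve l q hx,
          outerChart_curve l q hy.1]
  rw [← hrc.mfderiv_eq, mfderiv_comp x hr hd] at hinj
  exact Function.Injective.of_comp hinj

/-- The embedding of the curve `C` in the surface. -/
def embedding (p : C) [CompactSpace C] : HolomorphicEmbedding C (TwistedSurface p l q) where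
  toFun := curve p l q
  isEmbedding := ((contMDiff_curve l q).continuous.isClosedEmbedding
    (curve_injective l q)).isEmbedding
  contMDiff := contMDiff_curve l q
  mfderiv_injective := mfderiv_curve_injective l q

theorem connectedSpace [ConnectedSpace C] : ConnectedSpace (TwistedSurface p l q) := by
  have hcont : Continuous (curve p l q) := (contMDiff_curve l q).continuous
  have hr : IsPreconnected (range (curve p l q)) := isPreconnected_range hcont
  have hI : IsPreconnected (Icc (0 : ℝ) 1) := isPreconnected_Icc
  suffices h : IsPreconnected (univ : Set (TwistedSurface p l q)) by
    have : PreconnectedSpace (TwistedSurface p l q) := ⟨h⟩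
    exact ⟨⟨curve p l q p⟩⟩
  -- Every point is joined to the curve inside a fibre.
  refine isPreconnected_of_forall (curve p l q p) fun s _ => ?_
  suffices h : ∃ γ : ℝ → TwistedSurface p l q, ContinuousOn γ (Icc 0 1) ∧ γ 1 = s ∧
      γ 0 ∈ range (curve p l q) by
    obtain ⟨γ, h1, h2, h3⟩ := h
    refine ⟨range (curve p l q) ∪ γ '' Icc 0 1, subset_univ _, Or.inl (mem_range_self p),
      Or.inr ⟨1, by simp, h2⟩, ?_⟩
    exact IsPreconnected.union (γ 0) h3 ⟨0, by simp, rfl⟩ hr (hI.image γ h1)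
  rcases mem_source_or p l q s with hs | hs
  · have ht := (outer p l q).map_source hs
    set a := outer p l q s with ha
    rw [outer_target] at ht
    refine ⟨fun t => (outer p l q).symm (a.1, t * a.2), ?_, ?_, ?_⟩
    · refine (outer p l q).continuousOn_symm.comp (by fun_prop) fun t ht' => ?_
      rw [outer_target]
      refine ⟨ht.1, fun h => ?_⟩
      show ‖discChart p a.1 ^ l * (t * a.2)‖ < 1
      rw [mul_left_comm, norm_mul, Complex.norm_real, Real.norm_of_nonneg ht'.1]
      exact (mul_le_of_le_one_left (norm_nonneg _) ht'.2).trans_lt (ht.2 h)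
    · simp only [Complex.ofReal_one, one_mul, Prod.mk.eta]
      exact (outer p l q).left_inv hs
    · refine ⟨a.1, ?_⟩
      simp only [Complex.ofReal_zero, zero_mul]
      exact curve_of_ne l q ht.1
  · have ht := (inner p l q).map_source hs
    set b := inner p l q s with hb
    rw [inner_target] at ht
    have hb3 : b.1 ∈ (discChart p).target := by
      refine closedBall_subset_discChart_target p ?_
      rw [mem_closedBall_zero_iff]
      exact ht.le.trans (by norm_num)
    refine ⟨fun t => (inner p l q).symm (b.1, t * b.2), ?_, ?_, ?_⟩
    · refine (inner p l q).continuousOn_symm.comp (by fun_prop) fun t ht' => ?_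
      rw [inner_target]
      exact ht
    · simp only [Complex.ofReal_one, one_mul, Prod.mk.eta]
      exact (inner p l q).left_inv hs
    · refine ⟨(discChart p).symm b.1, ?_⟩
      have h1 := (discChart p).right_inv hb3
      rw [curve_eq_inner_symm l q ((discChart p).map_target hb3) (by rw [h1]; exact ht), h1]
      simp

end Curve

end TwistedSurface

/-! ### Tangent vectors of the surface along the curve -/

namespace TwistedSurface

section Tangent

variable {C : Type u} [TopologicalSpace C] [ChartedSpace ℂ C] [T2Space C] [CompactSpace C]
  [IsManifold 𝓘(ℂ) ω C] (p : C) (l q : ℤ)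

/-- The derivative at `y` of the change of charts from the preferred chart at `y` to the preferred
chart at `x`. -/
def chartDeriv (x y : C) : ℂ := deriv (chartAt ℂ x ∘ (chartAt ℂ y).symm) (chartAt ℂ y y)

theorem hasDerivAt_chart {x y : C} (hy : y ∈ (chartAt ℂ x).source) :
    HasDerivAt (chartAt ℂ x ∘ (chartAt ℂ y).symm) (chartDeriv x y) (chartAt ℂ y y) := by
  have h := contDiffAt_chart_comp_symm y x (mem_chart_target ℂ y)
    (by rwa [(chartAt ℂ y).left_inv (mem_chart_source ℂ y)])
  exact (h.differentiableAt (by simp)).hasDerivAt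

variable {p}

theorem coe_embedding (x : C) : embedding l q p x = curve p l q x := rfl

theorem mem_normalDomain {x y : C} (hx : x ≠ p) (hy : y ≠ p) (hyx : y ∈ (chartAt ℂ x).source) :
    y ∈ normalDomain (embedding l q p) x := by
  refine ⟨hyx, ?_⟩
  show curve p l q y ∈ (chartAt (ℂ × ℂ) (curve p l q x)).source
  rw [chartAt_curve l q hx]
  exact mem_outerChart_source l q hy hyx

theorem mem_normalDomain_self {y : C} (hy : y ∈ (discChart p).source) (h1 : ‖discChart p y‖ < 1) :
    y ∈ normalDomain (embedding l q p) p := by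
  refine ⟨by rwa [discChart_source] at hy, ?_⟩
  show curve p l q y ∈ (chartAt (ℂ × ℂ) (curve p l q p)).source
  rw [chartAt_curve_self l q]
  exact curve_mem_inner l q hy h1

theorem chart_eventually {x y : C} {P : C → Prop} (hyx : y ∈ (chartAt ℂ x).source)
    (h : ∀ᶠ w in 𝓝 y, P w) : ∀ᶠ z in 𝓝 (chartAt ℂ x y), P ((chartAt ℂ x).symm z) := by
  have h1 := (chartAt ℂ x).continuousAt_symm ((chartAt ℂ x).map_source hyx)
  rw [ContinuousAt, (chartAt ℂ x).left_inv hyx] at h1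
  exact h1.eventually h

/-- Away from `p`, the tangent vector of the curve is the first coordinate vector. -/
theorem surfCoord_curveFrame {x y : C} (hx : x ≠ p) (hy : y ≠ p) (hyx : y ∈ (chartAt ℂ x).source) :
    surfCoord (embedding l q p x) (embedding l q p y)
      (mfderiv 𝓘(ℂ) 𝓘(ℂ, ℂ × ℂ) (embedding l q p) y (curveFrame x y)) = (1, 0) := by
  rw [mfderiv_curveFrame_eq_fderiv _ (mem_normalDomain l q hx hy hyx)]
  have h : chartAt (ℂ × ℂ) (embedding l q p x) ∘ embedding l q p ∘ (chartAt ℂ x).symm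
      =ᶠ[𝓝 (chartAt ℂ x y)] fun z => (z, (0 : ℂ)) := by
    filter_upwards [chart_eventually hyx (isOpen_ne.eventually_mem hy),
      (chartAt ℂ x).open_target.eventually_mem ((chartAt ℂ x).map_source hyx)] with z hz hzt
    rw [Function.comp_apply, Function.comp_apply, coe_embedding, coe_embedding,
      chartAt_curve l q hx, outerChart_curve l q hz, (chartAt ℂ x).right_inv hzt]
  rw [h.fderiv_eq, fderiv_eq_smul_deriv,
    ((hasDerivAt_id _).prodMk (hasDerivAt_const _ _)).deriv, one_smul]

/-- Close to `p`, the tangent vector of the curve is a multiple of the first coordinate vector. -/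
theorem surfCoord_curveFrame_self {y : C} (hy : y ∈ (discChart p).source)
    (h1 : ‖discChart p y‖ < 1) :
    surfCoord (embedding l q p p) (embedding l q p y)
      (mfderiv 𝓘(ℂ) 𝓘(ℂ, ℂ × ℂ) (embedding l q p) y (curveFrame p y)) =
        ((discRadius p : ℂ)⁻¹, 0) := by
  rw [mfderiv_curveFrame_eq_fderiv _ (mem_normalDomain_self l q hy h1)]
  have hyp : y ∈ (chartAt ℂ p).source := by rwa [discChart_source] at hy
  have h : chartAt (ℂ × ℂ) (embedding l q p p) ∘ embedding l q p ∘ (chartAt ℂ p).symm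
      =ᶠ[𝓝 (chartAt ℂ p y)] fun z => ((z - chartAt ℂ p p) * (discRadius p : ℂ)⁻¹, (0 : ℂ)) := by
    have h2 : ∀ᶠ w in 𝓝 y, ‖discChart p w‖ < 1 :=
      ((discChart p).continuousAt hy).norm.eventually_lt continuousAt_const h1
    filter_upwards [chart_eventually hyp ((discChart p).open_source.eventually_mem hy),
      chart_eventually hyp h2,
      (chartAt ℂ p).open_target.eventually_mem ((chartAt ℂ p).map_source hyp)] with z hz hz1 hzt
    rw [Function.comp_apply, Function.comp_apply, coe_embedding, coe_embedding,
      chartAt_curve_self l q, inner_curve l q hz hz1, discChart_apply, (chartAt ℂ p).right_inv hzt]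
  rw [h.fderiv_eq, fderiv_eq_smul_deriv]
  have h3 := ((hasDerivAt_id (chartAt ℂ p y)).sub_const (chartAt ℂ p p)).mul_const
    (discRadius p : ℂ)⁻¹
  rw [one_mul] at h3
  rw [one_smul]
  exact (h3.prodMk (hasDerivAt_const _ _)).deriv

theorem continuousAt_chart_symm_prod (y : C) :
    ContinuousAt (fun c : ℂ × ℂ => ((chartAt ℂ y).symm c.1, c.2)) (chartAt ℂ y y, (0 : ℂ)) :=
  (ContinuousAt.comp (g := (chartAt ℂ y).symm) (f := Prod.fst) (x := (chartAt ℂ y y, (0 : ℂ)))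
    ((chartAt ℂ y).continuousAt_symm (mem_chart_target ℂ y)) continuousAt_fst).prodMk
    continuousAt_snd

theorem eventually_mem_outerPiece {y : C} (hy : y ≠ p) :
    ∀ᶠ c in 𝓝 (chartAt ℂ y y, (0 : ℂ)), ((chartAt ℂ y).symm c.1, c.2) ∈ outerPiece p l := by
  refine (continuousAt_chart_symm_prod y).eventually ((isOpen_outerPiece p l).eventually_mem ?_)
  simp only [(chartAt ℂ y).left_inv (mem_chart_source ℂ y)]
  exact mk_zero_mem_outerPiece l hy

/-- The coordinates of a tangent vector of the surface at a point of the curve, away from `p`. -/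
theorem surfCoord_outer {x y : C} (hx : x ≠ p) (hy : y ≠ p) (hyx : y ∈ (chartAt ℂ x).source)
    (v : ℂ × ℂ) :
    surfCoord (embedding l q p x) (embedding l q p y) v = (chartDeriv x y * v.1, v.2) := by
  refine (surfCoord_eq_fderiv (mem_normalDomain l q hx hy hyx).2 v).trans ?_
  have h : chartAt (ℂ × ℂ) (embedding l q p x) ∘ (chartAt (ℂ × ℂ) (embedding l q p y)).symm
      =ᶠ[𝓝 (chartAt ℂ y y, (0 : ℂ))]
        fun c => ((chartAt ℂ x ∘ (chartAt ℂ y).symm) c.1, c.2) := by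
    filter_upwards [eventually_mem_outerPiece l hy] with c hc
    rw [Function.comp_apply, coe_embedding, coe_embedding, chartAt_curve l q hx,
      chartAt_curve l q hy, outerChart_symm_apply, outerChart_apply,
      (outer p l q).right_inv (by rw [outer_target]; exact hc)]
    rfl
  have hb : chartAt (ℂ × ℂ) (embedding l q p y) (embedding l q p y) = (chartAt ℂ y y, (0 : ℂ)) := by
    rw [coe_embedding, chartAt_curve l q hy, outerChart_curve l q hy]
  rw [hb, h.fderiv_eq]
  have h1 : HasFDerivAt (fun c : ℂ × ℂ => (chartAt ℂ x ∘ (chartAt ℂ y).symm) c.1) _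
      (chartAt ℂ y y, (0 : ℂ)) :=
    HasFDerivAt.comp (g := chartAt ℂ x ∘ (chartAt ℂ y).symm) _
      (hasDerivAt_chart hyx).hasFDerivAt hasFDerivAt_fst
  rw [(h1.prodMk hasFDerivAt_snd).fderiv]
  simp [mul_comm]

/-- The coordinates of a tangent vector of the surface at a point of the curve, close to `p`. -/
theorem surfCoord_inner {y : C} (hy : y ≠ p) (hys : y ∈ (discChart p).source)
    (h1 : ‖discChart p y‖ < 1) (v : ℂ × ℂ) :
    surfCoord (embedding l q p p) (embedding l q p y) v =
      ((discRadius p : ℂ)⁻¹ * (chartDeriv p y * v.1) + discChart p y ^ (l + 1) * v.2,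
        discChart p y ^ (q + l) * v.2) := by
  refine (surfCoord_eq_fderiv (mem_normalDomain_self l q hys h1).2 v).trans ?_
  have hyp : y ∈ (chartAt ℂ p).source := by rwa [discChart_source] at hys
  have hb : chartAt (ℂ × ℂ) (embedding l q p y) (embedding l q p y) = (chartAt ℂ y y, (0 : ℂ)) := by
    rw [coe_embedding, chartAt_curve l q hy, outerChart_curve l q hy]
  have h0 : HasDerivAt (discChart p ∘ (chartAt ℂ y).symm) (chartDeriv p y * (discRadius p : ℂ)⁻¹)
      (chartAt ℂ y y) :=
    ((hasDerivAt_chart hyp).sub_const _).mul_const _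
  have h2 : HasFDerivAt
      (fun c : ℂ × ℂ => (discChart p ((chartAt ℂ y).symm c.1), c.2)) _
      (chartAt ℂ y y, (0 : ℂ)) :=
    (HasFDerivAt.comp (g := discChart p ∘ (chartAt ℂ y).symm) (f := Prod.fst)
      (chartAt ℂ y y, (0 : ℂ)) h0.hasFDerivAt hasFDerivAt_fst).prodMk hasFDerivAt_snd
  have h3 : (fun c : ℂ × ℂ => (discChart p ((chartAt ℂ y).symm c.1), c.2)) (chartAt ℂ y y, (0 : ℂ)) =
      (discChart p y, 0) := by
    simp only [(chartAt ℂ y).left_inv (mem_chart_source ℂ y)]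
  have hz := discChart_ne_zero hys hy
  have h4 : HasFDerivAt (twistMap l q) (fderiv ℂ (twistMap l q) (discChart p y, 0))
      ((fun c : ℂ × ℂ => (discChart p ((chartAt ℂ y).symm c.1), c.2)) (chartAt ℂ y y, (0 : ℂ))) := by
    rw [h3]
    exact (analyticAt_twistMap l q (a := (discChart p y, 0)) hz).differentiableAt.hasFDerivAt
  have h : chartAt (ℂ × ℂ) (embedding l q p p) ∘ (chartAt (ℂ × ℂ) (embedding l q p y)).symm
      =ᶠ[𝓝 (chartAt ℂ y y, (0 : ℂ))]
        twistMap l q ∘ (fun c : ℂ × ℂ => (discChart p ((chartAt ℂ y).symm c.1), c.2)) := by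
    have h5 : ∀ᶠ c in 𝓝 (chartAt ℂ y y, (0 : ℂ)),
        ((chartAt ℂ y).symm c.1, c.2) ∈ (transition p l q).source := by
      refine (continuousAt_chart_symm_prod y).eventually ((transition p l q).open_source.eventually_mem ?_)
      simp only [(chartAt ℂ y).left_inv (mem_chart_source ℂ y)]
      exact mk_zero_mem_transition l q hy hys h1
    filter_upwards [eventually_mem_outerPiece l hy, h5] with c hc hct
    rw [Function.comp_apply, coe_embedding, coe_embedding, chartAt_curve_self l q,
      chartAt_curve l q hy, outerChart_symm_apply, inner_outer_symm hc hct, transition_apply]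
    rfl
  rw [hb, h.fderiv_eq, (HasFDerivAt.comp (chartAt ℂ y y, (0 : ℂ)) h4 h2).fderiv]
  show fderiv ℂ (twistMap l q) (discChart p y, 0) (_, _) = _
  rw [fderiv_twistMap l q hz]
  simp [mul_comm, mul_left_comm]

end Tangent

end TwistedSurface

/-! ### Orders of sections -/

theorem meromorphicAt_mul_const_zpow (c r : ℂ) (n : ℤ) :
    MeromorphicAt (fun z : ℂ => ((z - c) * r) ^ n) c :=
  MeromorphicAt.zpow (f := fun z : ℂ => (z - c) * r) (by fun_prop) n

theorem meromorphicOrderAt_mul_const_zpow (c : ℂ) {r : ℂ} (hr : r ≠ 0) (n : ℤ) :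
    meromorphicOrderAt (fun z : ℂ => ((z - c) * r) ^ n) c = n := by
  rw [meromorphicOrderAt_eq_int_iff (meromorphicAt_mul_const_zpow c r n)]
  exact ⟨fun _ => r ^ n, analyticAt_const, zpow_ne_zero n hr,
    Eventually.of_forall fun z => by rw [mul_zpow, smul_eq_mul]⟩

section Order

variable {C : Type u} [TopologicalSpace C] [ChartedSpace ℂ C] [IsManifold 𝓘(ℂ) ω C]
  {S : Type v} [TopologicalSpace S] [ChartedSpace (ℂ × ℂ) S] [IsManifold 𝓘(ℂ, ℂ × ℂ) ω S]

theorem eventually_chart_symm {x : C} {P : C → Prop} (h : ∀ᶠ y in 𝓝 x, P y) :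
    ∀ᶠ z in 𝓝 (chartAt ℂ x x), P ((chartAt ℂ x).symm z) :=
  ((chartAt ℂ x).tendsto_symm (mem_chart_source ℂ x)).eventually h

theorem eventually_chart_symm_nhdsNE {x : C} {P : C → Prop} (h : ∀ᶠ y in 𝓝[≠] x, P y) :
    ∀ᶠ z in 𝓝[≠] (chartAt ℂ x x), P ((chartAt ℂ x).symm z) :=
  ((chartAt ℂ x).eventually_comp_symm_iff (mem_chart_source ℂ x)).2 h

theorem localExpr_normalClass_eventually (i : HolomorphicEmbedding C S)
    (w : ∀ y : C, TangentSpace 𝓘(ℂ, ℂ × ℂ) (i y)) (x : C) :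
    ∀ᶠ z in 𝓝 (chartAt ℂ x x), localExpr (CurveNormalSpace i) (fun y => normalClass i y (w y)) x z =
      normalForm i x ((chartAt ℂ x).symm z) (w ((chartAt ℂ x).symm z)) := by
  have hx : x ∈ normalDomain i x := ⟨mem_chart_source ℂ x, mem_chart_source (ℂ × ℂ) (i x)⟩
  filter_upwards [eventually_chart_symm ((isOpen_normalDomain i x).eventually_mem hx)] with z hz
  exact localExpr_normalClass i w hz

/-- The coordinates of a holomorphic vector field along the curve are holomorphic. -/
theorem analyticAt_surfCoord (i : HolomorphicEmbedding C S)
    {L : ∀ y : S, Submodule ℂ (TangentSpace 𝓘(ℂ, ℂ × ℂ) y)} {V : Set S}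
    {v : ∀ y : S, TangentSpace 𝓘(ℂ, ℂ × ℂ) y} (hv : IsGenerator L V v) {x : C} (hx : i x ∈ V) :
    AnalyticAt ℂ (fun z => surfCoord (i x) (i ((chartAt ℂ x).symm z)) (v (i ((chartAt ℂ x).symm z))))
      (chartAt ℂ x x) := by
  have h1 := (hv.holomorphic.contMDiffAt (hv.isOpen.mem_nhds hx)).comp x (i.contMDiff x)
  have h2 := (contMDiffAt_totalSpace.1 h1).2
  have h3 : ContMDiffAt 𝓘(ℂ) 𝓘(ℂ) ω (chartAt ℂ x).symm (chartAt ℂ x x) :=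
    contMDiffOn_chart_symm.contMDiffAt ((chartAt ℂ x).open_target.mem_nhds (mem_chart_target ℂ x))
  have e1 := (chartAt ℂ x).left_inv (mem_chart_source ℂ x)
  have h4 := (ContMDiffAt.comp_of_eq h2 h3 e1).contDiffAt
  refine h4.analyticAt.congr ?_
  have hev : ∀ᶠ y in 𝓝 x, i y ∈ (chartAt (ℂ × ℂ) (i x)).source :=
    (i.contMDiff x).continuousAt.eventually
      ((chartAt (ℂ × ℂ) (i x)).open_source.eventually_mem (mem_chart_source _ _))
  filter_upwards [eventually_chart_symm hev] with z hz
  exact (Trivialization.continuousLinearMapAt_apply_of_mem ℂ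
    (trivializationAt (ℂ × ℂ) (TangentSpace 𝓘(ℂ, ℂ × ℂ) : S → Type) (i x)) hz _).symm

theorem isTransverse_iff_normalForm_ne_zero (i : HolomorphicEmbedding C S)
    {L : ∀ y : S, Submodule ℂ (TangentSpace 𝓘(ℂ, ℂ × ℂ) y)} {V : Set S}
    {v : ∀ y : S, TangentSpace 𝓘(ℂ, ℂ × ℂ) y} (hv : IsGenerator L V v) {x₀ x : C} (hx : i x ∈ V)
    (hx₀ : x ∈ normalDomain i x₀) :
    L (i x) ⊓ tangentLine i x = ⊥ ↔ normalForm i x₀ x (v (i x)) ≠ 0 := by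
  rw [Ne, normalForm_eq_zero_iff i hx₀, hv.span_eq _ hx, ← disjoint_iff, disjoint_comm,
    Submodule.disjoint_span_singleton' (hv.ne_zero _ hx)]

end Order

/-! ### The self-intersection number and the degree of vector fields -/

namespace TwistedSurface

section Degree

variable {C : Type u} [TopologicalSpace C] [ChartedSpace ℂ C] [T2Space C] [CompactSpace C]
  [IsManifold 𝓘(ℂ) ω C] (p : C) (l q : ℤ)

theorem chartDeriv_ne_zero {x y : C} (hy : y ∈ (chartAt ℂ x).source) : chartDeriv x y ≠ 0 := by
  have h1 := hasDerivAt_chart hy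
  have h2 := (contDiffAt_chart_comp_symm x y ((chartAt ℂ x).map_source hy)
    (by rw [(chartAt ℂ x).left_inv hy]; exact mem_chart_source ℂ y)).differentiableAt (by simp)
  have e1 : (chartAt ℂ x ∘ (chartAt ℂ y).symm) (chartAt ℂ y y) = chartAt ℂ x y := by
    rw [Function.comp_apply, (chartAt ℂ y).left_inv (mem_chart_source ℂ y)]
  have h3 := HasDerivAt.comp_of_eq (chartAt ℂ y y) h2.hasDerivAt h1 e1.symm
  have h4 : (chartAt ℂ y ∘ (chartAt ℂ x).symm) ∘ (chartAt ℂ x ∘ (chartAt ℂ y).symm)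
      =ᶠ[𝓝 (chartAt ℂ y y)] id := by
    filter_upwards [eventually_chart_symm ((chartAt ℂ x).open_source.eventually_mem hy),
      (chartAt ℂ y).open_target.eventually_mem (mem_chart_target ℂ y)] with z hz hzt
    simp [(chartAt ℂ x).left_inv hz, (chartAt ℂ y).right_inv hzt]
  have h5 := (h3.congr_of_eventuallyEq h4.symm).unique (hasDerivAt_id _)
  exact right_ne_zero_of_mul_eq_one h5

/-- The coordinate vector field `∂/∂w` of the outer piece induces a section of the normal bundle
whose divisor is `(q + l) p`. -/
theorem hasSelfIntersection : HasSelfIntersection (embedding l q p) (q + l) := by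
  set i := embedding l q p with hi
  set w : ∀ y : C, TangentSpace 𝓘(ℂ, ℂ × ℂ) (i y) := fun _ => ((0 : ℂ), (1 : ℂ)) with hw
  have hne : ∀ x ≠ p, localExpr (CurveNormalSpace i) (fun y => normalClass i y (w y)) x
      =ᶠ[𝓝[≠] (chartAt ℂ x x)] fun _ => 1 := by
    intro x hx
    filter_upwards [nhdsWithin_le_nhds (localExpr_normalClass_eventually i w x),
      nhdsWithin_le_nhds (eventually_chart_symm (eventually_ne_and_mem hx))] with z hz hz2
    rw [hz]
    refine (congrArg₂ detTwo (surfCoord_curveFrame l q hx hz2.1 hz2.2)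
      (surfCoord_outer l q hx hz2.1 hz2.2 (0, 1))).trans ?_
    simp [detTwo]
  have hp : localExpr (CurveNormalSpace i) (fun y => normalClass i y (w y)) p
      =ᶠ[𝓝[≠] (chartAt ℂ p p)] fun z => (discRadius p : ℂ)⁻¹ *
        ((z - chartAt ℂ p p) * (discRadius p : ℂ)⁻¹) ^ (q + l) := by
    filter_upwards [nhdsWithin_le_nhds (localExpr_normalClass_eventually i w p),
      nhdsWithin_le_nhds (eventually_chart_symm (eventually_mem_disc p)),
      eventually_chart_symm_nhdsNE (x := p) self_mem_nhdsWithin,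
      nhdsWithin_le_nhds ((chartAt ℂ p).open_target.mem_nhds (mem_chart_target ℂ p))]
      with z hz hz2 hzp hzt
    rw [hz]
    refine (congrArg₂ detTwo (surfCoord_curveFrame_self l q hz2.1 hz2.2)
      (surfCoord_inner l q hzp hz2.1 hz2.2 (0, 1))).trans ?_
    simp [detTwo, discChart_apply, (chartAt ℂ p).right_inv hzt]
  have hr := inv_ne_zero (discRadius_ne_zero p)
  have ho : ∀ x ≠ p, sectionOrder (CurveNormalSpace i) (fun y => normalClass i y (w y)) x = 0 := by
    intro x hx
    rw [sectionOrder, meromorphicOrderAt_congr (hne x hx), meromorphicOrderAt_const]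
    simp
  have hop : sectionOrder (CurveNormalSpace i) (fun y => normalClass i y (w y)) p =
      ((q + l : ℤ) : WithTop ℤ) := by
    rw [sectionOrder, meromorphicOrderAt_congr hp]
    refine (meromorphicOrderAt_mul_of_ne_zero (g := fun _ => (discRadius p : ℂ)⁻¹)
      analyticAt_const hr).trans ?_
    exact meromorphicOrderAt_mul_const_zpow _ hr _
  refine ⟨fun y => normalClass i y (w y), fun x => ?_, fun x => ?_, ?_, ?_⟩
  · by_cases hx : x = p
    · subst hx
      exact ((MeromorphicAt.const _ _).mul (meromorphicAt_mul_const_zpow _ _ _)).congr hp.symm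
    · exact (MeromorphicAt.const _ _).congr (hne x hx).symm
  · by_cases hx : x = p
    · rw [hx, hop]
      exact WithTop.coe_ne_top
    · rw [ho x hx]
      exact WithTop.zero_ne_top
  · refine (finite_singleton p).subset fun x hx => ?_
    by_contra hxp
    exact hx (ho x hxp)
  · rw [finsum_eq_single _ p fun x hx => by rw [ho x hx]; rfl, hop, WithTop.untop₀_coe]

/-- The expression in the preferred chart at `x` of the vector field on the curve whose value at
`y`, read in the preferred chart at `y`, is `b y`. -/
def vectorExpr (b : C → ℂ) (x : C) (z : ℂ) : ℂ :=
  chartDeriv x ((chartAt ℂ x).symm z) * b ((chartAt ℂ x).symm z)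

theorem exists_vectorExpr_of_hasDegree {D : ℤ}
    (hD : HasDegree (fun x : C => TangentSpace 𝓘(ℂ) x) D) :
    ∃ s : C → ℂ, (∀ x, MeromorphicAt (vectorExpr s x) (chartAt ℂ x x)) ∧
      (∀ x, meromorphicOrderAt (vectorExpr s x) (chartAt ℂ x x) ≠ ⊤) ∧
      {x | meromorphicOrderAt (vectorExpr s x) (chartAt ℂ x x) ≠ 0}.Finite ∧
      ∑ᶠ x, (meromorphicOrderAt (vectorExpr s x) (chartAt ℂ x x)).untop₀ = D := by
  obtain ⟨s, hs, hst, hsf, hsum⟩ := hD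
  have h : ∀ x, localExpr (fun x : C => TangentSpace 𝓘(ℂ) x) s x = vectorExpr (fun y => (s y : ℂ)) x :=
    fun x => funext fun z => localExpr_tangent (fun y => (s y : ℂ))
  refine ⟨fun y => (s y : ℂ), fun x => h x ▸ hs x, fun x => h x ▸ hst x, ?_, ?_⟩
  · simp only [← h]
    exact hsf
  · simp only [← h]
    exact hsum

variable {p}

/-- A meromorphic vector field on the curve without poles away from `p` vanishes at `p` to an order
at most the degree of the tangent bundle: the quotient of two vector fields is a meromorphic
function, whose divisor has degree zero. -/
theorem order_vectorExpr_le [ConnectedSpace C] {D : ℤ}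
    (hD : HasDegree (fun x : C => TangentSpace 𝓘(ℂ) x) D) {b : C → ℂ}
    (hb : ∀ x, MeromorphicAt (vectorExpr b x) (chartAt ℂ x x))
    (hp : meromorphicOrderAt (vectorExpr b p) (chartAt ℂ p p) ≠ ⊤)
    (hnn : ∀ x ≠ p, 0 ≤ meromorphicOrderAt (vectorExpr b x) (chartAt ℂ x x)) :
    (meromorphicOrderAt (vectorExpr b p) (chartAt ℂ p p)).untop₀ ≤ D := by
  obtain ⟨s, hs, hst, hsf, rfl⟩ := exists_vectorExpr_of_hasDegree hD
  set ob : C → WithTop ℤ := fun x => meromorphicOrderAt (vectorExpr b x) (chartAt ℂ x x) with hob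
  set os : C → WithTop ℤ := fun x => meromorphicOrderAt (vectorExpr s x) (chartAt ℂ x x) with hos
  set f : C → ℂ := fun x => b x / s x with hf
  have hfe : ∀ x, f ∘ (chartAt ℂ x).symm =ᶠ[𝓝[≠] (chartAt ℂ x x)]
      vectorExpr b x / vectorExpr s x := by
    intro x
    filter_upwards [nhdsWithin_le_nhds (eventually_chart_symm
      ((chartAt ℂ x).open_source.eventually_mem (mem_chart_source ℂ x)))] with z hz
    exact (mul_div_mul_left _ _ (chartDeriv_ne_zero hz)).symm
  have hfm : IsMeromorphic f := fun x => ((hb x).div (hs x)).congr (hfe x).symm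
  have hfo : ∀ x, orderAt f x + os x = ob x := fun x => by
    have h1 : orderAt f x = ob x + -os x := by
      rw [orderAt, meromorphicOrderAt_congr (hfe x), div_eq_mul_inv,
        meromorphicOrderAt_mul (hb x) (hs x).inv, meromorphicOrderAt_inv]
    obtain ⟨k, hk⟩ := WithTop.ne_top_iff_exists.1 (hst x)
    have hk' : os x = (k : WithTop ℤ) := hk.symm
    rw [h1, hk', add_assoc, ← WithTop.LinearOrderedAddCommGroup.coe_neg, ← WithTop.coe_add,
      neg_add_cancel, WithTop.coe_zero, add_zero]
  have hft : ∀ x, orderAt f x ≠ ⊤ := by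
    refine hfm.orderAt_ne_top_of_exists (x := p) fun h => hp ?_
    rw [← show ob p = meromorphicOrderAt (vectorExpr b p) (chartAt ℂ p p) from rfl, ← hfo, h, top_add]
  have hsum : ∀ x, (ob x).untop₀ = (orderAt f x).untop₀ + (os x).untop₀ := fun x => by
    rw [← hfo, WithTop.untop₀_add (hft x) (hst x)]
  have hfin1 : (Function.support fun x => (orderAt f x).untop₀).Finite := by
    refine (hfm.finite_orderAt_ne_zero hft).subset fun x hx hx0 => hx ?_
    simp [hx0]
  have hfin2 : (Function.support fun x => (os x).untop₀).Finite := by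
    refine hsf.subset fun x hx hx0 => hx ?_
    exact (congrArg WithTop.untop₀ (show os x = 0 from hx0)).trans rfl
  have hfin3 : (Function.support fun x => (ob x).untop₀).Finite := by
    refine (hfin1.union hfin2).subset fun x hx => ?_
    by_contra hcon
    simp only [mem_union, Function.mem_support, not_or, not_not] at hcon
    exact hx (by simp only [hsum, hcon.1, hcon.2, add_zero])
  have htot : ∑ᶠ x, (ob x).untop₀ = ∑ᶠ x, (os x).untop₀ := by
    rw [finsum_congr hsum, finsum_add_distrib hfin1 hfin2, hfm.finsum_orderAt_eq_zero hft, zero_add]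
  rw [← htot]
  classical
  rw [finsum_eq_sum_of_support_subset (s := insert p hfin3.toFinset) _ (by
    intro x hx
    simp only [Finset.coe_insert, Finite.coe_toFinset]
    exact Or.inr hx)]
  rw [← Finset.add_sum_erase _ _ (Finset.mem_insert_self p _)]
  refine le_add_of_nonneg_right (Finset.sum_nonneg fun x hx => ?_)
  exact WithTop.untop₀_nonneg.2 (hnn x (Finset.ne_of_mem_erase hx))

end Degree

end TwistedSurface

/-! ### Foliations transverse to the curve away from a point -/

namespace TwistedSurface

section Obstruction

variable {C : Type u} [TopologicalSpace C] [ChartedSpace ℂ C] [T2Space C] [CompactSpace C]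
  [IsManifold 𝓘(ℂ) ω C] {p : C} (l q : ℤ)

/-- The slope `v₁ / v₂` of a line in `ℂ²` spanned by `v`. It takes the junk value `0` on the line
`v₂ = 0`. -/
def lineSlope (L : Submodule ℂ (ℂ × ℂ)) : ℂ :=
  open Classical in
  if h : ∃ v : ℂ × ℂ, L = Submodule.span ℂ {v} then h.choose.1 / h.choose.2 else 0

theorem lineSlope_span (v : ℂ × ℂ) : lineSlope (Submodule.span ℂ {v}) = v.1 / v.2 := by
  have h : ∃ w : ℂ × ℂ, Submodule.span ℂ {v} = Submodule.span ℂ {w} := ⟨v, rfl⟩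
  rw [lineSlope, dif_pos h]
  obtain ⟨c, hc⟩ := (Submodule.span_singleton_eq_span_singleton).1 h.choose_spec
  rw [← hc]
  exact (mul_div_mul_left v.1 v.2 c.ne_zero)

/-- A line field on the surface induces a vector field on the curve minus `p`: its lines, where they
are transverse to the curve, are spanned by the vectors `b ∂/∂z + ∂/∂w`. -/
def slopeField {U : Set (TwistedSurface p l q)} (F : RegularFoliation U) (y : C) : ℂ :=
  lineSlope (F.line (embedding l q p y))

variable {l q} {U : Set (TwistedSurface p l q)} (F : RegularFoliation U)
  {V : Set (TwistedSurface p l q)}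
  {v : ∀ y : TwistedSurface p l q, TangentSpace 𝓘(ℂ, ℂ × ℂ) y}

theorem slopeField_eq (hv : IsGenerator F.line V v) {y : C} (hy : embedding l q p y ∈ V) :
    slopeField l q F y = (v (embedding l q p y) : ℂ × ℂ).1 / (v (embedding l q p y) : ℂ × ℂ).2 :=
  (congrArg lineSlope (hv.span_eq _ hy)).trans (lineSlope_span _)

variable (v) in
/-- The coordinates of the vector field `v` along the curve, in the preferred charts at `x`. -/
def alongCurve (x : C) (z : ℂ) : ℂ × ℂ :=
  surfCoord (embedding l q p x) (embedding l q p ((chartAt ℂ x).symm z))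
    (v (embedding l q p ((chartAt ℂ x).symm z)))

theorem eventually_embedding_mem (hv : IsGenerator F.line V v) {x : C}
    (hx : embedding l q p x ∈ V) : ∀ᶠ y in 𝓝 x, embedding l q p y ∈ V :=
  ((embedding l q p).contMDiff x).continuousAt.eventually (hv.isOpen.eventually_mem hx)

theorem normalForm_eq_alongCurve {x : C} (hx : x ≠ p) {z : ℂ} (hz : (chartAt ℂ x).symm z ≠ p)
    (hzx : (chartAt ℂ x).symm z ∈ (chartAt ℂ x).source) :
    normalForm (embedding l q p) x ((chartAt ℂ x).symm z)
      (v (embedding l q p ((chartAt ℂ x).symm z))) = (alongCurve v x z).2 := by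
  refine (congrArg (fun a => detTwo a (alongCurve v x z))
    (surfCoord_curveFrame l q hx hz hzx)).trans ?_
  simp [detTwo]

theorem normalForm_eq_alongCurve_self {z : ℂ} (hz : (chartAt ℂ p).symm z ∈ (discChart p).source)
    (h1 : ‖discChart p ((chartAt ℂ p).symm z)‖ < 1) :
    normalForm (embedding l q p) p ((chartAt ℂ p).symm z)
      (v (embedding l q p ((chartAt ℂ p).symm z))) =
        (discRadius p : ℂ)⁻¹ * (alongCurve v p z).2 := by
  refine (congrArg (fun a => detTwo a (alongCurve v p z))
    (surfCoord_curveFrame_self l q hz h1)).trans ?_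
  simp [detTwo]

/-- Away from `p`, the induced vector field is holomorphic where the foliation is transverse to the
curve. -/
theorem analyticAt_vectorExpr_slopeField (hv : IsGenerator F.line V v) {x : C} (hx : x ≠ p)
    (hxV : embedding l q p x ∈ V) (ht : F.IsTransverseAt (embedding l q p) x) :
    AnalyticAt ℂ (vectorExpr (slopeField l q F) x) (chartAt ℂ x x) := by
  have ha : AnalyticAt ℂ (alongCurve v x) (chartAt ℂ x x) := analyticAt_surfCoord _ hv hxV
  have e1 := (chartAt ℂ x).left_inv (mem_chart_source ℂ x)
  have hne : (alongCurve v x (chartAt ℂ x x)).2 ≠ 0 := by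
    rw [← normalForm_eq_alongCurve hx (by rwa [e1]) (by rw [e1]; exact mem_chart_source ℂ x), e1]
    exact (isTransverse_iff_normalForm_ne_zero _ hv hxV
      (mem_normalDomain l q hx hx (mem_chart_source ℂ x))).1 ht
  have hd : AnalyticAt ℂ (fun z => (alongCurve v x z).1 / (alongCurve v x z).2) (chartAt ℂ x x) :=
    (analyticAt_fst.comp ha).div (analyticAt_snd.comp ha) hne
  refine hd.congr ?_
  filter_upwards [eventually_chart_symm (eventually_ne_and_mem hx),
    eventually_chart_symm (eventually_embedding_mem F hv hxV)] with z hz hzV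
  rw [vectorExpr, slopeField_eq F hv hzV,
    show alongCurve v x z = _ from surfCoord_outer l q hx hz.1 hz.2 _, mul_div_assoc]

/-- At a point where the induced normal section has finite order `n`, the second coordinate of a
generator vanishes to order `n`. -/
theorem meromorphicOrderAt_alongCurve_snd {k : WithTop ℤ}
    (hk : sectionOrder (CurveNormalSpace (embedding l q p))
      (fun y => normalClass (embedding l q p) y (v (embedding l q p y))) p = k) :
    meromorphicOrderAt (fun z => (alongCurve v p z).2) (chartAt ℂ p p) = k := by
  rw [← hk, sectionOrder]
  have h : localExpr (CurveNormalSpace (embedding l q p))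
      (fun y => normalClass (embedding l q p) y (v (embedding l q p y))) p
      =ᶠ[𝓝[≠] (chartAt ℂ p p)] fun z => (discRadius p : ℂ)⁻¹ * (alongCurve v p z).2 := by
    filter_upwards [nhdsWithin_le_nhds (localExpr_normalClass_eventually (embedding l q p)
      (fun y => v (embedding l q p y)) p),
      nhdsWithin_le_nhds (eventually_chart_symm (eventually_mem_disc p))] with z hz hz2
    rw [hz, normalForm_eq_alongCurve_self hz2.1 hz2.2]
  rw [meromorphicOrderAt_congr h]
  exact (meromorphicOrderAt_mul_of_ne_zero (g := fun _ => (discRadius p : ℂ)⁻¹)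
    analyticAt_const (inv_ne_zero (discRadius_ne_zero p))).symm

/-- If the order of tangency at `p` is small, the induced vector field vanishes to order `l + 1` at
`p`: the gluing map adds the vector field `-ζ ^ (l + 1) ∂/∂ζ` to a field of higher order. -/
theorem meromorphicOrderAt_slopeField {n : ℕ} (hn : (n : ℤ) + 1 < q)
    (hv : IsGenerator F.line V v) (hpV : embedding l q p p ∈ V)
    (hk : sectionOrder (CurveNormalSpace (embedding l q p))
      (fun y => normalClass (embedding l q p) y (v (embedding l q p y))) p = ((n : ℤ) : WithTop ℤ)) :
    MeromorphicAt (vectorExpr (slopeField l q F) p) (chartAt ℂ p p) ∧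
    meromorphicOrderAt (vectorExpr (slopeField l q F) p) (chartAt ℂ p p) =
      ((l + 1 : ℤ) : WithTop ℤ) := by
  have ha : AnalyticAt ℂ (alongCurve v p) (chartAt ℂ p p) := analyticAt_surfCoord _ hv hpV
  have ha1 : AnalyticAt ℂ (fun z => (alongCurve v p z).1) (chartAt ℂ p p) :=
    analyticAt_fst.comp ha
  have ha2 : AnalyticAt ℂ (fun z => (alongCurve v p z).2) (chartAt ℂ p p) :=
    analyticAt_snd.comp ha
  have ho := meromorphicOrderAt_alongCurve_snd hk
  have hne := (meromorphicOrderAt_ne_top_iff_eventually_ne_zero ha2.meromorphicAt).1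
    (by rw [ho]; exact WithTop.coe_ne_top)
  have hr := discRadius_ne_zero p
  set ζ : ℤ → ℂ → ℂ := fun j z => ((z - chartAt ℂ p p) * (discRadius p : ℂ)⁻¹) ^ j with hζ
  have hζm : ∀ j, MeromorphicAt (ζ j) (chartAt ℂ p p) := meromorphicAt_mul_const_zpow _ _
  have hζo : ∀ j, meromorphicOrderAt (ζ j) (chartAt ℂ p p) = (j : WithTop ℤ) :=
    meromorphicOrderAt_mul_const_zpow _ (inv_ne_zero hr)
  -- Solving the formula of `surfCoord_inner` for the slope gives `A + B`, where `A` has the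
  -- lower order.
  set A : ℂ → ℂ := (fun _ => -(discRadius p : ℂ)) * ζ (l + 1) with hA
  set B : ℂ → ℂ := (fun _ => (discRadius p : ℂ)) *
    (ζ (q + l) * ((fun z => (alongCurve v p z).1) * (fun z => (alongCurve v p z).2)⁻¹)) with hB
  have hfe : vectorExpr (slopeField l q F) p =ᶠ[𝓝[≠] (chartAt ℂ p p)] A + B := by
    filter_upwards [nhdsWithin_le_nhds (eventually_chart_symm (eventually_mem_disc p)),
      eventually_chart_symm_nhdsNE (x := p) self_mem_nhdsWithin, hne,
      nhdsWithin_le_nhds (eventually_chart_symm (eventually_embedding_mem F hv hpV)),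
      nhdsWithin_le_nhds ((chartAt ℂ p).open_target.mem_nhds (mem_chart_target ℂ p))]
      with z hz hzp hz0 hzV hzt
    have e1 : alongCurve v p z = _ := surfCoord_inner l q hzp hz.1 hz.2 _
    have e2 : discChart p ((chartAt ℂ p).symm z) =
        (z - chartAt ℂ p p) * (discRadius p : ℂ)⁻¹ := by
      rw [discChart_apply, (chartAt ℂ p).right_inv hzt]
    have hψ := discChart_ne_zero hz.1 hzp
    rw [e1] at hz0
    have hv2 := right_ne_zero_of_mul hz0
    have hzq := left_ne_zero_of_mul hz0
    simp only [hA, hB, hζ, Pi.add_apply, Pi.mul_apply, Pi.inv_apply, ← e2]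
    rw [vectorExpr, slopeField_eq F hv hzV, e1]
    field_simp
    ring
  have hAm : MeromorphicAt A (chartAt ℂ p p) := (MeromorphicAt.const _ _).mul (hζm _)
  have hBm : MeromorphicAt B (chartAt ℂ p p) := (MeromorphicAt.const _ _).mul
    ((hζm _).mul (ha1.meromorphicAt.mul ha2.meromorphicAt.inv))
  have hAo : meromorphicOrderAt A (chartAt ℂ p p) = ((l + 1 : ℤ) : WithTop ℤ) := by
    rw [hA, meromorphicOrderAt_mul_of_ne_zero analyticAt_const (neg_ne_zero.2 hr), hζo]
  have hBo : ((l + 1 : ℤ) : WithTop ℤ) < meromorphicOrderAt B (chartAt ℂ p p) := by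
    rw [hB, meromorphicOrderAt_mul_of_ne_zero analyticAt_const hr,
      meromorphicOrderAt_mul (hζm _) (ha1.meromorphicAt.mul ha2.meromorphicAt.inv),
      meromorphicOrderAt_mul ha1.meromorphicAt ha2.meromorphicAt.inv, hζo, meromorphicOrderAt_inv,
      ho]
    have h0 := ha1.meromorphicOrderAt_nonneg
    cases h1 : meromorphicOrderAt (fun z => (alongCurve v p z).1) (chartAt ℂ p p) with
    | top => rw [top_add, add_top]; exact WithTop.coe_lt_top _
    | coe k =>
      rw [h1] at h0
      have h0' : 0 ≤ k := by exact_mod_cast h0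
      rw [← WithTop.LinearOrderedAddCommGroup.coe_neg, ← WithTop.coe_add, ← WithTop.coe_add,
        WithTop.coe_lt_coe]
      omega
  refine ⟨(hAm.add hBm).congr hfe.symm, ?_⟩
  rw [meromorphicOrderAt_congr hfe, meromorphicOrderAt_add_eq_left_of_lt hBm (by rwa [hAo]), hAo]

/-- The induced vector field would have more zeros than the degree of the tangent bundle allows. -/
theorem not_hasTangencyOrder [ConnectedSpace C]
    (hl : HasDegree (fun x : C => TangentSpace 𝓘(ℂ) x) l) (hU : range (embedding l q p) ⊆ U)
    {n : ℕ} (hn : (n : ℤ) + 1 < q) (ht : ∀ x ≠ p, F.IsTransverseAt (embedding l q p) x) :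
    ¬ F.HasTangencyOrder (embedding l q p) p n := by
  rintro ⟨V, v, hpV, -, hv, hk⟩
  obtain ⟨h1, h2⟩ := meromorphicOrderAt_slopeField F hn hv hpV hk
  have h3 : ∀ x ≠ p, AnalyticAt ℂ (vectorExpr (slopeField l q F) x) (chartAt ℂ x x) := by
    intro x hx
    obtain ⟨V', v', hxV', -, hv'⟩ := F.exists_generator _ (hU (mem_range_self x))
    exact analyticAt_vectorExpr_slopeField F hv' hx hxV' (ht x hx)
  have h4 := order_vectorExpr_le (p := p) hl (b := slopeField l q F) (fun x => by
    by_cases hx : x = p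
    · rw [hx]
      exact h1
    · exact (h3 x hx).meromorphicAt) (by rw [h2]; exact WithTop.coe_ne_top)
    (fun x hx => (h3 x hx).meromorphicOrderAt_nonneg)
  rw [h2, WithTop.untop₀_coe] at h4
  omega

/-- A foliation transverse to the curve at `p` has order of tangency zero. -/
theorem hasTangencyOrder_zero (hU : range (embedding l q p) ⊆ U)
    (ht : F.IsTransverseAt (embedding l q p) p) : F.HasTangencyOrder (embedding l q p) p 0 := by
  obtain ⟨V, v, hpV, hVU, hv⟩ := F.exists_generator _ (hU (mem_range_self p))
  refine ⟨V, v, hpV, hVU, hv, ?_⟩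
  have ha : AnalyticAt ℂ (alongCurve v p) (chartAt ℂ p p) := analyticAt_surfCoord _ hv hpV
  have e1 := (chartAt ℂ p).left_inv (mem_chart_source ℂ p)
  have hd := eventually_mem_disc p
  have hne : (alongCurve v p (chartAt ℂ p p)).2 ≠ 0 := by
    refine right_ne_zero_of_mul (a := (discRadius p : ℂ)⁻¹) ?_
    rw [← normalForm_eq_alongCurve_self (by rw [e1]; exact hd.self_of_nhds.1)
      (by rw [e1]; exact hd.self_of_nhds.2), e1]
    exact (isTransverse_iff_normalForm_ne_zero _ hv hpV
      (mem_normalDomain_self l q hd.self_of_nhds.1 hd.self_of_nhds.2)).1 ht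
  have h := meromorphicOrderAt_alongCurve_snd (v := v) rfl
  rw [← h]
  have ha2 : AnalyticAt ℂ (fun z => (alongCurve v p z).2) (chartAt ℂ p p) :=
    analyticAt_snd.comp ha
  rw [ha2.meromorphicOrderAt_eq, ha2.analyticOrderAt_eq_zero.2 hne]
  rfl

end Obstruction

end TwistedSurface

/-! ### Linearizable neighbourhoods carry a transverse foliation -/

section LevelFoliation

variable {C : Type u} [TopologicalSpace C] [ChartedSpace ℂ C] [IsManifold 𝓘(ℂ) ω C]
  {S : Type v} [TopologicalSpace S] [ChartedSpace (ℂ × ℂ) S] [IsManifold 𝓘(ℂ, ℂ × ℂ) ω S]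

theorem apply_eq_zero_iff_of_ne_zero {L : ℂ × ℂ →L[ℂ] ℂ} (hL : L ≠ 0) (c : ℂ × ℂ) :
    L c = 0 ↔ ∃ a : ℂ, a • (-L (0, 1), L (1, 0)) = c := by
  have h : ∀ c : ℂ × ℂ, L c = c.1 * L (1, 0) + c.2 * L (0, 1) := by
    intro c
    rw [← smul_eq_mul, ← smul_eq_mul, ← map_smul, ← map_smul, ← map_add]
    simp
  constructor
  · intro hc
    have hne : (-L (0, 1), L (1, 0)) ≠ (0 : ℂ × ℂ) := by
      intro h0
      rw [Prod.mk_eq_zero, neg_eq_zero] at h0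
      refine hL (ContinuousLinearMap.ext fun c => ?_)
      rw [h, h0.1, h0.2]
      simp
    obtain ⟨a, ha⟩ := detTwo_ker (b := c) hne (by
      rw [h] at hc
      simp only [detTwo]
      linear_combination -hc)
    exact ⟨a, ha.symm⟩
  · rintro ⟨a, rfl⟩
    rw [map_smul, h]
    simp only [smul_eq_mul]
    ring

theorem surfCoord_injective {y₀ y : S} (hy : y ∈ (chartAt (ℂ × ℂ) y₀).source) :
    Function.Injective (surfCoord y₀ y) := by
  have hS : y ∈ (trivializationAt (ℂ × ℂ)
      (TangentSpace 𝓘(ℂ, ℂ × ℂ) : S → Type) y₀).baseSet := hy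
  intro a b hab
  have h1 := congrArg ((trivializationAt (ℂ × ℂ)
    (TangentSpace 𝓘(ℂ, ℂ × ℂ) : S → Type) y₀).symmL ℂ y) hab
  rwa [Trivialization.symmL_continuousLinearMapAt _ hS,
    Trivialization.symmL_continuousLinearMapAt _ hS] at h1

/-- The expression of a map from the surface to the curve in the preferred charts at `y₀` and `f
y₀`. -/
def chartExpr (f : S → C) (y₀ : S) : ℂ × ℂ → ℂ :=
  chartAt ℂ (f y₀) ∘ f ∘ (chartAt (ℂ × ℂ) y₀).symm

theorem mfderiv_eq_zero_iff_chartExpr {f : S → C} {y₀ y : S}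
    (hf : MDifferentiableAt 𝓘(ℂ, ℂ × ℂ) 𝓘(ℂ) f y) (hy : y ∈ (chartAt (ℂ × ℂ) y₀).source)
    (hfy : f y ∈ (chartAt ℂ (f y₀)).source)
    (hG : DifferentiableAt ℂ (chartExpr f y₀) (chartAt (ℂ × ℂ) y₀ y))
    (w : TangentSpace 𝓘(ℂ, ℂ × ℂ) y) :
    mfderiv 𝓘(ℂ, ℂ × ℂ) 𝓘(ℂ) f y w = 0 ↔
      fderiv ℂ (chartExpr f y₀) (chartAt (ℂ × ℂ) y₀ y) (surfCoord y₀ y w) = 0 := by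
  have d1 : MDifferentiableAt 𝓘(ℂ) 𝓘(ℂ) (extChartAt 𝓘(ℂ) (f y₀)) (f y) :=
    mdifferentiableAt_extChartAt hfy
  have d2 : MDifferentiableAt 𝓘(ℂ, ℂ × ℂ) 𝓘(ℂ, ℂ × ℂ) (extChartAt 𝓘(ℂ, ℂ × ℂ) y₀) y :=
    mdifferentiableAt_extChartAt hy
  have e1 := TangentBundle.continuousLinearMapAt_trivializationAt (I := 𝓘(ℂ)) hfy
  have e2 := TangentBundle.continuousLinearMapAt_trivializationAt (I := 𝓘(ℂ, ℂ × ℂ)) hy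
  have h1 := HasMFDerivAt.comp y d1.hasMFDerivAt hf.hasMFDerivAt
  have h2 := HasMFDerivAt.comp (g := chartExpr f y₀) y hG.hasFDerivAt.hasMFDerivAt d2.hasMFDerivAt
  have h3 : chartExpr f y₀ ∘ extChartAt 𝓘(ℂ, ℂ × ℂ) y₀ =ᶠ[𝓝 y] extChartAt 𝓘(ℂ) (f y₀) ∘ f := by
    filter_upwards [(chartAt (ℂ × ℂ) y₀).open_source.eventually_mem hy] with z hz
    show chartAt ℂ (f y₀) (f ((chartAt (ℂ × ℂ) y₀).symm (chartAt (ℂ × ℂ) y₀ z))) = _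
    rw [(chartAt (ℂ × ℂ) y₀).left_inv hz]
    rfl
  have h4 := hasMFDerivAt_unique h2 (h1.congr_of_eventuallyEq h3)
  rw [← e1, ← e2] at h4
  have h5 := congrArg (fun L : ℂ × ℂ →L[ℂ] ℂ => L w) h4
  have hC : f y ∈ (trivializationAt ℂ (TangentSpace 𝓘(ℂ) : C → Type) (f y₀)).baseSet := hfy
  constructor
  · intro h0
    refine h5.trans ?_
    refine (congrArg ((trivializationAt ℂ (TangentSpace 𝓘(ℂ) : C → Type)
      (f y₀)).continuousLinearMapAt ℂ (f y)) h0).trans (map_zero _)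
  · intro h0
    have h6 := congrArg ((trivializationAt ℂ (TangentSpace 𝓘(ℂ) : C → Type) (f y₀)).symmL ℂ (f y))
      (h5.symm.trans h0)
    rw [map_zero] at h6
    refine Eq.trans ?_ h6
    exact (Trivialization.symmL_continuousLinearMapAt (R := ℂ) _ hC _).symm

/-- The kernels of the differential of a holomorphic map to a curve form a regular foliation at the
points where this differential does not vanish. -/
theorem exists_isGenerator_ker_mfderiv {f : S → C} {O : Set S} (hO : IsOpen O)
    (hf : ContMDiffOn 𝓘(ℂ, ℂ × ℂ) 𝓘(ℂ) ω f O) {y₀ : S} (hy₀ : y₀ ∈ O)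
    (h0 : mfderiv 𝓘(ℂ, ℂ × ℂ) 𝓘(ℂ) f y₀ ≠ 0) :
    ∃ V v, y₀ ∈ V ∧ V ⊆ {y | y ∈ O ∧ mfderiv 𝓘(ℂ, ℂ × ℂ) 𝓘(ℂ) f y ≠ 0} ∧
      IsGenerator (fun y => LinearMap.ker (mfderiv 𝓘(ℂ, ℂ × ℂ) 𝓘(ℂ) f y).toLinearMap) V v := by
  set T := chartAt (ℂ × ℂ) y₀ with hT
  set W : Set S := (O ∩ f ⁻¹' (chartAt ℂ (f y₀)).source) ∩ T.source with hW
  have hWo : IsOpen W := (hf.continuousOn.isOpen_inter_preimage hO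
    (chartAt ℂ (f y₀)).open_source).inter T.open_source
  have hyW : y₀ ∈ W := ⟨⟨hy₀, mem_chart_source ℂ _⟩, mem_chart_source _ _⟩
  set W' : Set (ℂ × ℂ) := T.target ∩ T.symm ⁻¹' W with hW'
  have hWo' : IsOpen W' := T.isOpen_inter_preimage_symm hWo
  have hTW : ∀ y ∈ W, T y ∈ W' := fun y hy =>
    ⟨T.map_source hy.2, by rw [mem_preimage, T.left_inv hy.2]; exact hy⟩
  have hG : ContDiffOn ℂ ω (chartExpr f y₀) W' := by
    rw [← contMDiffOn_iff_contDiffOn]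
    refine (contMDiffOn_chart (I := 𝓘(ℂ)) (x := f y₀)).comp (hf.comp
      ((contMDiffOn_chart_symm (I := 𝓘(ℂ, ℂ × ℂ)) (x := y₀)).mono inter_subset_left) ?_) ?_
    · exact fun c hc => hc.2.1.1
    · exact fun c hc => hc.2.1.2
  have hG' : ContDiffOn ℂ ω (fderiv ℂ (chartExpr f y₀)) W' := hG.fderiv_of_isOpen hWo' (by simp)
  set L : S → ℂ × ℂ →L[ℂ] ℂ := fun y => fderiv ℂ (chartExpr f y₀) (T y) with hL
  have hLs : ContMDiffOn 𝓘(ℂ, ℂ × ℂ) 𝓘(ℂ, ℂ × ℂ →L[ℂ] ℂ) ω L W :=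
    (contMDiffOn_iff_contDiffOn.2 hG').comp ((contMDiffOn_chart (I := 𝓘(ℂ, ℂ × ℂ))
      (x := y₀)).mono inter_subset_right) hTW
  have hmf : ∀ y ∈ W, ∀ w : TangentSpace 𝓘(ℂ, ℂ × ℂ) y,
      mfderiv 𝓘(ℂ, ℂ × ℂ) 𝓘(ℂ) f y w = 0 ↔ L y (surfCoord y₀ y w) = 0 := fun y hy =>
    mfderiv_eq_zero_iff_chartExpr
      ((hf.contMDiffAt (hO.mem_nhds hy.1.1)).mdifferentiableAt (by simp)) hy.2 hy.1.2
      ((hG.contDiffAt (hWo'.mem_nhds (hTW y hy))).differentiableAt (by simp))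
  set e := trivializationAt (ℂ × ℂ) (TangentSpace 𝓘(ℂ, ℂ × ℂ) : S → Type) y₀ with he
  have hsymm : ∀ y ∈ W, ∀ c : ℂ × ℂ, surfCoord y₀ y (e.symmL ℂ y c) = c := fun y hy c =>
    Trivialization.continuousLinearMapAt_symmL e (show y ∈ e.baseSet from hy.2) c
  have hne : ∀ y ∈ W, mfderiv 𝓘(ℂ, ℂ × ℂ) 𝓘(ℂ) f y ≠ 0 ↔ L y ≠ 0 := by
    intro y hy
    rw [not_iff_not]
    constructor
    · intro h
      refine ContinuousLinearMap.ext fun c => ?_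
      have := (hmf y hy (e.symmL ℂ y c)).1 (by rw [h]; rfl)
      rwa [hsymm y hy] at this
    · intro h
      refine ContinuousLinearMap.ext fun w => ?_
      exact (hmf y hy w).2 (by rw [h]; rfl)
  set V : Set S := W ∩ L ⁻¹' {0}ᶜ with hV
  have hVo : IsOpen V := hLs.continuousOn.isOpen_inter_preimage hWo isOpen_compl_singleton
  set a : S → ℂ × ℂ := fun y => (-L y (0, 1), L y (1, 0)) with ha
  have has : ContMDiffOn 𝓘(ℂ, ℂ × ℂ) 𝓘(ℂ, ℂ × ℂ) ω a W := by
    have s1 : ContMDiffOn 𝓘(ℂ, ℂ × ℂ) 𝓘(ℂ) ω (fun y => -L y (0, 1)) W :=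
      (hLs.clm_apply contMDiffOn_const).neg
    have s2 : ContMDiffOn 𝓘(ℂ, ℂ × ℂ) 𝓘(ℂ) ω (fun y => L y (1, 0)) W :=
      hLs.clm_apply contMDiffOn_const
    exact s1.prodMk_space s2
  refine ⟨V, fun y => e.symmL ℂ y (a y), ⟨hyW, (hne y₀ hyW).1 h0⟩,
    fun y hy => ⟨hy.1.1.1, (hne y hy.1).2 hy.2⟩, hVo, ?_, ?_, ?_⟩
  · refine (e.contMDiffOn_section_iff (IB := 𝓘(ℂ, ℂ × ℂ)) (n := ω) hVo
      (fun y hy => hy.1.2)).2 ((has.mono inter_subset_left).congr fun y hy => ?_)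
    refine Eq.trans ?_ (hsymm y hy.1 (a y))
    exact (Trivialization.continuousLinearMapAt_apply_of_mem ℂ e
      (show y ∈ e.baseSet from hy.1.2) _).symm
  · intro y hy h
    have h1 := hsymm y hy.1 (a y)
    rw [h, map_zero] at h1
    obtain ⟨h2, h3⟩ := Prod.mk_eq_zero.1 h1.symm
    refine hy.2 (ContinuousLinearMap.ext fun c => ?_)
    have h4 : c = c.1 • ((1 : ℂ), (0 : ℂ)) + c.2 • ((0 : ℂ), (1 : ℂ)) := by simp
    rw [h4, map_add, map_smul, map_smul, h3, neg_eq_zero.1 h2]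
    simp
  · intro y hy
    ext w
    rw [Submodule.mem_span_singleton]
    refine (hmf y hy.1 w).trans ((apply_eq_zero_iff_of_ne_zero hy.2 _).trans
      (exists_congr fun c => ?_))
    rw [← (surfCoord_injective (y₀ := y₀) hy.1.2).eq_iff, map_smul, hsymm y hy.1]

/-- The regular foliation whose leaves are the level sets of a holomorphic map to a curve, defined
where the differential of this map does not vanish. -/
def levelFoliation {f : S → C} {O : Set S} (hO : IsOpen O)
    (hf : ContMDiffOn 𝓘(ℂ, ℂ × ℂ) 𝓘(ℂ) ω f O) :
    RegularFoliation {y | y ∈ O ∧ mfderiv 𝓘(ℂ, ℂ × ℂ) 𝓘(ℂ) f y ≠ 0} where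
  line y := LinearMap.ker (mfderiv 𝓘(ℂ, ℂ × ℂ) 𝓘(ℂ) f y).toLinearMap
  exists_generator _ hy := exists_isGenerator_ker_mfderiv hO hf hy.1 hy.2

/-- The fibres of the normal bundle define a foliation transverse to the zero section. -/
theorem IsLinearizable.exists_transverse_foliation {i : HolomorphicEmbedding C S}
    (h : IsLinearizable i) :
    ∃ U : Set S, IsOpen U ∧ range i ⊆ U ∧ ∃ F : RegularFoliation U, ∀ x, F.IsTransverseAt i x := by
  obtain ⟨e, hs, hi, he, he'⟩ := h
  set f : S → C := fun y => (e y).proj with hf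
  have hfs : ContMDiffOn 𝓘(ℂ, ℂ × ℂ) 𝓘(ℂ) ω f e.source :=
    (contMDiff_proj (CurveNormalSpace i)).comp_contMDiffOn he
  have hx : ∀ x, i x ∈ e.source := fun x => hs (mem_range_self x)
  have dz : ContMDiff 𝓘(ℂ) (𝓘(ℂ).prod 𝓘(ℂ)) ω (zeroSection ℂ (CurveNormalSpace i)) :=
    contMDiff_zeroSection ℂ (CurveNormalSpace i)
  have hz : ∀ x, zeroSection ℂ (CurveNormalSpace i) (f (i x)) = e (i x) := by
    intro x
    obtain ⟨c, hc⟩ : e (i x) ∈ range (zeroSection ℂ (CurveNormalSpace i)) :=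
      hi ▸ mem_image_of_mem _ (mem_range_self x)
    rw [hf]
    simp only [← hc]
    rfl
  -- The embedding factors through `f ∘ i`, so the differential of `f ∘ i` is injective.
  have hinj : ∀ x, ∀ t : TangentSpace 𝓘(ℂ) x,
      mfderiv 𝓘(ℂ, ℂ × ℂ) 𝓘(ℂ) f (i x) (mfderiv 𝓘(ℂ) 𝓘(ℂ, ℂ × ℂ) i x t) = 0 → t = 0 := by
    intro x t ht
    have di : MDifferentiableAt 𝓘(ℂ) 𝓘(ℂ, ℂ × ℂ) i x := (i.contMDiff x).mdifferentiableAt (by simp)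
    have df : MDifferentiableAt 𝓘(ℂ, ℂ × ℂ) 𝓘(ℂ) f (i x) :=
      (hfs.contMDiffAt (e.open_source.mem_nhds (hx x))).mdifferentiableAt (by simp)
    have dg : MDifferentiableAt 𝓘(ℂ) 𝓘(ℂ, ℂ × ℂ)
        (e.symm ∘ zeroSection ℂ (CurveNormalSpace i)) (f (i x)) := by
      refine MDifferentiableAt.comp (I' := 𝓘(ℂ).prod 𝓘(ℂ)) _ ?_
        ((dz _).mdifferentiableAt (by simp))
      rw [hz]
      exact (he'.contMDiffAt (e.open_target.mem_nhds (e.map_source (hx x)))).mdifferentiableAt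
        (by simp)
    have hc : i.toFun = (e.symm ∘ zeroSection ℂ (CurveNormalSpace i)) ∘ (f ∘ i) := by
      funext y
      simp only [Function.comp_apply]
      rw [hz, e.left_inv (hx y)]
    have h1 := (dg.hasMFDerivAt.comp x (df.hasMFDerivAt.comp x di.hasMFDerivAt)).mfderiv
    rw [← hc] at h1
    refine i.mfderiv_injective x ?_
    rw [map_zero]
    have h2 := congrArg (fun L : ℂ →L[ℂ] ℂ × ℂ => L t) h1
    refine h2.trans ?_
    refine (congrArg (mfderiv 𝓘(ℂ) 𝓘(ℂ, ℂ × ℂ)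
      (e.symm ∘ zeroSection ℂ (CurveNormalSpace i)) (f (i x))) ht).trans (map_zero _)
  -- The foliation is defined on the open set where the projection to the curve is a submersion.
  refine ⟨_, ?_, ?_, levelFoliation e.open_source hfs, ?_⟩
  · rw [isOpen_iff_mem_nhds]
    intro y hy
    obtain ⟨V, v, hyV, hV, hv⟩ := (levelFoliation e.open_source hfs).exists_generator y hy
    exact mem_of_superset (hv.isOpen.mem_nhds hyV) hV
  · rintro _ ⟨x, rfl⟩
    refine ⟨hx x, fun h0 => ?_⟩
    have := hinj x (1 : ℂ) (by rw [h0]; rfl)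
    exact one_ne_zero (α := ℂ) this
  · intro x
    refine (Submodule.eq_bot_iff _).2 ?_
    rintro _ ⟨hw, t, rfl⟩
    have : t = 0 := hinj x t hw
    rw [this]
    exact map_zero _

end LevelFoliation
end

theorem mainTheorem9 (m : ℕ) (hm : 1 ≤ m)
    (C : Type u) [TopologicalSpace C] [T2Space C] [CompactSpace C] [ConnectedSpace C]
    [ChartedSpace ℂ C] [IsManifold 𝓘(ℂ) ω C]
    (g : ℕ) (hg : HasGenus C g) (p : C) (d : ℤ) (hd : (m : ℤ) + 2 - 2 * (g : ℤ) < d) :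
    ∃ (S : Type u) (_ : TopologicalSpace S) (_ : T2Space S) (_ : SecondCountableTopology S)
      (_ : ConnectedSpace S) (_ : ChartedSpace (ℂ × ℂ) S) (_ : IsManifold 𝓘(ℂ, ℂ × ℂ) ω S)
      (i : HolomorphicEmbedding C S),
      HasSelfIntersection i d ∧
      (∀ (U : Set S), IsOpen U → range i ⊆ U → ∀ (F : RegularFoliation U) (n : ℕ), n < m →
        ¬ ((∀ x : C, x ≠ p → F.IsTransverseAt i x) ∧ F.HasTangencyOrder i p n)) ∧
      (m = 1 →
        (∀ (U : Set S), IsOpen U → range i ⊆ U → ∀ F : RegularFoliation U,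
          ¬ ∀ x : C, F.IsTransverseAt i x) ∧
        ¬ IsLinearizable i) := by
  -- The bound on `d` says that `n + 1 < d - l` for `n < m`.
  set l : ℤ := 2 - 2 * (g : ℤ) with hl
  have hobs : ∀ (U : Set (TwistedSurface p l (d - l))), IsOpen U →
      range (TwistedSurface.embedding l (d - l) p) ⊆ U → ∀ (F : RegularFoliation U) (n : ℕ), n < m →
        ¬ ((∀ x : C, x ≠ p → F.IsTransverseAt (TwistedSurface.embedding l (d - l) p) x) ∧
          F.HasTangencyOrder (TwistedSurface.embedding l (d - l) p) p n) :=
    fun U _ hU F n hn h => TwistedSurface.not_hasTangencyOrder F hg hU (by omega) h.1 h.2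
  have htrans : ∀ (U : Set (TwistedSurface p l (d - l))), IsOpen U →
      range (TwistedSurface.embedding l (d - l) p) ⊆ U → ∀ F : RegularFoliation U,
        ¬ ∀ x : C, F.IsTransverseAt (TwistedSurface.embedding l (d - l) p) x :=
    fun U hUo hU F h => hobs U hUo hU F 0 (by omega)
      ⟨fun x _ => h x, TwistedSurface.hasTangencyOrder_zero F hU (h p)⟩
  refine ⟨TwistedSurface p l (d - l), inferInstance, inferInstance, inferInstance,
    TwistedSurface.connectedSpace l (d - l), inferInstance, inferInstance,
    TwistedSurface.embedding l (d - l) p, ?_, hobs, fun _ => ⟨htrans, fun hlin => ?_⟩⟩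
  · have h := TwistedSurface.hasSelfIntersection p l (d - l)
    rwa [sub_add_cancel] at h
  · obtain ⟨U, hUo, hU, F, hF⟩ := hlin.exists_transverse_foliation
    exact htrans U hUo hU F hF
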